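/- \textbf{Setting.} Let $\lambda,\nu,\mu,\kappa,\alpha,\beta,\gamma,\tau$ be real constants with $\lambda>\nu>0$, $\mu>0$, $\kappa>0$, $\tilde\alpha:=\alpha+\tfrac{4\beta}{3}>0$, $\tilde\gamma:=\beta+\gamma>0$ and $\tau>0$. Let $\mathbb{T}^3=\mathbb{R}^3/(2\pi\mathbb{Z})^3$, $d=\frac{\tau}{2\kappa}$ and $J_{eq}=\operatorname{diag}(\lambda,\lambda,\nu)$. For $k\in\mathbb{R}^3$ let $P_\parallel(k)=\frac{k\otimes k}{|k|^2}$ if $k\neq0$, $P_\parallel(0)=0$, and $P_\perp(k)=I-P_\parallel(k)$; let $k\times$ also denote the matrix of $z\mapsto k\times z$. Let $R=R_{22}=\begin{pmatrix}0&-1\\1&0\end{pmatrix}$, and let $R_{23},R_{32},R_{33}$ be the $2\times3$, $3\times2$, $3\times3$ matrices obtained from $R$ by adding zero rows and columns at the end. Put $$\hat{\mathcal B}_k=\begin{pmatrix}-(\mu+\frac{\kappa}{2})|k|^2P_\perp(k)& i\kappa k\times&0\\ J_{eq}^{-1}(i\kappa k\times)P_\perp(k)& -2\kappa J_{eq}^{-1}-\tilde\alpha|k|^2J_{eq}^{-1}P_\parallel(k)-\tilde\gamma|k|^2J_{eq}^{-1}P_\perp(k)-(1-\frac{\nu}{\lambda})d\,R_{33}&-\frac{1}{\lambda}d^2R_{32}\\0&(\lambda-\nu)R_{23}&d\,R_{22}\end{pmatrix}\in\mathbb{C}^{8\times8}$$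 and $M_k=Q_k\hat{\mathcal B}_k\bar Q_k$, where $Q_k=T(k)\oplus J_{eq}^{1/2}\oplus sR_{22}$, $\bar Q_k=T(k)\oplus J_{eq}^{-1/2}\oplus(-s^{-1})R_{22}$, $T(k)=\frac{ik\times}{|k|}$ for $k\ne0$, $T(0)=0$, $s=-\frac{d}{\sqrt{\lambda-\nu}}$. Write the elements of $L^2:=L^2(\mathbb{T}^3,\mathbb{R}^8)\times L^2(\mathbb{T}^3,\mathbb{R}^{2\times2})\times L^2(\mathbb{T}^3,\mathbb{R})$ as $X=(f,\bar J,J_{33})$ with $f=(u,\omega,a)\in\mathbb{R}^3\times\mathbb{R}^3\times\mathbb{R}^2$. Let $\mathcal B$ be the differential operator with symbol $\hat{\mathcal B}_k$, let $\mathcal L=\mathcal B\oplus d\,[R,\cdot\,]\oplus0$ (where $\mathcal{L}X$ is defined in the sense of distributions, as an element of $L^2$ whenever it belongs to $L^2$), and for $t\geq0$ let $$e^{t\mathcal L}(f,\bar J,J_{33})=(e^{t\mathcal B}f,\;e^{t\,d[R,\cdot]}\bar J,\;J_{33}),\qquad \widehat{e^{t\mathcal B}f}(k)=e^{t\hat{\mathcal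 B}_k}\hat f(k)\quad(k\in\mathbb{Z}^3).$$ For $s\ge0$ let $\|g\|_{H^s}^2=\sum_k(1+|k|^2)^s|\hat g(k)|^2$ and, for $p,q,r\ge0$, let $H^{p,q,r}=H^p(\mathbb{T}^3,\mathbb{R}^8)\times H^q(\mathbb{T}^3,\mathbb{R}^{2\times2})\times H^r(\mathbb{T}^3,\mathbb{R})$ with $\|(f,\bar J,J_{33})\|_{H^{p,q,r}}^2=\|f\|_{H^p}^2+\|\bar J\|_{H^q}^2+\|J_{33}\|_{H^r}^2$. Let $\mathbb{P}_L$ be the Leray projector, with symbol $P_\perp(k)$, and let $\mathfrak D=H^2(\mathbb{T}^3,\mathbb{R}^6)\times L^2(\mathbb{T}^3,\mathbb{R}^2)\times L^2(\mathbb{T}^3,\mathbb{R}^{2\times2})\times L^2(\mathbb{T}^3,\mathbb{R})$, i.e. $u,\omega\in H^2$. \textbf{Statement.} The real parts of the eigenvalues of the matrices $M_k$, $k\in\mathbb{Z}^3$, have a largest element $\eta_*$, and $\eta_*>0$. For every $t\ge0$, $e^{t\mathcal L}$ is a well-defined bounded operator on $L^2$, and: (1) $(e^{t\mathcal L})_{t\ge0}$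 is a strongly continuous semigroup on $L^2$, and its generator is $\mathcal L$: one has $\lim_{t\to0^+}\frac1t(e^{t\mathcal L}X-X)=X'$ in $L^2$ if and only if $X'=\mathcal LX$. The domain of the generator is the set of all $X\in L^2$ with $\mathbb{P}_Lu\in H^2$ and $\omega\in H^2$. In particular it contains $\mathfrak D$, and an $X\in L^2$ with $u$ incompressible belongs to it if and only if $X\in\mathfrak D$. (2) For every $\varepsilon>0$ there is a constant $C_S(\varepsilon)>0$ such that for every $t\ge0$, with respect to the norm $\|X\|^2_{L^2}=\|f\|^2_{L^2}+\|\bar J\|^2_{L^2}+\|J_{33}\|^2_{L^2}$, $\|e^{t\mathcal L}X\|_{L^2}^2\le C_S(\varepsilon)^2e^{2(\eta_*+\varepsilon)t}\|X\|_{L^2}^2$ for all $X\in L^2$, and such that for all $p,q,r\ge0$ and $t\ge0$, $e^{t\mathcal L}$ maps $H^{p,q,r}$ to itself with $\|e^{t\mathcal L}X\|_{H^{p,q,r}}^2\le C_S(\varepsilon)^2e^{2(\eta_*+\varepsilon)t}\|X\|_{H^{p,q,r}}^2$. (3) If $u$ is incompressible in the sense of distributions, then so is the velocity component of $e^{t\mathcal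 L}X$ for every $t\geq0$. -/

import Mathlib

open scoped ENNReal NNReal ContDiff Topology Matrix

noncomputable section

namespace Micropolar

/-! ### The torus, Fourier coefficients and Sobolev norms -/

instance factTwoPiPos : Fact (0 < 2 * Real.pi) := ⟨Real.two_pi_pos⟩

/-- The torus `ℝ³ / (2πℤ)³`; its measure `volume` is Lebesgue measure, of total mass `(2π)³`. -/
abbrev Torus : Type := Fin 3 → AddCircle (2 * Real.pi)

/-- `L²` of the torus with values in the Euclidean space `ℝⁿ`. -/
abbrev L2 (n : Type) [Fintype n] : Type :=
  MeasureTheory.Lp (EuclideanSpace ℝ n) 2 (MeasureTheory.volume : MeasureTheory.Measure Torus)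

/-- The character `x ↦ exp (i k · x)` of the torus. -/
def character (k : Fin 3 → ℤ) (x : Torus) : ℂ := ∏ j, fourier (k j) (x j)

/-- The Fourier coefficients of a family of real functions on the torus, normalised to be unitary:
`(2π)^(-3/2) ∫ exp (-i k · x) f_i(x) dx`. -/
def fourierHat {n : Type} (f : Torus → n → ℝ) (k : Fin 3 → ℤ) (i : n) : ℂ :=
  ((Real.sqrt ((2 * Real.pi) ^ 3))⁻¹ : ℝ) * ∫ x : Torus, character (-k) x * (f x i : ℂ)

/-- The integer wavenumber `k`, seen in `ℝ³`. -/
def wave (k : Fin 3 → ℤ) : Fin 3 → ℝ := fun j => (k j : ℝ)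

/-- `∑_k ⟨k⟩^(2s) |c_k|²`, with `⟨k⟩² = 1 + |k|²`. -/
def hatNormSq {n : Type} [Fintype n] (s : ℝ) (c : (Fin 3 → ℤ) → n → ℂ) : ℝ≥0∞ :=
  ∑' k, ENNReal.ofReal ((1 + wave k ⬝ᵥ wave k) ^ s * ∑ i, ‖c k i‖ ^ 2)

/-- The square of the `H^s` norm of an `ℝⁿ`-valued function (infinite if it is not in `H^s`). -/
def sobolevNormSq {n : Type} [Fintype n] (s : ℝ) (f : Torus → n → ℝ) : ℝ≥0∞ :=
  hatNormSq s (fourierHat f)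

/-- Smooth real functions on the torus. -/
def IsSmooth (φ : Torus → ℝ) : Prop :=
  ContDiff ℝ ∞ (fun y : Fin 3 → ℝ => φ (fun i => (y i : AddCircle (2 * Real.pi))))

/-- The partial derivative `∂_j φ` on the torus. -/
def partialD (j : Fin 3) (φ : Torus → ℝ) (x : Torus) : ℝ :=
  deriv (fun h : ℝ => φ (x + Pi.single j (h : AddCircle (2 * Real.pi)))) 0

/-- `∇ · u = 0` in the sense of distributions. -/
def Incompressible (u : Torus → Fin 3 → ℝ) : Prop :=
  ∀ φ : Torus → ℝ, IsSmooth φ → ∫ x : Torus, ∑ j, u x j * partialD j φ x = 0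

/-! ### One-parameter semigroups on a Banach space -/

section Semigroup

variable {E : Type*} [NormedAddCommGroup E] [NormedSpace ℝ E]

/-- `(S t)_{t ≥ 0}` is a strongly continuous semigroup of bounded operators. -/
structure IsC0Semigroup (S : ℝ≥0 → E →L[ℝ] E) : Prop where
  zero : S 0 = ContinuousLinearMap.id ℝ E
  add : ∀ t s, S (t + s) = (S t).comp (S s)
  continuous : ∀ x, Continuous fun t => S t x

/-- `(x, y)` is in the graph of the generator of `S`: `(S t x - x) / t → y` as `t → 0+`.
The domain of the generator is the set of the `x` for which there is such a `y`. -/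
def GeneratorMaps (S : ℝ≥0 → E →L[ℝ] E) (x y : E) : Prop :=
  Filter.Tendsto (fun t : ℝ≥0 => (t : ℝ)⁻¹ • (S t x - x)) (𝓝[>] 0) (𝓝 y)

end Semigroup

/-! ### Linear algebra -/

/-- A real matrix, seen as a complex one. -/
def toC {m n : Type} (A : Matrix m n ℝ) : Matrix m n ℂ := A.map (fun x : ℝ => (x : ℂ))

/-- The orthogonal projection onto the span of `k` (zero for `k = 0`). -/
def projPar (k : Fin 3 → ℝ) : Matrix (Fin 3) (Fin 3) ℝ := (k ⬝ᵥ k)⁻¹ • Matrix.vecMulVec k k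

/-- The orthogonal projection onto the orthogonal complement of `k` (the identity for `k = 0`). -/
def projPerp (k : Fin 3 → ℝ) : Matrix (Fin 3) (Fin 3) ℝ := 1 - projPar k

/-- The matrix of `z ↦ k × z`. -/
def crossMat (k : Fin 3 → ℝ) : Matrix (Fin 3) (Fin 3) ℝ :=
  !![0, -k 2, k 1; k 2, 0, -k 0; -k 1, k 0, 0]

def R22 : Matrix (Fin 2) (Fin 2) ℝ := !![0, -1; 1, 0]
def R23 : Matrix (Fin 2) (Fin 3) ℝ := !![0, -1, 0; 1, 0, 0]
def R32 : Matrix (Fin 3) (Fin 2) ℝ := !![0, -1; 1, 0; 0, 0]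
def R33 : Matrix (Fin 3) (Fin 3) ℝ := !![0, -1, 0; 1, 0, 0; 0, 0, 0]

/-- The operator `J ↦ [A, J] = A J - J A` on `ℝ^{2 × 2}` with the Frobenius norm. -/
def commutator (A : Matrix (Fin 2) (Fin 2) ℝ) :
    EuclideanSpace ℝ (Fin 2 × Fin 2) →L[ℝ] EuclideanSpace ℝ (Fin 2 × Fin 2) :=
  LinearMap.toContinuousLinearMap
    { toFun := fun J => WithLp.toLp 2 fun ij =>
        ∑ l, (A ij.1 l * J (l, ij.2) - J (ij.1, l) * A l ij.2)
      map_add' := by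
        intro J J'
        ext ij
        simp only [PiLp.add_apply, ← Finset.sum_add_distrib]
        exact Finset.sum_congr rfl fun l _ => by ring
      map_smul' := by
        intro c J
        ext ij
        simp only [PiLp.smul_apply, smul_eq_mul, RingHom.id_apply, Finset.mul_sum]
        exact Finset.sum_congr rfl fun l _ => by ring }

/-! ### The linearized problem -/

/-- The physical constants `λ, ν, μ, κ, α, β, γ, τ`. -/
structure Params where
  lam : ℝ
  nu : ℝ
  mu : ℝ
  kappa : ℝ
  alpha : ℝ
  beta : ℝ
  gamma : ℝ
  tau : ℝ

/-- The eight components `(u, ω, a)`. -/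
abbrev Idx : Type := Fin 3 ⊕ (Fin 3 ⊕ Fin 2)

/-- The state space `L²(𝕋³; ℝ⁸) × L²(𝕋³; ℝ^{2 × 2}) × L²(𝕋³; ℝ)` of the `((u, ω, a), J̄, J₃₃)`. -/
abbrev State : Type :=
  L2 Idx × L2 (Fin 2 × Fin 2) ×
    MeasureTheory.Lp ℝ 2 (MeasureTheory.volume : MeasureTheory.Measure Torus)

namespace State

/-- The component `(u, ω, a)`. -/
def y (X : State) : Torus → Idx → ℝ := fun x i => X.1 x i

/-- The velocity `u`. -/
def u (X : State) : Torus → Fin 3 → ℝ := fun x i => X.1 x (Sum.inl i)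

/-- The angular velocity `ω`. -/
def omega (X : State) : Torus → Fin 3 → ℝ := fun x i => X.1 x (Sum.inr (Sum.inl i))

/-- The component `J̄`. -/
def jBar (X : State) : Torus → Fin 2 × Fin 2 → ℝ := fun x ij => X.2.1 x ij

/-- The component `J₃₃`. -/
def j33 (X : State) : Torus → Unit → ℝ := fun x _ => X.2.2 x

/-- The square of the `L²` norm. -/
def l2NormSq (X : State) : ℝ := ‖X.1‖ ^ 2 + ‖X.2.1‖ ^ 2 + ‖X.2.2‖ ^ 2

/-- The square of the `H^{p,q,r}` norm; `X` is in `H^{p,q,r}` if and only if this is finite. -/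
def hNormSq (p q r : ℝ) (X : State) : ℝ≥0∞ :=
  sobolevNormSq p X.y + sobolevNormSq q X.jBar + sobolevNormSq r X.j33

/-- `X` is in `H²(𝕋³; ℝ⁶) × L²(𝕋³; ℝ²) × L²(𝕋³; ℝ^{2 × 2}) × L²(𝕋³; ℝ)`: `u` and `ω` are `H²`. -/
def InDomain (X : State) : Prop :=
  sobolevNormSq 2 X.u < ⊤ ∧ sobolevNormSq 2 X.omega < ⊤

/-- The Leray projection of `u`, whose symbol is `projPerp`, is in `H²`, and `ω` is in `H²`. -/
def InLerayDomain (X : State) : Prop :=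
  hatNormSq 2 (fun k => toC (projPerp (wave k)) *ᵥ fourierHat X.u k) < ⊤ ∧
    sobolevNormSq 2 X.omega < ⊤

end State

namespace Params

/-- The equilibrium angular speed `τ / (2κ)`. -/
def speed (P : Params) : ℝ := P.tau / (2 * P.kappa)

/-- `J_eq⁻¹`, for `J_eq = diag (λ, λ, ν)`. -/
def jInv (P : Params) : Matrix (Fin 3) (Fin 3) ℝ :=
  Matrix.diagonal ![P.lam⁻¹, P.lam⁻¹, P.nu⁻¹]

/-- The symbol `B̂_k` of the `(u, ω, a)` block of the Leray-projected linearized operator. -/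
def symbolB (P : Params) (k : Fin 3 → ℝ) : Matrix Idx Idx ℂ :=
  Matrix.fromBlocks
    (toC (-((P.mu + P.kappa / 2) * (k ⬝ᵥ k)) • projPerp k))
    (Matrix.fromCols (Complex.I • toC (P.kappa • crossMat k)) 0)
    (Matrix.fromRows (Complex.I • toC (P.jInv * (P.kappa • crossMat k) * projPerp k)) 0)
    (toC (Matrix.fromBlocks
      (-(2 * P.kappa) • P.jInv
        - ((P.alpha + 4 * P.beta / 3) * (k ⬝ᵥ k)) • (P.jInv * projPar k)
        - ((P.beta + P.gamma) * (k ⬝ᵥ k)) • (P.jInv * projPerp k)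
        - ((1 - P.nu / P.lam) * P.speed) • R33)
      (-(P.lam⁻¹ * P.speed ^ 2) • R32)
      ((P.lam - P.nu) • R23)
      (P.speed • R22)))

/-- `T(k) = i k × / |k|`, and `T(0) = 0`. -/
def symbolT (k : Fin 3 → ℝ) : Matrix (Fin 3) (Fin 3) ℂ :=
  Complex.I • toC ((Real.sqrt (k ⬝ᵥ k))⁻¹ • crossMat k)

/-- The constant `s = -(λ - ν)^(-1/2) τ / (2κ)`. -/
def sConst (P : Params) : ℝ := -(Real.sqrt (P.lam - P.nu))⁻¹ * P.speed

/-- `Q_k = T(k) ⊕ J_eq^{1/2} ⊕ s R`. -/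
def matQ (P : Params) (k : Fin 3 → ℝ) : Matrix Idx Idx ℂ :=
  Matrix.fromBlocks (symbolT k) 0 0 (toC (Matrix.fromBlocks
    (Matrix.diagonal ![Real.sqrt P.lam, Real.sqrt P.lam, Real.sqrt P.nu]) 0 0
    (P.sConst • R22)))

/-- `Q̄_k = T(k) ⊕ J_eq^{-1/2} ⊕ (-s⁻¹) R`. -/
def matQBar (P : Params) (k : Fin 3 → ℝ) : Matrix Idx Idx ℂ :=
  Matrix.fromBlocks (symbolT k) 0 0 (toC (Matrix.fromBlocks
    (Matrix.diagonal ![(Real.sqrt P.lam)⁻¹, (Real.sqrt P.lam)⁻¹, (Real.sqrt P.nu)⁻¹]) 0 0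
    (-P.sConst⁻¹ • R22)))

/-- `M_k = Q_k B̂_k Q̄_k`. -/
def matM (P : Params) (k : Fin 3 → ℝ) : Matrix Idx Idx ℂ :=
  P.matQ k * P.symbolB k * P.matQBar k

/-- The real parts of all eigenvalues of all `M_k`, `k ∈ ℤ³`. -/
def growthRates (P : Params) : Set ℝ :=
  {x | ∃ (k : Fin 3 → ℤ) (w : ℂ),
    Module.End.HasEigenvalue (Matrix.toLin' (P.matM (wave k))) w ∧ w.re = x}

/-- The operator `[Ω̄_eq, ·] = (τ / 2κ) [R, ·]` on `ℝ^{2 × 2}`. -/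
def bracket (P : Params) : EuclideanSpace ℝ (Fin 2 × Fin 2) →L[ℝ] EuclideanSpace ℝ (Fin 2 × Fin 2) :=
  commutator (P.speed • R22)

/-- `X' = e^{tL} X`, where `e^{tL}` is the direct sum of the Fourier multiplier `exp (t B̂_k)`, of
`exp (t [Ω̄_eq, ·])` and of the identity. -/
def IsFlow (P : Params) (t : ℝ) (X X' : State) : Prop :=
  (∀ k : Fin 3 → ℤ,
    fourierHat X'.y k = NormedSpace.exp ((t : ℂ) • P.symbolB (wave k)) *ᵥ fourierHat X.y k) ∧
  X'.2.1 = (NormedSpace.exp (t • P.bracket)).compLp X.2.1 ∧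
  X'.2.2 = X.2.2

/-- `X' = L X` for `L = B ⊕ [Ω̄_eq, ·] ⊕ 0`, where `B` is the differential operator of symbol `B̂`
(in the sense of distributions, with `X` and `L X` in `L²`). -/
def IsLin (P : Params) (X X' : State) : Prop :=
  (∀ k : Fin 3 → ℤ, fourierHat X'.y k = P.symbolB (wave k) *ᵥ fourierHat X.y k) ∧
  X'.2.1 = P.bracket.compLp X.2.1 ∧
  X'.2.2 = 0

end Params

end Micropolar

end

/-! Everything happens one Fourier mode at a time. Parseval and Riesz–Fischer identify real `L²`
fields with square summable families of coefficients satisfying `c (-k) = conj (c k)`. Since the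
symbol satisfies `B (-k) = conj (B k)`, its exponential maps such families to such families. Thus a
bound on `exp (t B_k)` that is uniform in `k` yields the operators, their strong continuity and all
the growth bounds (`exists_multiplier_semigroup`, `exists_uniform_growth_bound`).

The uniform bound has two sources. For finitely many modes, the spectral bound of a matrix is its
growth bound up to `ε`. For the others, the energy with weights `(1, J_eq, d²/(λ-ν))` makes all
rotations drop out and lets viscosity and damping absorb the coupling of `u` and `ω`. The only term
left without a sign couples `ω` and `a`, and diffusion absorbs it at the cost of a rate `O(|k|⁻²)`.
Large modes therefore grow more slowly than any prescribed positive rate. At `k = 0` there is an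
eigenvalue with positive real part, because `ν < λ`; so the supremum of the growth rates is decided
by finitely many modes, is attained and is positive. The matrices `M_k` and `B_k` have the same
nonzero eigenvalues because `Q̄_k Q_k` acts as the identity on both sides of `B_k`
(`hasEigenvalue_matM_iff`).

The generator of the multiplier semigroup has the maximal domain, those `f` with `B_k f̂(k)` in
`ℓ²`: the difference quotients are dominated by a multiple of `|B_k f̂(k)|²`. To identify this
domain, `exists_elliptic_bound` bounds `⟨k⟩⁴|P_⊥ û|²` and `⟨k⟩⁴|ω̂|²` by `|f̂|² + |B_k f̂|²`, the
couplings of `u` and `ω` being of first order and hence absorbable. The converse is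
`exists_nsq_symbolB_le`. Only `P_⊥ û` enters, because `k ×` and the viscous term ignore the
component of `û` along `k`.

The remaining claims are algebraic. The bracket with `R` is skew for the Frobenius product, so it
generates isometries, also of every Fourier coefficient. The velocity row of `B_k` is orthogonal to
`k`, so `k · û` is constant along the flow. -/

namespace Micropolar

open MeasureTheory Submodule

/-! ### Fourier series on the torus -/

section Characters

/-- `character k` as a continuous function. -/
noncomputable def characterC (k : Fin 3 → ℤ) : C(Torus, ℂ) where
  toFun := character k
  continuous_toFun := by unfold character; fun_prop

lemma character_neg (k : Fin 3 → ℤ) (x : Torus) :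
    character (-k) x = (starRingEnd ℂ) (character k x) := by
  simp [character, map_prod]

lemma character_add (k l : Fin 3 → ℤ) (x : Torus) :
    character (k + l) x = character k x * character l x := by
  simp [character, Finset.prod_mul_distrib]

lemma character_zero (x : Torus) : character 0 x = 1 := by
  simp [character]

lemma norm_character (k : Fin 3 → ℤ) (x : Torus) : ‖character k x‖ = 1 := by
  rw [character, norm_prod]
  exact Finset.prod_eq_one fun j _ => Circle.norm_coe _

lemma character_apply_add (k : Fin 3 → ℤ) (x y : Torus) :
    character k (x + y) = character k x * character k y := by
  simp [character, fourier_apply, Finset.prod_mul_distrib, smul_add, AddCircle.toCircle_add]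

lemma character_single (i : Fin 3) (x : Torus) :
    character (Pi.single i 1) x = fourier 1 (x i) := by
  rw [character, Finset.prod_eq_single i]
  · simp
  · intro j _ hj
    simp [Pi.single_eq_of_ne hj]
  · simp

lemma character_pi_single (k : Fin 3 → ℤ) (i : Fin 3) (y : AddCircle (2 * Real.pi)) :
    character k (Pi.single i y) = fourier (k i) y := by
  rw [character, Finset.prod_eq_single i]
  · simp
  · intro j _ hj
    simp [Pi.single_eq_of_ne hj]
  · simp

lemma integral_character (k : Fin 3 → ℤ) :
    ∫ x : Torus, character k x = if k = 0 then (((2 * Real.pi) ^ 3 : ℝ) : ℂ) else 0 := by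
  have h1 : ∀ n : ℤ, ∫ y : AddCircle (2 * Real.pi), fourier n y
      = if n = 0 then ((2 * Real.pi : ℝ) : ℂ) else 0 := by
    intro n
    have h := (orthonormal_iff_ite.mp
      (orthonormal_fourier (T := 2 * Real.pi))) 0 n
    rw [ContinuousMap.inner_toLp] at h
    -- The one-dimensional orthogonality holds for the Haar probability measure; passing to `volume`
    -- brings in the factor `2π`.
    rw [AddCircle.volume_eq_smul_haarAddCircle, integral_smul_measure]
    simp only [fourier_zero, map_one, mul_one] at h
    rw [h, ENNReal.toReal_ofReal Real.two_pi_pos.le]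
    by_cases hn : n = 0
    · simp [hn]
    · simp [hn, Ne.symm hn]
  unfold character
  rw [MeasureTheory.integral_fintype_prod_volume_eq_prod]
  simp only [h1]
  split_ifs with hk
  · simp [hk]
  · obtain ⟨i, hi⟩ := Function.ne_iff.mp hk
    exact Finset.prod_eq_zero (Finset.mem_univ i) (by simpa using hi)

/-- The star subalgebra generated by the characters. -/
noncomputable def characterSubalgebra : StarSubalgebra ℂ C(Torus, ℂ) where
  toSubalgebra := Algebra.adjoin ℂ (Set.range characterC)
  star_mem' := by
    change Algebra.adjoin ℂ (Set.range characterC) ≤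
      star (Algebra.adjoin ℂ (Set.range characterC))
    refine Algebra.adjoin_le ?_
    rintro _ ⟨n, rfl⟩
    refine Algebra.subset_adjoin ⟨-n, ?_⟩
    ext1 x
    exact character_neg n x

lemma characterSubalgebra_coe :
    characterSubalgebra.toSubalgebra.toSubmodule = span ℂ (Set.range characterC) := by
  apply Algebra.adjoin_eq_span_of_subset
  refine .trans (fun x ↦ Submonoid.closure_induction (fun _ ↦ id) ⟨0, ?_⟩ ?_) subset_span
  · ext z
    exact character_zero z
  · rintro _ _ _ _ ⟨m, rfl⟩ ⟨n, rfl⟩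
    refine ⟨m + n, ?_⟩
    ext z
    exact character_add m n z

/-- Points that differ in the coordinate `i` are told apart by `exp (i x_i)`. -/
lemma characterSubalgebra_separatesPoints : characterSubalgebra.SeparatesPoints := by
  intro x y hxy
  rw [Ne, funext_iff, not_forall] at hxy
  obtain ⟨i, hi⟩ := hxy
  refine ⟨_, ⟨characterC (Pi.single i 1), Algebra.subset_adjoin ⟨Pi.single i 1, rfl⟩, rfl⟩, ?_⟩
  change character _ x ≠ character _ y
  rw [character_single, character_single, fourier_one, fourier_one]
  exact fun h => hi (AddCircle.injective_toCircle Real.two_pi_pos.ne' (Circle.ext h))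

/-- Stone–Weierstrass on the compact torus: products and conjugates of characters are characters, so
their span is already a star subalgebra. -/
lemma span_characterC_closure_eq_top :
    (span ℂ (Set.range characterC)).topologicalClosure = ⊤ := by
  rw [← characterSubalgebra_coe]
  exact congr_arg (Subalgebra.toSubmodule <| StarSubalgebra.toSubalgebra ·)
    (ContinuousMap.starSubalgebra_topologicalClosure_eq_top_of_separatesPoints _
      characterSubalgebra_separatesPoints)

end Characters

/-! ### The Hilbert basis of characters -/

section Basis

/-- The normalisation `(2π)^(-3/2)`. -/
noncomputable def fourierConst : ℝ := (Real.sqrt ((2 * Real.pi) ^ 3))⁻¹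

lemma fourierConst_pos : 0 < fourierConst := by
  have := Real.pi_pos
  unfold fourierConst
  positivity

lemma fourierConst_sq : fourierConst * fourierConst * (2 * Real.pi) ^ 3 = 1 := by
  have := Real.pi_pos
  unfold fourierConst
  rw [← mul_inv, Real.mul_self_sqrt (by positivity)]
  field_simp

/-- The normalised characters as elements of `L²`. -/
noncomputable def characterLp (k : Fin 3 → ℤ) : Lp ℂ 2 (volume : Measure Torus) :=
  (fourierConst : ℂ) • ContinuousMap.toLp (E := ℂ) 2 volume ℂ (characterC k)

lemma coeFn_characterLp (k : Fin 3 → ℤ) :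
    characterLp k =ᵐ[volume] fun x => (fourierConst : ℂ) * character k x := by
  unfold characterLp
  filter_upwards [Lp.coeFn_smul (fourierConst : ℂ)
    (ContinuousMap.toLp (E := ℂ) 2 volume ℂ (characterC k)),
    ContinuousMap.coeFn_toLp (p := 2) (𝕜 := ℂ) volume (characterC k)] with x h1 h2
  rw [h1, Pi.smul_apply, h2]
  rfl

lemma orthonormal_characterLp : Orthonormal ℂ characterLp := by
  rw [orthonormal_iff_ite]
  intro m n
  rw [characterLp, characterLp, inner_smul_left, inner_smul_right, ContinuousMap.inner_toLp]
  have : ∀ x, (characterC n) x * (starRingEnd ℂ) ((characterC m) x) = character (n - m) x := by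
    intro x
    rw [sub_eq_add_neg, character_add, character_neg]
    rfl
  simp only [this, integral_character, Complex.conj_ofReal, sub_eq_zero]
  split_ifs with h1 h2 h2
  · rw [← mul_assoc]
    exact_mod_cast fourierConst_sq
  · exact absurd h1.symm h2
  · exact absurd h2.symm h1
  · simp

lemma span_characterLp_closure_eq_top :
    (span ℂ (Set.range characterLp)).topologicalClosure = ⊤ := by
  have h : (span ℂ (Set.range fun k => ContinuousMap.toLp (E := ℂ) 2 (volume : Measure Torus) ℂ
      (characterC k))).topologicalClosure = ⊤ := by
    simpa only [map_span, ContinuousLinearMap.coe_coe, ← Set.range_comp, Function.comp_def] using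
      (ContinuousMap.toLp_denseRange ℂ (volume : Measure Torus) ℂ
        (p := 2) (by simp)).topologicalClosure_map_submodule span_characterC_closure_eq_top
  rw [eq_top_iff, ← h]
  refine topologicalClosure_mono (span_le.mpr ?_)
  rintro _ ⟨k, rfl⟩
  have : ContinuousMap.toLp (E := ℂ) 2 (volume : Measure Torus) ℂ (characterC k)
      = ((fourierConst : ℂ))⁻¹ • characterLp k := by
    rw [characterLp, smul_smul, inv_mul_cancel₀, one_smul]
    exact_mod_cast fourierConst_pos.ne'
  simp only [this]
  exact smul_mem _ _ (subset_span ⟨k, rfl⟩)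

/-- The characters as a Hilbert basis. -/
noncomputable def characterBasis :
    HilbertBasis (Fin 3 → ℤ) ℂ (Lp ℂ 2 (volume : Measure Torus)) :=
  HilbertBasis.mk orthonormal_characterLp span_characterLp_closure_eq_top.ge

lemma characterBasis_repr (f : Lp ℂ 2 (volume : Measure Torus)) (k : Fin 3 → ℤ) :
    characterBasis.repr f k = (fourierConst : ℂ) * ∫ x : Torus, character (-k) x * f x := by
  rw [characterBasis.repr_apply_apply f k, MeasureTheory.L2.inner_def, characterBasis,
    HilbertBasis.coe_mk, ← integral_const_mul]
  apply integral_congr_ae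
  filter_upwards [coeFn_characterLp k] with x hx
  rw [hx, RCLike.inner_apply, character_neg, map_mul, Complex.conj_ofReal]
  ring

end Basis

end Micropolar

namespace Micropolar

open MeasureTheory

/-! ### Fourier coefficients of real vector fields -/

section Coefficients

variable {n : Type} [Fintype n]

/-- The sum of the squares of the moduli of the components. -/
noncomputable def nsq (v : n → ℂ) : ℝ := ∑ i, ‖v i‖ ^ 2

lemma nsq_nonneg (v : n → ℂ) : 0 ≤ nsq v := Finset.sum_nonneg fun _ _ => sq_nonneg _

/-- The Fourier coefficients of a square integrable vector field. -/
noncomputable def coeff (f : L2 n) : (Fin 3 → ℤ) → n → ℂ := fourierHat fun x i => f x i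

/-- The `i`-th component of a vector field, as a complex function. -/
noncomputable def complexComponent (i : n) : L2 n →L[ℝ] Lp ℂ 2 (volume : Measure Torus) :=
  (Complex.ofRealCLM.comp (EuclideanSpace.proj i)).compLpL 2 volume

lemma coeFn_complexComponent (i : n) (f : L2 n) :
    complexComponent i f =ᵐ[volume] fun x => ((f x i : ℝ) : ℂ) :=
  (Complex.ofRealCLM.comp (EuclideanSpace.proj (𝕜 := ℝ) i)).coeFn_compLpL f

lemma coeff_eq_repr (f : L2 n) (k : Fin 3 → ℤ) (i : n) :
    coeff f k i = characterBasis.repr (complexComponent i f) k := by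
  rw [characterBasis_repr, coeff, fourierHat]
  congr 1
  apply integral_congr_ae
  filter_upwards [coeFn_complexComponent i f] with x hx
  rw [hx]

lemma coeff_add (f g : L2 n) : coeff (f + g) = coeff f + coeff g := by
  ext k i
  simp [coeff_eq_repr]

lemma coeff_sub (f g : L2 n) : coeff (f - g) = coeff f - coeff g := by
  ext k i
  simp [coeff_eq_repr]

lemma coeff_smul (c : ℝ) (f : L2 n) : coeff (c • f) = fun k => (c : ℂ) • coeff f k := by
  ext k i
  have h : complexComponent i (c • f) = (c : ℂ) • complexComponent i f := by
    rw [map_smul]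
    exact (RCLike.real_smul_eq_coe_smul (K := ℂ) c (complexComponent i f))
  rw [coeff_eq_repr, h, LinearIsometryEquiv.map_smul]
  exact congrArg (fun z => (c : ℂ) * z) (coeff_eq_repr f k i).symm

/-- The reality condition. It is the only constraint, besides square summability, on the
coefficients of a real field. -/
lemma coeff_neg_wave (f : L2 n) (k : Fin 3 → ℤ) (i : n) :
    coeff f (-k) i = (starRingEnd ℂ) (coeff f k i) := by
  simp only [coeff, fourierHat, map_mul, Complex.conj_ofReal, ← integral_conj, character_neg,
    Complex.conj_conj]

lemma memLp_component (f : L2 n) (i : n) :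
    MemLp (fun x => (f x i : ℝ)) 2 (volume : Measure Torus) :=
  (Lp.memLp f).eval_piLp i

lemma norm_sq_eq_sum_components (f : L2 n) : ‖f‖ ^ 2 = ∑ i, ‖complexComponent i f‖ ^ 2 := by
  have h1 : ‖f‖ ^ 2 = ∫ x, ‖f x‖ ^ 2 := by
    have h := MeasureTheory.L2.inner_def (𝕜 := ℝ) f f
    simpa only [real_inner_self_eq_norm_sq] using h
  have h2 : ∀ i, ‖complexComponent i f‖ ^ 2 = ∫ x, (f x i) ^ 2 := by
    intro i
    have h := MeasureTheory.L2.inner_def (𝕜 := ℂ) (complexComponent i f) (complexComponent i f)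
    simp only [inner_self_eq_norm_sq_to_K] at h
    have h3 : (∫ x : Torus, ((‖complexComponent i f x‖ : ℂ)) ^ 2)
        = ((∫ x : Torus, (f x i) ^ 2 : ℝ) : ℂ) := by
      rw [← integral_complex_ofReal]
      apply integral_congr_ae
      filter_upwards [coeFn_complexComponent i f] with x hx
      rw [hx]
      push_cast [Complex.norm_real]
      exact_mod_cast sq_abs (f x i)
    have h4 : ((‖complexComponent i f‖ ^ 2 : ℝ) : ℂ) = ((∫ x : Torus, (f x i) ^ 2 : ℝ) : ℂ) := by
      rw [Complex.ofReal_pow]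
      exact h.trans h3
    exact Complex.ofReal_injective h4
  rw [h1, Finset.sum_congr rfl fun i _ => h2 i, ← integral_finsetSum]
  · exact integral_congr_ae (Filter.Eventually.of_forall fun x => by
      simp [EuclideanSpace.norm_sq_eq])
  · exact fun i _ => (memLp_component f i).integrable_sq

/-- Parseval, component by component. All `L²` estimates below are read off from the modes through
this identity. -/
lemma hasSum_nsq_coeff (f : L2 n) : HasSum (fun k => nsq (coeff f k)) (‖f‖ ^ 2) := by
  rw [norm_sq_eq_sum_components]
  refine hasSum_sum fun i _ => ?_
  have h := lp.hasSum_norm (p := 2) (by norm_num) (characterBasis.repr (complexComponent i f))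
  simp only [LinearIsometryEquiv.norm_map] at h
  simp only [coeff_eq_repr]
  exact_mod_cast h

lemma coeff_injective : Function.Injective (coeff : L2 n → _) := by
  intro f g h
  have h1 := hasSum_nsq_coeff (f - g)
  rw [coeff_sub, h, sub_self] at h1
  have h2 : ‖f - g‖ ^ 2 = 0 := h1.unique (by simp [nsq])
  exact sub_eq_zero.mp (norm_eq_zero.mp (pow_eq_zero_iff (by norm_num) |>.mp h2))

/-- The Riesz–Fischer theorem for real vector fields. -/
lemma exists_coeff_eq (c : (Fin 3 → ℤ) → n → ℂ) (hc : Summable fun k => nsq (c k))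
    (hconj : ∀ k i, c (-k) i = (starRingEnd ℂ) (c k i)) : ∃ f : L2 n, coeff f = c := by
  have hmem : ∀ i, Memℓp (fun k => c k i) 2 := fun i => by
    refine memℓp_gen ?_
    refine Summable.of_nonneg_of_le (fun k => by positivity) (fun k => ?_) hc
    have : ‖c k i‖ ^ 2 ≤ nsq (c k) :=
      Finset.single_le_sum (f := fun i => ‖c k i‖ ^ 2) (fun _ _ => sq_nonneg _) (Finset.mem_univ i)
    exact_mod_cast this
  set g : n → Lp ℂ 2 (volume : Measure Torus) :=
    fun i => characterBasis.repr.symm ⟨_, hmem i⟩ with hg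
  have hgc : ∀ i k, (fourierConst : ℂ) * ∫ x : Torus, character (-k) x * g i x = c k i := by
    intro i k
    rw [← characterBasis_repr, hg, LinearIsometryEquiv.apply_symm_apply]
  -- Taking real parts does not change the coefficients: those of `conj g` are `conj (c (-k))`,
  -- which is `c k` by the symmetry assumption.
  have hF : MemLp (fun x => WithLp.toLp 2 fun i => (g i x).re : Torus → EuclideanSpace ℝ n) 2
      (volume : Measure Torus) := by
    refine MemLp.of_eval_piLp fun i => ?_
    exact (Lp.memLp (g i)).re
  refine ⟨hF.toLp, ?_⟩
  ext k i
  have hint : ∀ l : Fin 3 → ℤ, Integrable (fun x : Torus => character l x * g i x) := by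
    intro l
    refine (Lp.memLp (g i)).integrable (by norm_num) |>.bdd_mul (c := 1)
      (characterC l).continuous.aestronglyMeasurable ?_
    exact Filter.Eventually.of_forall fun x => (norm_character l x).le
  have h1 : coeff hF.toLp k i
      = (fourierConst : ℂ) * ∫ x : Torus, character (-k) x * ((g i x).re : ℂ) := by
    rw [coeff, fourierHat]
    congr 1
    apply integral_congr_ae
    filter_upwards [hF.coeFn_toLp] with x hx
    rw [hx]
  have h2 : ∀ x : Torus, character (-k) x * ((g i x).re : ℂ)
      = (1 / 2 : ℂ) * (character (-k) x * g i x
        + (starRingEnd ℂ) (character (-(-k)) x * g i x)) := by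
    intro x
    rw [map_mul, character_neg (-k), Complex.conj_conj, ← mul_add, Complex.add_conj]
    push_cast
    ring
  have h3 : (fourierConst : ℂ) * (starRingEnd ℂ) (∫ x : Torus, character (-(-k)) x * g i x)
      = c k i := by
    have := hgc i (-k)
    rw [hconj] at this
    rw [← Complex.conj_conj (c k i), ← this, map_mul, Complex.conj_ofReal]
  rw [h1]
  simp only [h2]
  have hconj_int : Integrable fun x : Torus =>
      (starRingEnd ℂ) (character (-(-k)) x * g i x) :=
    Complex.conjCLE.toContinuousLinearMap.integrable_comp (hint _)
  rw [integral_const_mul, integral_add (hint _) hconj_int, integral_conj]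
  linear_combination (1 / 2 : ℂ) * hgc i k + (1 / 2 : ℂ) * h3

lemma integrable_smul_of_abs_le_one (f : L2 n) {ρ : Torus → ℝ} (hρ : Continuous ρ)
    (hb : ∀ x, |ρ x| ≤ 1) : Integrable fun x : Torus => (fourierConst * ρ x) • f x := by
  refine (Lp.memLp f).integrable (by norm_num) |>.bdd_smul fourierConst
    (continuous_const.mul hρ).aestronglyMeasurable ?_
  refine Filter.Eventually.of_forall fun x => ?_
  rw [Pi.mul_apply, norm_mul, Real.norm_of_nonneg fourierConst_pos.le]
  exact mul_le_of_le_one_right fourierConst_pos.le (hb x)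

/-- The Fourier coefficients of a vector field in terms of vector valued integrals. -/
lemma coeff_eq_add_integral (f : L2 n) (k : Fin 3 → ℤ) (i : n) :
    coeff f k i = (((∫ x, (fourierConst * (character (-k) x).re) • f x : EuclideanSpace ℝ n) i : ℝ)
        : ℂ) + (((∫ x, (fourierConst * (character (-k) x).im) • f x :
          EuclideanSpace ℝ n) i : ℝ) : ℂ) * Complex.I := by
  have hr : Integrable fun x : Torus => (fourierConst * (character (-k) x).re) • f x :=
    integrable_smul_of_abs_le_one f
    (Complex.continuous_re.comp (characterC (-k)).continuous)
    (fun x => (Complex.abs_re_le_norm _).trans (norm_character _ x).le)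
  have hi : Integrable fun x : Torus => (fourierConst * (character (-k) x).im) • f x :=
    integrable_smul_of_abs_le_one f
    (Complex.continuous_im.comp (characterC (-k)).continuous)
    (fun x => (Complex.abs_im_le_norm _).trans (norm_character _ x).le)
  have hproj : ∀ F : Torus → EuclideanSpace ℝ n, Integrable F →
      (((∫ x, F x) i : ℝ) : ℂ) = ∫ x, ((F x i : ℝ) : ℂ) := by
    intro F hF
    exact ((Complex.ofRealCLM.comp (EuclideanSpace.proj i)).integral_comp_comm hF).symm
  rw [hproj _ hr, hproj _ hi, ← integral_mul_const, ← integral_add, coeff, fourierHat,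
    ← integral_const_mul]
  · refine integral_congr_ae (Filter.Eventually.of_forall fun x => ?_)
    change (fourierConst : ℂ) * _ = _
    simp only [PiLp.smul_apply, smul_eq_mul]
    push_cast
    nth_rewrite 1 [← Complex.re_add_im (character (-k) x)]
    ring
  · exact ((Complex.ofRealCLM.comp (EuclideanSpace.proj (𝕜 := ℝ) i)).integrable_comp hr)
  · exact ((Complex.ofRealCLM.comp (EuclideanSpace.proj (𝕜 := ℝ) i)).integrable_comp hi).mul_const _

/-- A constant linear map commutes with the integral that defines a Fourier coefficient. Since `A`
is real, it acts separately on the real and the imaginary part of the coefficient, and contracts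
both. -/
lemma nsq_coeff_compLp_le (A : EuclideanSpace ℝ n →L[ℝ] EuclideanSpace ℝ n)
    (hA : ∀ v, ‖A v‖ ≤ ‖v‖) (f : L2 n) (k : Fin 3 → ℤ) :
    nsq (coeff (A.compLp f) k) ≤ nsq (coeff f k) := by
  have hsplit : ∀ g : L2 n, nsq (coeff g k) =
      ‖(∫ x, (fourierConst * (character (-k) x).re) • g x : EuclideanSpace ℝ n)‖ ^ 2
      + ‖(∫ x, (fourierConst * (character (-k) x).im) • g x : EuclideanSpace ℝ n)‖ ^ 2 := by
    intro g
    rw [EuclideanSpace.norm_sq_eq, EuclideanSpace.norm_sq_eq, ← Finset.sum_add_distrib]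
    refine Finset.sum_congr rfl fun i _ => ?_
    rw [coeff_eq_add_integral, Complex.sq_norm, Complex.normSq_add_mul_I, Real.norm_eq_abs,
      Real.norm_eq_abs, sq_abs, sq_abs]
  have hcomm : ∀ ρ : Torus → ℝ, (∀ x, |ρ x| ≤ 1) → Continuous ρ →
      (∫ x, (fourierConst * ρ x) • (A.compLp f) x) = A (∫ x, (fourierConst * ρ x) • f x) := by
    intro ρ hb hρ
    rw [← A.integral_comp_comm]
    · apply integral_congr_ae
      filter_upwards [A.coeFn_compLp f] with x hx
      rw [hx, map_smul]
    · exact integrable_smul_of_abs_le_one f hρ hb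
  rw [hsplit, hsplit, hcomm _ (fun x => (Complex.abs_re_le_norm _).trans (norm_character _ x).le)
    (Complex.continuous_re.comp (characterC (-k)).continuous),
    hcomm _ (fun x => (Complex.abs_im_le_norm _).trans (norm_character _ x).le)
    (Complex.continuous_im.comp (characterC (-k)).continuous)]
  gcongr <;> exact hA _

end Coefficients

end Micropolar

namespace Micropolar

open MeasureTheory Filter

/-! ### Matrix exponentials -/

section Exponential

variable {n : Type} [Fintype n]

lemma nsq_eq_norm_sq (v : n → ℂ) : nsq v = ‖(WithLp.toLp 2 v : EuclideanSpace ℂ n)‖ ^ 2 :=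
  (EuclideanSpace.norm_sq_eq _).symm

lemma continuous_nsq : Continuous (nsq : (n → ℂ) → ℝ) := by
  unfold nsq
  fun_prop

lemma nsq_zero : nsq (0 : n → ℂ) = 0 := by simp [nsq]

lemma nsq_smul (c : ℂ) (v : n → ℂ) : nsq (c • v) = ‖c‖ ^ 2 * nsq v := by
  simp [nsq, mul_pow, Finset.mul_sum]

lemma nsq_add_le (v w : n → ℂ) : nsq (v + w) ≤ 2 * nsq v + 2 * nsq w := by
  unfold nsq
  rw [Finset.mul_sum, Finset.mul_sum, ← Finset.sum_add_distrib]
  refine Finset.sum_le_sum fun i _ => ?_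
  have h := norm_add_le (v i) (w i)
  have h2 : ‖(v + w) i‖ ^ 2 ≤ (‖v i‖ + ‖w i‖) ^ 2 := by
    gcongr
    exact h
  nlinarith [sq_nonneg (‖v i‖ - ‖w i‖)]

lemma nsq_sub_le (v w : n → ℂ) : nsq (v - w) ≤ 2 * nsq v + 2 * nsq w := by
  have h := nsq_add_le v (-w)
  rwa [← sub_eq_add_neg, show nsq (-w) = nsq w by simp [nsq]] at h

lemma map_conj_mulVec (A : Matrix n n ℂ) (v : n → ℂ) (i : n) :
    (A.map (starRingEnd ℂ) *ᵥ fun j => (starRingEnd ℂ) (v j)) i = (starRingEnd ℂ) ((A *ᵥ v) i) := by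
  simp [Matrix.mulVec, dotProduct]

variable [DecidableEq n]

open scoped Matrix.Norms.Operator in
lemma hasDerivAt_exp_mulVec (A : Matrix n n ℂ) (v : n → ℂ) (t : ℝ) :
    HasDerivAt (fun t : ℝ => NormedSpace.exp ((t : ℂ) • A) *ᵥ v)
      (NormedSpace.exp ((t : ℂ) • A) *ᵥ (A *ᵥ v)) t := by
  have h : HasDerivAt (fun t : ℝ => NormedSpace.exp ((t : ℂ) • A))
      (NormedSpace.exp ((t : ℂ) • A) * A) t := by
    simpa using! (hasDerivAt_exp_smul_const A (t : ℂ)).scomp t Complex.ofRealCLM.hasDerivAt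
  let e : Matrix n n ℂ →L[ℂ] (n → ℂ) := LinearMap.toContinuousLinearMap
    { toFun := fun M => M *ᵥ v
      map_add' := fun M N => Matrix.add_mulVec M N v
      map_smul' := fun c M => Matrix.smul_mulVec c M v }
  have h2 := (e.restrictScalars ℝ).hasFDerivAt.comp_hasDerivAt t h
  rw [Matrix.mulVec_mulVec]
  exact h2

lemma exp_mulVec_mulVec_comm (A : Matrix n n ℂ) (v : n → ℂ) (t : ℂ) :
    NormedSpace.exp (t • A) *ᵥ (A *ᵥ v) = A *ᵥ (NormedSpace.exp (t • A) *ᵥ v) := by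
  rw [Matrix.mulVec_mulVec, Matrix.mulVec_mulVec]
  congr 1
  open scoped Matrix.Norms.Operator in
  exact (((Commute.refl A).smul_right t).exp_right).eq.symm

lemma exp_zero_smul_mulVec (A : Matrix n n ℂ) (v : n → ℂ) :
    NormedSpace.exp (((0 : ℝ) : ℂ) • A) *ᵥ v = v := by
  simp

lemma exp_add_smul_mulVec (A : Matrix n n ℂ) (v : n → ℂ) (s t : ℂ) :
    NormedSpace.exp ((s + t) • A) *ᵥ v
      = NormedSpace.exp (s • A) *ᵥ (NormedSpace.exp (t • A) *ᵥ v) := by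
  rw [add_smul, Matrix.exp_add_of_commute _ _ (((Commute.refl A).smul_left s).smul_right t),
    Matrix.mulVec_mulVec]

-- Conjugation is a continuous ring homomorphism, so it passes through the exponential series. This
-- gives `exp (t B_k)` the symmetry of `B_k` needed to preserve real fields.
open scoped Matrix.Norms.Operator in
lemma exp_map_conj (A : Matrix n n ℂ) (t : ℝ) :
    NormedSpace.exp ((t : ℂ) • A.map (starRingEnd ℂ))
      = (NormedSpace.exp ((t : ℂ) • A)).map (starRingEnd ℂ) := by
  have h : Continuous (RingHom.mapMatrix (m := n) (starRingEnd ℂ)) := by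
    refine continuous_matrix fun i j => ?_
    exact Complex.continuous_conj.comp (continuous_id.matrix_elem i j)
  have h2 := NormedSpace.map_exp (RingHom.mapMatrix (m := n) (starRingEnd ℂ)) h ((t : ℂ) • A)
  simp only [RingHom.mapMatrix_apply] at h2
  refine Eq.trans ?_ h2.symm
  congr 1
  ext i j
  simp

/-- The remainder of the first order expansion of a bounded matrix semigroup. -/
lemma nsq_exp_sub_sub_le (A : Matrix n n ℂ) (v : n → ℂ) {D : ℝ}
    (hD : ∀ s : ℝ, 0 ≤ s → s ≤ 1 → nsq (NormedSpace.exp ((s : ℂ) • A) *ᵥ (A *ᵥ v))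
      ≤ D * nsq (A *ᵥ v)) {t : ℝ} (ht : 0 < t) (ht1 : t ≤ 1) :
    nsq ((t : ℂ)⁻¹ • (NormedSpace.exp ((t : ℂ) • A) *ᵥ v - v) - A *ᵥ v)
      ≤ (2 * D + 2) * nsq (A *ᵥ v) := by
  -- Mean value inequality for `s ↦ exp (sA) v - v - s A v`, which vanishes at `0` and has
  -- derivative `exp (sA) A v - A v`. The Euclidean norm replaces the sup norm in order to obtain
  -- `nsq`.
  let e := (PiLp.continuousLinearEquiv 2 ℝ fun _ : n => ℂ).symm
  have hd : ∀ s : ℝ, HasDerivAt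
      (fun s : ℝ => e (NormedSpace.exp ((s : ℂ) • A) *ᵥ v - v - s • (A *ᵥ v)))
      (e (NormedSpace.exp ((s : ℂ) • A) *ᵥ (A *ᵥ v) - A *ᵥ v)) s := by
    intro s
    have h1 : HasDerivAt (fun s : ℝ => NormedSpace.exp ((s : ℂ) • A) *ᵥ v - v - s • (A *ᵥ v))
        (NormedSpace.exp ((s : ℂ) • A) *ᵥ (A *ᵥ v) - A *ᵥ v) s := by
      have h2 := ((hasDerivAt_exp_mulVec A v s).sub_const v).sub
        ((hasDerivAt_id s).smul_const (A *ᵥ v))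
      rw [one_smul] at h2
      exact h2
    exact e.toContinuousLinearMap.hasFDerivAt.comp_hasDerivAt s h1
  have hsqrt : ∀ w : n → ℂ, ‖e w‖ = Real.sqrt (nsq w) := by
    intro w
    rw [nsq_eq_norm_sq, Real.sqrt_sq (norm_nonneg _)]
    rfl
  have hb := norm_image_sub_le_of_norm_deriv_le_segment' (a := 0) (b := t)
    (C := Real.sqrt ((2 * D + 2) * nsq (A *ᵥ v)))
    (fun s _ => (hd s).hasDerivWithinAt) (fun s hs => by
      rw [hsqrt]
      apply Real.sqrt_le_sqrt
      have h1 := nsq_sub_le (NormedSpace.exp ((s : ℂ) • A) *ᵥ (A *ᵥ v)) (A *ᵥ v)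
      have h2 := hD s hs.1 (hs.2.le.trans ht1)
      linarith) t ⟨ht.le, le_rfl⟩
  rw [exp_zero_smul_mulVec, sub_self, zero_smul, sub_zero, map_zero, sub_zero, sub_zero, hsqrt]
    at hb
  have hDn : 0 ≤ (2 * D + 2) * nsq (A *ᵥ v) := by
    have := nsq_nonneg (NormedSpace.exp (((0 : ℝ) : ℂ) • A) *ᵥ (A *ᵥ v))
    have h2 := hD 0 le_rfl zero_le_one
    have h3 := nsq_nonneg (A *ᵥ v)
    linarith
  have hb2 := pow_le_pow_left₀ (Real.sqrt_nonneg _) hb 2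
  rw [mul_pow, Real.sq_sqrt (nsq_nonneg _), Real.sq_sqrt hDn] at hb2
  have ht0 : (t : ℂ) ≠ 0 := by exact_mod_cast ht.ne'
  have heq : (t : ℂ)⁻¹ • (NormedSpace.exp ((t : ℂ) • A) *ᵥ v - v) - A *ᵥ v
      = (t : ℂ)⁻¹ • (NormedSpace.exp ((t : ℂ) • A) *ᵥ v - v - t • (A *ᵥ v)) := by
    rw [smul_sub _ (_ - v), ← Complex.coe_smul t, smul_smul, inv_mul_cancel₀ ht0, one_smul]
  rw [heq, nsq_smul, norm_inv, Complex.norm_real, Real.norm_of_nonneg ht.le, inv_pow,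
    inv_mul_le_iff₀ (by positivity)]
  linarith

lemma tendsto_exp_sub_div (A : Matrix n n ℂ) (v : n → ℂ) :
    Tendsto (fun t : ℝ => (t : ℂ)⁻¹ • (NormedSpace.exp ((t : ℂ) • A) *ᵥ v - v)) (𝓝[>] 0)
      (𝓝 (A *ᵥ v)) := by
  have h := (hasDerivAt_exp_mulVec A v 0).tendsto_slope_zero_right
  rw [exp_zero_smul_mulVec, exp_zero_smul_mulVec] at h
  refine h.congr fun t => ?_
  rw [zero_add, ← Complex.coe_smul, Complex.ofReal_inv]

end Exponential

/-! ### Fourier multipliers -/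

section Multiplier

variable {n : Type} [Fintype n]

lemma continuous_coeff (k : Fin 3 → ℤ) : Continuous fun f : L2 n => coeff f k := by
  refine continuous_pi fun i => ?_
  simp only [coeff_eq_repr, HilbertBasis.repr_apply_apply]
  fun_prop

/-- Dominated convergence for the sum over the modes that Parseval assigns to `‖F a - g‖²`. -/
lemma tendsto_of_coeff {α : Type*} {l : Filter α} [l.IsCountablyGenerated] {F : α → L2 n}
    {g : L2 n} {bound : (Fin 3 → ℤ) → ℝ} (hb : Summable bound)
    (h1 : ∀ k, Tendsto (fun a => coeff (F a) k) l (𝓝 (coeff g k)))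
    (h2 : ∀ᶠ a in l, ∀ k, nsq (coeff (F a) k - coeff g k) ≤ bound k) : Tendsto F l (𝓝 g) := by
  have h : Tendsto (fun a => ∑' k, nsq (coeff (F a) k - coeff g k)) l
      (𝓝 (∑' _ : Fin 3 → ℤ, (0 : ℝ))) := by
    refine tendsto_tsum_of_dominated_convergence hb (fun k => ?_) ?_
    · have h3 := (continuous_nsq.tendsto 0).comp (tendsto_sub_nhds_zero_iff.mpr (h1 k))
      rwa [nsq_zero] at h3
    · filter_upwards [h2] with a ha k
      rw [Real.norm_of_nonneg (nsq_nonneg _)]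
      exact ha k
  rw [tsum_zero] at h
  have h3 : ∀ a, ∑' k, nsq (coeff (F a) k - coeff g k) = ‖F a - g‖ ^ 2 := by
    intro a
    have := (hasSum_nsq_coeff (F a - g)).tsum_eq
    rwa [coeff_sub] at this
  simp only [h3] at h
  rw [tendsto_iff_norm_sub_tendsto_zero]
  have h4 := (Real.continuous_sqrt.tendsto 0).comp h
  simpa [Function.comp_def, Real.sqrt_sq (norm_nonneg _)] using h4

/-- The bound keeps the new coefficients square summable and the symmetry of `A` keeps them those of
a real field, so Riesz–Fischer applies. -/
lemma exists_multiplier (A : (Fin 3 → ℤ) → Matrix n n ℂ)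
    (hA : ∀ k, A (-k) = (A k).map (starRingEnd ℂ)) {C : ℝ} (hC : 0 ≤ C)
    (hb : ∀ k v, nsq (A k *ᵥ v) ≤ C ^ 2 * nsq v) :
    ∃ T : L2 n →L[ℝ] L2 n, ∀ f k, coeff (T f) k = A k *ᵥ coeff f k := by
  have hex : ∀ f : L2 n, ∃ g : L2 n, coeff g = fun k => A k *ᵥ coeff f k := by
    intro f
    refine exists_coeff_eq _ ?_ ?_
    · exact Summable.of_nonneg_of_le (fun _ => nsq_nonneg _) (fun k => hb k _)
        ((hasSum_nsq_coeff f).summable.mul_left _)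
    · intro k i
      rw [hA, ← map_conj_mulVec]
      congr 2
      funext j
      exact coeff_neg_wave f k j
  choose T hT using hex
  let T' : L2 n →ₗ[ℝ] L2 n :=
    { toFun := T
      map_add' := fun f g => coeff_injective (by
        rw [hT, coeff_add, coeff_add, hT, hT]
        funext k
        simp [Matrix.mulVec_add])
      map_smul' := fun c f => coeff_injective (by
        rw [hT, coeff_smul, coeff_smul, RingHom.id_apply, hT]
        funext k
        exact Matrix.mulVec_smul _ _ _) }
  refine ⟨T'.mkContinuous C fun f => ?_, fun f k => congrFun (hT f) k⟩
  have h1 := hasSum_nsq_coeff (T f)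
  have h2 := (hasSum_nsq_coeff f).mul_left (C ^ 2)
  rw [hT] at h1
  have h3 := hasSum_le (fun k => hb k _) h1 h2
  rw [← mul_pow] at h3
  exact (pow_le_pow_iff_left₀ (norm_nonneg _) (by positivity) two_ne_zero).mp h3

end Multiplier

end Micropolar

namespace Micropolar

open MeasureTheory Filter

/-! ### Strongly continuous semigroups -/

section Semigroups

lemma tendsto_coe_nhdsGT_zero : Tendsto (fun t : ℝ≥0 => (t : ℝ)) (𝓝[>] 0) (𝓝[>] 0) := by
  refine tendsto_nhdsWithin_iff.mpr ⟨?_, ?_⟩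
  · exact (NNReal.continuous_coe.tendsto 0).mono_left nhdsWithin_le_nhds
  · filter_upwards [self_mem_nhdsWithin] with t ht
    exact NNReal.coe_pos.mpr ht

variable {E F : Type*} [NormedAddCommGroup E] [NormedSpace ℝ E] [NormedAddCommGroup F]
  [NormedSpace ℝ F]

lemma IsC0Semigroup.prodMap {S : ℝ≥0 → E →L[ℝ] E} {T : ℝ≥0 → F →L[ℝ] F} (hS : IsC0Semigroup S)
    (hT : IsC0Semigroup T) : IsC0Semigroup fun t => (S t).prodMap (T t) where
  zero := by
    rw [hS.zero, hT.zero]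
    rfl
  add t s := by
    rw [hS.add, hT.add]
    rfl
  continuous x := (hS.continuous x.1).prodMk (hT.continuous x.2)

lemma generatorMaps_prodMap {S : ℝ≥0 → E →L[ℝ] E} {T : ℝ≥0 → F →L[ℝ] F} (x y : E × F) :
    GeneratorMaps (fun t => (S t).prodMap (T t)) x y
      ↔ GeneratorMaps S x.1 y.1 ∧ GeneratorMaps T x.2 y.2 := by
  unfold GeneratorMaps
  rw [nhds_prod_eq, tendsto_prod_iff']
  rfl

lemma isC0Semigroup_id : IsC0Semigroup fun _ : ℝ≥0 => ContinuousLinearMap.id ℝ E where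
  zero := rfl
  add _ _ := rfl
  continuous _ := continuous_const

lemma generatorMaps_id (x y : E) :
    GeneratorMaps (fun _ : ℝ≥0 => ContinuousLinearMap.id ℝ E) x y ↔ y = 0 := by
  unfold GeneratorMaps
  simp only [ContinuousLinearMap.id_apply, sub_self, smul_zero]
  exact ⟨fun h => (tendsto_nhds_unique h tendsto_const_nhds), fun h => h ▸ tendsto_const_nhds⟩

end Semigroups

/-! ### Pointwise action of an operator exponential on `L²` -/

section CompLp

variable {E : Type*} [NormedAddCommGroup E] [NormedSpace ℝ E]

/-- Composition with a linear map, as a function of the linear map. -/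
noncomputable def compLpEval (f : Lp E 2 (volume : Measure Torus)) :
    (E →L[ℝ] E) →L[ℝ] Lp E 2 (volume : Measure Torus) :=
  ((ContinuousLinearMap.id ℝ (E →L[ℝ] E)).compLpL₂ 2 volume).flip f

/-- The pointwise semigroup generated by a linear map of the target. -/
noncomputable def pointwiseSemigroup (A : E →L[ℝ] E) (t : ℝ≥0) :
    Lp E 2 (volume : Measure Torus) →L[ℝ] Lp E 2 (volume : Measure Torus) :=
  (NormedSpace.exp ((t : ℝ) • A)).compLpL 2 volume

lemma pointwiseSemigroup_apply (A : E →L[ℝ] E) (t : ℝ≥0)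
    (f : Lp E 2 (volume : Measure Torus)) :
    pointwiseSemigroup A t f = compLpEval f (NormedSpace.exp ((t : ℝ) • A)) := rfl

variable [CompleteSpace E]

lemma exp_add_smul (A : E →L[ℝ] E) (s t : ℝ) :
    NormedSpace.exp ((s + t) • A) = NormedSpace.exp (s • A) * NormedSpace.exp (t • A) := by
  let : NormedAlgebra ℚ (E →L[ℝ] E) := NormedAlgebra.restrictScalars ℚ ℝ (E →L[ℝ] E)
  rw [add_smul, NormedSpace.exp_add_of_commute (((Commute.refl A).smul_left s).smul_right t)]

lemma isC0Semigroup_pointwiseSemigroup (A : E →L[ℝ] E) :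
    IsC0Semigroup (pointwiseSemigroup A) where
  zero := by
    ext1 f
    rw [pointwiseSemigroup_apply, NNReal.coe_zero, zero_smul, NormedSpace.exp_zero]
    change ContinuousLinearMap.compLp _ f = f
    refine Lp.ext ?_
    filter_upwards [ContinuousLinearMap.coeFn_compLp' (1 : E →L[ℝ] E) f]
      with x hx
    exact hx
  add t s := by
    ext1 f
    rw [pointwiseSemigroup_apply, NNReal.coe_add, exp_add_smul]
    refine Lp.ext ?_
    have h1 := ContinuousLinearMap.coeFn_compLp'
      (NormedSpace.exp ((t : ℝ) • A) * NormedSpace.exp ((s : ℝ) • A)) f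
    have h2 := ContinuousLinearMap.coeFn_compLp' (NormedSpace.exp ((s : ℝ) • A)) f
    have h3 := ContinuousLinearMap.coeFn_compLp' (NormedSpace.exp ((t : ℝ) • A))
      (pointwiseSemigroup A s f)
    filter_upwards [h1, h2, h3] with x h1 h2 h3
    refine h1.trans (Eq.trans ?_ h3.symm)
    exact congrArg (NormedSpace.exp ((t : ℝ) • A) : E →L[ℝ] E) h2.symm
  continuous f := by
    simp only [pointwiseSemigroup_apply]
    refine (compLpEval f).continuous.comp ?_
    refine Continuous.comp (g := fun t : ℝ => NormedSpace.exp (t • A)) ?_ NNReal.continuous_coe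
    exact continuous_iff_continuousAt.mpr fun t => (hasDerivAt_exp_smul_const A t).continuousAt

/-- The exponential is differentiable in operator norm, and evaluation at `f` is continuous and
linear in the operator. So the generator is defined everywhere, and uniqueness of limits gives the
equivalence. -/
lemma generatorMaps_pointwiseSemigroup (A : E →L[ℝ] E)
    (f g : Lp E 2 (volume : Measure Torus)) :
    GeneratorMaps (pointwiseSemigroup A) f g ↔ g = A.compLp f := by
  have h : GeneratorMaps (pointwiseSemigroup A) f (A.compLp f) := by
    have h1 := (compLpEval f).hasFDerivAt.comp_hasDerivAt (0 : ℝ)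
      (hasDerivAt_exp_smul_const A (0 : ℝ))
    rw [zero_smul, NormedSpace.exp_zero, one_mul] at h1
    have h2 := h1.tendsto_slope_zero_right.comp tendsto_coe_nhdsGT_zero
    refine h2.congr fun t => ?_
    simp only [Function.comp_apply, zero_add, zero_smul]
    rw [← pointwiseSemigroup_apply, NormedSpace.exp_zero]
    have h0 := (isC0Semigroup_pointwiseSemigroup A).zero
    have h4 := pointwiseSemigroup_apply A 0 f
    rw [h0, NNReal.coe_zero, zero_smul, NormedSpace.exp_zero] at h4
    rw [← h4]
    rfl
  exact ⟨fun hg => tendsto_nhds_unique hg h, fun hg => hg ▸ h⟩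

end CompLp

/-! ### Semigroups of Fourier multipliers and their generators -/

section MultiplierSemigroup

variable {n : Type} [Fintype n] [DecidableEq n]

/-- Each property holds for every mode by matrix calculus, and the uniform bound supplies the
summable majorants that carry limits over to `L²`. The generator has no domain condition other than
that `B k` applied to the coefficients gives an `L²` field. -/
lemma exists_multiplier_semigroup (B : (Fin 3 → ℤ) → Matrix n n ℂ)
    (hB : ∀ k, B (-k) = (B k).map (starRingEnd ℂ)) {C c : ℝ} (hC : 0 ≤ C) (hc : 0 ≤ c)
    (hb : ∀ k (t : ℝ), 0 ≤ t → ∀ v, nsq (NormedSpace.exp ((t : ℂ) • B k) *ᵥ v)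
      ≤ (C * Real.exp (c * t)) ^ 2 * nsq v) :
    ∃ S : ℝ≥0 → L2 n →L[ℝ] L2 n,
      (∀ t f k, coeff (S t f) k = NormedSpace.exp (((t : ℝ) : ℂ) • B k) *ᵥ coeff f k) ∧
      IsC0Semigroup S ∧
      ∀ f g, GeneratorMaps S f g ↔ ∀ k, coeff g k = B k *ᵥ coeff f k := by
  have hex : ∀ t : ℝ≥0, ∃ T : L2 n →L[ℝ] L2 n, ∀ f k,
      coeff (T f) k = NormedSpace.exp (((t : ℝ) : ℂ) • B k) *ᵥ coeff f k := fun t =>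
    exists_multiplier _ (fun k => by rw [hB, exp_map_conj])
      (mul_nonneg hC (Real.exp_pos (c * t)).le) fun k v => hb k t t.2 v
  choose S hS using hex
  -- As `c ≥ 0`, the bound at `T` serves for all times in `[0, T]`, which gives majorants
  -- independent of time.
  have hmono : ∀ k (t T : ℝ), 0 ≤ t → t ≤ T → ∀ v, nsq (NormedSpace.exp ((t : ℂ) • B k) *ᵥ v)
      ≤ (C * Real.exp (c * T)) ^ 2 * nsq v := by
    intro k t T h0 hT v
    refine (hb k t h0 v).trans ?_
    have := nsq_nonneg v
    gcongr
  refine ⟨S, hS, ⟨?_, ?_, ?_⟩, fun f g => ⟨fun h k => ?_, fun h => ?_⟩⟩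
  · ext1 f
    refine coeff_injective (funext fun k => ?_)
    rw [hS]
    simp
  · intro t s
    ext1 f
    refine coeff_injective (funext fun k => ?_)
    rw [ContinuousLinearMap.comp_apply, hS, hS, hS, NNReal.coe_add, Complex.ofReal_add,
      exp_add_smul_mulVec]
  · intro f
    rw [continuous_iff_continuousAt]
    intro t₀
    refine tendsto_of_coeff (bound := fun k =>
      4 * ((C * Real.exp (c * (t₀ + 1))) ^ 2 * nsq (coeff f k))) ?_ (fun k => ?_) ?_
    · exact ((hasSum_nsq_coeff f).summable.mul_left _).mul_left _
    · simp only [hS]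
      have h1 : Continuous fun t : ℝ => NormedSpace.exp ((t : ℂ) • B k) *ᵥ coeff f k :=
        continuous_iff_continuousAt.mpr fun t => (hasDerivAt_exp_mulVec _ _ t).continuousAt
      exact (h1.comp NNReal.continuous_coe).tendsto t₀
    · have hlt : ∀ᶠ t : ℝ≥0 in 𝓝 t₀, t < t₀ + 1 := by
        exact eventually_lt_nhds (lt_add_one t₀)
      filter_upwards [hlt] with t ht k
      have ht' : (t : ℝ) ≤ t₀ + 1 := by exact_mod_cast ht.le
      have h1 := nsq_sub_le (coeff (S t f) k) (coeff (S t₀ f) k)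
      have h2 := hmono k t (t₀ + 1) t.2 ht' (coeff f k)
      have h3 := hmono k t₀ (t₀ + 1) t₀.2 (by linarith) (coeff f k)
      rw [← hS] at h2 h3
      linarith
  -- Convergence in `L²` forces convergence of each coefficient, whose limit is known.
  · have h1 := ((continuous_coeff k).tendsto g).comp h
    refine tendsto_nhds_unique h1
      (((tendsto_exp_sub_div (B k) (coeff f k)).comp tendsto_coe_nhdsGT_zero).congr fun t => ?_)
    simp only [Function.comp_apply]
    rw [coeff_smul, coeff_sub, ← hS, Complex.ofReal_inv]
    rfl
  · have hcoeff : ∀ (t : ℝ≥0) k, coeff ((t : ℝ)⁻¹ • (S t f - f)) k = ((t : ℝ) : ℂ)⁻¹ •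
        (NormedSpace.exp (((t : ℝ) : ℂ) • B k) *ᵥ coeff f k - coeff f k) := by
      intro t k
      rw [coeff_smul, coeff_sub, ← hS, Complex.ofReal_inv]
      rfl
    -- The majorant from `nsq_exp_sub_sub_le` is a multiple of `|B k f̂(k)|² = |ĝ(k)|²`, summable
    -- because `g` is in `L²`.
    refine tendsto_of_coeff (bound := fun k =>
      (2 * (C * Real.exp (c * 1)) ^ 2 + 2) * nsq (coeff g k)) ?_ (fun k => ?_) ?_
    · exact (hasSum_nsq_coeff g).summable.mul_left _
    · simp only [hcoeff]
      rw [h k]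
      exact (tendsto_exp_sub_div (B k) (coeff f k)).comp tendsto_coe_nhdsGT_zero
    · have hlt : ∀ᶠ t : ℝ≥0 in 𝓝[>] 0, t < 1 :=
        (eventually_lt_nhds one_pos).filter_mono nhdsWithin_le_nhds
      filter_upwards [hlt, self_mem_nhdsWithin] with t ht ht0 k
      rw [hcoeff, h k]
      refine nsq_exp_sub_sub_le (B k) _ (fun s hs hs1 => ?_) (NNReal.coe_pos.mpr ht0)
        (by exact_mod_cast ht.le)
      exact hmono k s 1 hs hs1 _

end MultiplierSemigroup

end Micropolar

namespace Micropolar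

open MeasureTheory Filter

/-! ### Growth of matrix exponentials -/

section Growth

variable {n : Type} [Fintype n]

lemma norm_sq_le_nsq (v : n → ℂ) : ‖v‖ ^ 2 ≤ nsq v := by
  have h : ‖v‖ ≤ Real.sqrt (nsq v) := by
    refine (pi_norm_le_iff_of_nonneg (Real.sqrt_nonneg _)).mpr fun i => ?_
    refine Real.le_sqrt_of_sq_le ?_
    exact Finset.single_le_sum (f := fun i => ‖v i‖ ^ 2) (fun _ _ => sq_nonneg _)
      (Finset.mem_univ i)
  calc ‖v‖ ^ 2 ≤ Real.sqrt (nsq v) ^ 2 := by gcongr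
    _ = nsq v := Real.sq_sqrt (nsq_nonneg _)

lemma nsq_le_card_mul (v : n → ℂ) : nsq v ≤ Fintype.card n * ‖v‖ ^ 2 := by
  have h : nsq v ≤ ∑ _i : n, ‖v‖ ^ 2 := Finset.sum_le_sum fun i _ => by
    gcongr
    exact norm_le_pi_norm v i
  simpa using h

variable [DecidableEq n]

/-- Induction on the order of the generalized eigenvector: `exp (-ws) exp (sA) v` has derivative
`exp (-ws) exp (sA) (A - w) v`, where `(A - w) v` has order one less. Integrating costs one power of
`1 + t`. -/
lemma exists_poly_bound_exp_mulVec (A : Matrix n n ℂ) (w : ℂ) (k : ℕ) :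
    ∀ v : n → ℂ, ((Matrix.toLin' A - algebraMap ℂ _ w) ^ k) v = 0 →
      ∃ C : ℝ, 0 ≤ C ∧ ∀ t : ℝ, 0 ≤ t →
        ‖NormedSpace.exp ((t : ℂ) • A) *ᵥ v‖ ≤ C * (1 + t) ^ k * Real.exp (w.re * t) := by
  induction k with
  | zero =>
    intro v hv
    refine ⟨0, le_rfl, fun t _ => ?_⟩
    have : v = 0 := by simpa using hv
    simp [this]
  | succ k ih =>
    intro v hv
    obtain ⟨C, hC, h⟩ := ih ((Matrix.toLin' A - algebraMap ℂ _ w) v) (by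
      rw [pow_succ] at hv
      exact hv)
    have hN : (Matrix.toLin' A - algebraMap ℂ (Module.End ℂ (n → ℂ)) w) v = A *ᵥ v - w • v := by
      simp [Module.algebraMap_end_apply]
    rw [hN] at h
    have hz : ∀ s : ℝ, HasDerivAt
        (fun s : ℝ => Complex.exp (-(w * s)) • (NormedSpace.exp ((s : ℂ) • A) *ᵥ v))
        (Complex.exp (-(w * s)) • (NormedSpace.exp ((s : ℂ) • A) *ᵥ (A *ᵥ v - w • v))) s := by
      intro s
      have h1 : HasDerivAt (fun s : ℝ => Complex.exp (-(w * s)))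
          (Complex.exp (-(w * s)) * (-(w * 1))) s :=
        ((Complex.ofRealCLM.hasDerivAt (x := s)).const_mul w).neg.cexp
      have h2 := h1.smul (hasDerivAt_exp_mulVec A v s)
      refine h2.congr_deriv ?_
      rw [Matrix.mulVec_sub, Matrix.mulVec_smul, smul_sub, smul_smul, mul_one, mul_neg, neg_smul,
        ← sub_eq_add_neg]
    have hnorm : ∀ s : ℝ, ‖Complex.exp (-(w * s))‖ = Real.exp (-(w.re * s)) := by
      intro s
      rw [Complex.norm_exp]
      simp
    refine ⟨‖v‖ + C, by positivity, fun t ht => ?_⟩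
    have hb := norm_image_sub_le_of_norm_deriv_le_segment' (a := 0) (b := t)
      (C := C * (1 + t) ^ k) (fun s _ => (hz s).hasDerivWithinAt) (fun s hs => by
        rw [norm_smul, hnorm]
        calc Real.exp (-(w.re * s)) * ‖NormedSpace.exp ((s : ℂ) • A) *ᵥ (A *ᵥ v - w • v)‖
            ≤ Real.exp (-(w.re * s)) * (C * (1 + s) ^ k * Real.exp (w.re * s)) := by
              gcongr
              exact h s hs.1
          _ = C * (1 + s) ^ k := by
              rw [mul_comm, mul_assoc, ← Real.exp_add]
              simp
          _ ≤ C * (1 + t) ^ k := by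
              have := hs.1
              gcongr
              exact hs.2.le) t ⟨ht, le_rfl⟩
    rw [exp_zero_smul_mulVec, Complex.ofReal_zero, mul_zero, neg_zero, Complex.exp_zero,
      one_smul, sub_zero] at hb
    have hb2 := (norm_le_norm_add_norm_sub' _ _).trans (add_le_add_right hb ‖v‖)
    rw [norm_smul, hnorm] at hb2
    have h3 : ‖NormedSpace.exp ((t : ℂ) • A) *ᵥ v‖
        ≤ (‖v‖ + C * (1 + t) ^ k * t) * Real.exp (w.re * t) := by
      have h4 := mul_le_mul_of_nonneg_right hb2 (Real.exp_pos (w.re * t)).le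
      rwa [mul_right_comm, ← Real.exp_add, neg_add_cancel, Real.exp_zero, one_mul] at h4
    refine h3.trans ?_
    gcongr
    have h5 : 1 ≤ (1 + t) ^ (k + 1) := one_le_pow₀ (by linarith)
    have h6 : C * (1 + t) ^ k * t ≤ C * (1 + t) ^ (k + 1) := by
      rw [pow_succ, ← mul_assoc]
      gcongr
      linarith
    nlinarith [norm_nonneg v]

/-- The vectors whose trajectories grow at most like `exp (c t)`. -/
noncomputable def growthSubspace (A : Matrix n n ℂ) (c : ℝ) : Submodule ℂ (n → ℂ) where
  carrier := {v | ∃ C : ℝ, 0 ≤ C ∧ ∀ t : ℝ, 0 ≤ t →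
    ‖NormedSpace.exp ((t : ℂ) • A) *ᵥ v‖ ≤ C * Real.exp (c * t)}
  zero_mem' := ⟨0, le_rfl, fun t _ => by rw [Matrix.mulVec_zero, norm_zero, zero_mul]⟩
  add_mem' := by
    rintro v w ⟨C, hC, h⟩ ⟨D, hD, h'⟩
    refine ⟨C + D, by positivity, fun t ht => ?_⟩
    rw [Matrix.mulVec_add, add_mul]
    exact (norm_add_le _ _).trans (add_le_add (h t ht) (h' t ht))
  smul_mem' := by
    rintro c v ⟨C, hC, h⟩
    refine ⟨‖c‖ * C, by positivity, fun t ht => ?_⟩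
    rw [Matrix.mulVec_smul, norm_smul, mul_assoc]
    exact mul_le_mul_of_nonneg_left (h t ht) (norm_nonneg c)

lemma mem_growthSubspace (A : Matrix n n ℂ) (c : ℝ) (v : n → ℂ) : v ∈ growthSubspace A c ↔
    ∃ C : ℝ, 0 ≤ C ∧ ∀ t : ℝ, 0 ≤ t →
      ‖NormedSpace.exp ((t : ℂ) • A) *ᵥ v‖ ≤ C * Real.exp (c * t) := Iff.rfl

/-- From `x ^ k / k! ≤ exp x` at `x = ε (1 + t)`. This is where the loss of `ε` pays for Jordan
blocks. -/
lemma one_add_pow_le_exp {ε : ℝ} (hε : 0 < ε) (k : ℕ) {t : ℝ} (ht : 0 ≤ t) :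
    (1 + t) ^ k ≤ k.factorial / ε ^ k * Real.exp ε * Real.exp (ε * t) := by
  have h1 := Real.pow_div_factorial_le_exp (ε * (1 + t)) (by positivity) k
  rw [mul_assoc, ← Real.exp_add, ← mul_one_add, div_mul_eq_mul_div, le_div_iff₀ (by positivity)]
  rw [div_le_iff₀ (by positivity), mul_pow] at h1
  linarith

lemma maxGenEigenspace_le_growthSubspace (A : Matrix n n ℂ) {η ε : ℝ} (hε : 0 < ε) {w : ℂ}
    (hw : w.re ≤ η) :
    Module.End.maxGenEigenspace (Matrix.toLin' A) w ≤ growthSubspace A (η + ε) := by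
  intro v hv
  obtain ⟨k, hk⟩ := (Module.End.mem_maxGenEigenspace _ _ _).mp hv
  obtain ⟨C, hC, h⟩ := exists_poly_bound_exp_mulVec A w k v hk
  rw [mem_growthSubspace]
  refine ⟨C * (k.factorial / ε ^ k * Real.exp ε), by positivity, fun t ht => (h t ht).trans ?_⟩
  have h2 := one_add_pow_le_exp hε k ht
  have h3 : Real.exp (w.re * t) ≤ Real.exp (η * t) := by
    gcongr
  calc C * (1 + t) ^ k * Real.exp (w.re * t)
      ≤ C * (k.factorial / ε ^ k * Real.exp ε * Real.exp (ε * t)) * Real.exp (η * t) := by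
        gcongr
    _ = C * (k.factorial / ε ^ k * Real.exp ε) * Real.exp ((η + ε) * t) := by
        rw [add_mul, Real.exp_add]
        ring

/-- The vectors of controlled growth form a subspace that contains every generalized eigenspace, and
over `ℂ` these span. -/
lemma growthSubspace_eq_top (A : Matrix n n ℂ) {η ε : ℝ} (hε : 0 < ε)
    (hη : ∀ w : ℂ, Module.End.HasEigenvalue (Matrix.toLin' A) w → w.re ≤ η) :
    growthSubspace A (η + ε) = ⊤ := by
  rw [eq_top_iff, ← Module.End.iSup_maxGenEigenspace_eq_top (Matrix.toLin' A)]
  refine iSup_le fun w => ?_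
  by_cases hw : Module.End.HasUnifEigenvalue (Matrix.toLin' A) w ⊤
  · exact maxGenEigenspace_le_growthSubspace A hε (hη w (hw.lt zero_lt_one))
  · rw [Module.End.HasUnifEigenvalue, not_not] at hw
    rw [Module.End.maxGenEigenspace, hw]
    exact bot_le

/-- The spectral bound of a matrix is its growth bound. -/
lemma exists_growth_bound (A : Matrix n n ℂ) {η ε : ℝ} (hε : 0 < ε)
    (hη : ∀ w : ℂ, Module.End.HasEigenvalue (Matrix.toLin' A) w → w.re ≤ η) :
    ∃ C : ℝ, 0 ≤ C ∧ ∀ t : ℝ, 0 ≤ t → ∀ v,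
      nsq (NormedSpace.exp ((t : ℂ) • A) *ᵥ v) ≤ C * Real.exp (2 * (η + ε) * t) * nsq v := by
  -- The constant in `growthSubspace` depends on the vector; summing those of the standard basis
  -- makes it uniform.
  choose C hC h using fun i : n => (mem_growthSubspace A (η + ε) (Pi.single i 1)).mp
    (growthSubspace_eq_top A hε hη ▸ Submodule.mem_top)
  have hC' : 0 ≤ ∑ i, C i := Finset.sum_nonneg fun i _ => hC i
  refine ⟨Fintype.card n * (∑ i, C i) ^ 2, by positivity, fun t ht v => ?_⟩
  have h1 : ‖NormedSpace.exp ((t : ℂ) • A) *ᵥ v‖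
      ≤ (∑ i, C i) * Real.exp ((η + ε) * t) * ‖v‖ := by
    have hv : v = ∑ i, v i • (Pi.single i 1 : n → ℂ) := pi_eq_sum_univ' v
    conv_lhs => rw [hv]
    rw [Matrix.mulVec_sum, Finset.sum_mul, Finset.sum_mul]
    refine (norm_sum_le _ _).trans (Finset.sum_le_sum fun i _ => ?_)
    rw [Matrix.mulVec_smul, norm_smul, mul_comm]
    have := hC i
    gcongr
    · exact h i t ht
    · exact norm_le_pi_norm v i
  calc nsq (NormedSpace.exp ((t : ℂ) • A) *ᵥ v)
      ≤ Fintype.card n * ‖NormedSpace.exp ((t : ℂ) • A) *ᵥ v‖ ^ 2 := nsq_le_card_mul _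
    _ ≤ Fintype.card n * ((∑ i, C i) * Real.exp ((η + ε) * t) * ‖v‖) ^ 2 := by gcongr
    _ = Fintype.card n * (∑ i, C i) ^ 2 * Real.exp (2 * (η + ε) * t) * ‖v‖ ^ 2 := by
        rw [show 2 * (η + ε) * t = (η + ε) * t + (η + ε) * t by ring, Real.exp_add]
        ring
    _ ≤ _ := by
        gcongr
        exact norm_sq_le_nsq v

end Growth

/-! ### Weighted energy estimates -/

section Energy

variable {n : Type} [Fintype n]

/-- A weighted sum of the squares of the moduli of the components. -/
noncomputable def wsq (w : n → ℝ) (v : n → ℂ) : ℝ := ∑ i, w i * ‖v i‖ ^ 2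

/-- The rate of change of `wsq w / 2` at `v` along the flow of `A`. -/
noncomputable def energyForm (w : n → ℝ) (A : Matrix n n ℂ) (v : n → ℂ) : ℝ :=
  ∑ i, w i * ((starRingEnd ℂ) (v i) * (A *ᵥ v) i).re

lemma wsq_le_of_le {w : n → ℝ} {b : ℝ} (hb : ∀ i, w i ≤ b) (v : n → ℂ) :
    wsq w v ≤ b * nsq v := by
  rw [wsq, nsq, Finset.mul_sum]
  exact Finset.sum_le_sum fun i _ => mul_le_mul_of_nonneg_right (hb i) (sq_nonneg _)

lemma le_wsq_of_le {w : n → ℝ} {a : ℝ} (ha : ∀ i, a ≤ w i) (v : n → ℂ) :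
    a * nsq v ≤ wsq w v := by
  rw [wsq, nsq, Finset.mul_sum]
  exact Finset.sum_le_sum fun i _ => mul_le_mul_of_nonneg_right (ha i) (sq_nonneg _)

lemma wsq_pos {w : n → ℝ} (hw : ∀ i, 0 < w i) {v : n → ℂ} (hv : v ≠ 0) : 0 < wsq w v := by
  obtain ⟨i, hi⟩ := Function.ne_iff.mp hv
  refine Finset.sum_pos' (fun j _ => mul_nonneg (hw j).le (sq_nonneg _)) ⟨i, Finset.mem_univ i, ?_⟩
  exact mul_pos (hw i) (pow_pos (norm_pos_iff.mpr hi) 2)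

/-- Pairing the eigenvalue equation with `v` in the weighted product gives `energyForm w A v = z.re
* wsq w v`. -/
lemma re_le_of_energyForm_le {w : n → ℝ} (hw : ∀ i, 0 < w i) {A : Matrix n n ℂ} {c : ℝ}
    {v : n → ℂ} (hA : energyForm w A v ≤ c * wsq w v) (hv : v ≠ 0) {z : ℂ}
    (hz : A *ᵥ v = z • v) : z.re ≤ c := by
  have h : energyForm w A v = z.re * wsq w v := by
    rw [energyForm, wsq, Finset.mul_sum]
    refine Finset.sum_congr rfl fun i _ => ?_
    rw [hz, Pi.smul_apply, smul_eq_mul, mul_left_comm, Complex.conj_mul', ← Complex.ofReal_pow,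
      Complex.re_mul_ofReal]
    ring
  rw [h] at hA
  exact le_of_mul_le_mul_right hA (wsq_pos hw hv)

variable [DecidableEq n]

/-- Grönwall: `exp (-2ct)` times the energy is nonincreasing. -/
lemma wsq_exp_mulVec_le {w : n → ℝ} {A : Matrix n n ℂ} {c : ℝ}
    (hA : ∀ v, energyForm w A v ≤ c * wsq w v) (v : n → ℂ) {t : ℝ} (ht : 0 ≤ t) :
    wsq w (NormedSpace.exp ((t : ℂ) • A) *ᵥ v) ≤ Real.exp (2 * c * t) * wsq w v := by
  set y : ℝ → n → ℂ := fun t => NormedSpace.exp ((t : ℂ) • A) *ᵥ v with hy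
  have hd : ∀ s, HasDerivAt (fun s => wsq w (y s)) (2 * energyForm w A (y s)) s := by
    intro s
    have h1 := hasDerivAt_pi.mp (hasDerivAt_exp_mulVec A v s)
    unfold wsq energyForm
    rw [Finset.mul_sum]
    refine HasDerivAt.fun_sum fun i _ => ?_
    rw [mul_left_comm]
    refine HasDerivAt.const_mul _ ?_
    refine (h1 i).norm_sq.congr_deriv ?_
    rw [exp_mulVec_mulVec_comm, Complex.inner, mul_comm ((A *ᵥ _) i)]
  have hφ : ∀ s, HasDerivAt (fun s => Real.exp (-(2 * c * s)) * wsq w (y s))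
      (Real.exp (-(2 * c * s)) * (-(2 * c * 1)) * wsq w (y s)
        + Real.exp (-(2 * c * s)) * (2 * energyForm w A (y s))) s := fun s =>
    ((((hasDerivAt_id s).const_mul (2 * c)).neg).exp).mul (hd s)
  have hanti : Antitone fun s => Real.exp (-(2 * c * s)) * wsq w (y s) := by
    refine antitone_of_deriv_nonpos (fun s => (hφ s).differentiableAt) fun s => ?_
    rw [(hφ s).deriv]
    have h1 := hA (y s)
    have h2 := Real.exp_pos (-(2 * c * s))
    nlinarith
  have h := hanti ht
  simp only [hy, exp_zero_smul_mulVec, mul_zero, neg_zero, Real.exp_zero, one_mul] at h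
  have h2 := mul_le_mul_of_nonneg_left h (Real.exp_pos (2 * c * t)).le
  rwa [← mul_assoc, ← Real.exp_add, add_neg_cancel, Real.exp_zero, one_mul] at h2

end Energy

end Micropolar

namespace Micropolar

open MeasureTheory Filter

/-! ### The symbol in coordinates -/

section Symbol

/-- The bilinear product `k · z` of a real and a complex vector. -/
noncomputable def dotC (k : Fin 3 → ℝ) (z : Fin 3 → ℂ) : ℂ := k 0 * z 0 + k 1 * z 1 + k 2 * z 2

/-- The vector product `k × z` of a real and a complex vector. -/
noncomputable def crossC (k : Fin 3 → ℝ) (z : Fin 3 → ℂ) : Fin 3 → ℂ :=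
  ![k 1 * z 2 - k 2 * z 1, k 2 * z 0 - k 0 * z 2, k 0 * z 1 - k 1 * z 0]

/-- The vector `|k|² P_⊥(k) z = |k|² z - (k · z) k`. -/
noncomputable def perpC (k : Fin 3 → ℝ) (z : Fin 3 → ℂ) : Fin 3 → ℂ :=
  fun j => ((k ⬝ᵥ k : ℝ) : ℂ) * z j - k j * dotC k z

/-- The velocity components. -/
def velocity (f : Idx → ℂ) : Fin 3 → ℂ := fun j => f (Sum.inl j)

/-- The angular velocity components. -/
def spin (f : Idx → ℂ) : Fin 3 → ℂ := fun j => f (Sum.inr (Sum.inl j))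

/-- The remaining components. -/
def tail (f : Idx → ℂ) : Fin 2 → ℂ := fun j => f (Sum.inr (Sum.inr j))

lemma nsq_eq_add (f : Idx → ℂ) : nsq f = nsq (velocity f) + (nsq (spin f) + nsq (tail f)) := by
  simp only [nsq, velocity, spin, tail, Fintype.sum_sum_type]

lemma dot_self (k : Fin 3 → ℝ) : k ⬝ᵥ k = k 0 ^ 2 + k 1 ^ 2 + k 2 ^ 2 := by
  simp only [dotProduct, Fin.sum_univ_three]
  ring

lemma dot_self_nonneg (k : Fin 3 → ℝ) : 0 ≤ k ⬝ᵥ k := by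
  rw [dot_self]
  positivity

lemma dot_self_pos {k : Fin 3 → ℝ} (hk : k ≠ 0) : 0 < k ⬝ᵥ k :=
  lt_of_le_of_ne (dot_self_nonneg k) fun h => hk (dotProduct_self_eq_zero.mp h.symm)

lemma smul_projPar (k : Fin 3 → ℝ) : (k ⬝ᵥ k) • projPar k = Matrix.vecMulVec k k := by
  rcases eq_or_ne k 0 with rfl | hk
  · simp
  · rw [projPar, smul_smul, mul_inv_cancel₀ (dot_self_pos hk).ne', one_smul]

lemma smul_projPerp (k : Fin 3 → ℝ) :
    (k ⬝ᵥ k) • projPerp k = (k ⬝ᵥ k) • 1 - Matrix.vecMulVec k k := by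
  rw [projPerp, smul_sub, smul_projPar]

lemma crossMat_mul_vecMulVec (k : Fin 3 → ℝ) : crossMat k * Matrix.vecMulVec k k = 0 := by
  ext i j
  fin_cases i <;> simp [crossMat, Matrix.mul_apply, Fin.sum_univ_three, Matrix.vecMulVec] <;> ring

lemma crossMat_mul_projPerp (k : Fin 3 → ℝ) : crossMat k * projPerp k = crossMat k := by
  rw [projPerp, projPar, mul_sub, Matrix.mul_smul, crossMat_mul_vecMulVec, smul_zero, mul_one,
    sub_zero]

lemma toC_projPerp_mulVec (k : Fin 3 → ℝ) (z : Fin 3 → ℂ) :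
    ((k ⬝ᵥ k : ℝ) : ℂ) • (toC (projPerp k) *ᵥ z) = perpC k z := by
  have h := smul_projPerp k
  have h2 : ((k ⬝ᵥ k : ℝ) : ℂ) • toC (projPerp k) = toC ((k ⬝ᵥ k) • 1 - Matrix.vecMulVec k k) := by
    rw [← h]
    ext i j
    simp [toC]
  rw [← Matrix.smul_mulVec, h2]
  ext j
  fin_cases j <;>
    simp [toC, Matrix.mulVec, dotProduct, Fin.sum_univ_three, Matrix.vecMulVec, perpC, dotC,
      Matrix.one_apply] <;> ring

variable (P : Params) (k : Fin 3 → ℝ) (f : Idx → ℂ)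

/-- Each projection either carries a factor `|k|²` or follows `k ×`, so no division by `|k|²`
remains. The entries are polynomial in `k` and `k = 0` is no special case. -/
lemma symbolB_eq : P.symbolB k = Matrix.fromBlocks
    (toC (-(P.mu + P.kappa / 2) • ((k ⬝ᵥ k) • 1 - Matrix.vecMulVec k k)))
    (Matrix.fromCols (Complex.I • toC (P.kappa • crossMat k)) 0)
    (Matrix.fromRows (Complex.I • toC (P.jInv * (P.kappa • crossMat k))) 0)
    (toC (Matrix.fromBlocks
      (-(2 * P.kappa) • P.jInv
        - (P.alpha + 4 * P.beta / 3) • (P.jInv * Matrix.vecMulVec k k)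
        - (P.beta + P.gamma) • (P.jInv * ((k ⬝ᵥ k) • 1 - Matrix.vecMulVec k k))
        - ((1 - P.nu / P.lam) * P.speed) • R33)
      (-(P.lam⁻¹ * P.speed ^ 2) • R32)
      ((P.lam - P.nu) • R23)
      (P.speed • R22))) := by
  unfold Params.symbolB
  rw [mul_assoc, Matrix.smul_mul, crossMat_mul_projPerp, neg_mul_eq_neg_mul, mul_smul, mul_smul,
    mul_smul, ← Matrix.mul_smul P.jInv (k ⬝ᵥ k) (projPar k),
    ← Matrix.mul_smul P.jInv (k ⬝ᵥ k) (projPerp k), smul_projPar, smul_projPerp]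

lemma velocity_symbolB : velocity (P.symbolB k *ᵥ f) = fun j =>
    -(P.mu + P.kappa / 2) * perpC k (velocity f) j
      + Complex.I * P.kappa * crossC k (spin f) j := by
  rw [symbolB_eq]
  funext j
  fin_cases j <;>
    simp [velocity, spin, perpC, crossC, dotC, Matrix.mulVec, dotProduct, Fintype.sum_sum_type,
      Fin.sum_univ_three, Matrix.vecMulVec, toC, crossMat, Matrix.one_apply] <;> ring

lemma spin_symbolB : spin (P.symbolB k *ᵥ f) = fun j =>
    ((![P.lam⁻¹, P.lam⁻¹, P.nu⁻¹] j : ℝ) : ℂ) * (Complex.I * P.kappa * crossC k (velocity f) j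
      - 2 * P.kappa * spin f j - (P.alpha + 4 * P.beta / 3) * (k j * dotC k (spin f))
      - (P.beta + P.gamma) * perpC k (spin f) j)
      - (1 - P.nu / P.lam) * P.speed * ![-spin f 1, spin f 0, 0] j
      - (P.lam⁻¹ : ℂ) * P.speed ^ 2 * ![-tail f 1, tail f 0, 0] j := by
  rw [symbolB_eq]
  funext j
  fin_cases j <;>
    simp [velocity, spin, tail, perpC, crossC, dotC, Matrix.mulVec, dotProduct,
      Fintype.sum_sum_type, Fin.sum_univ_three, Matrix.vecMulVec, toC, crossMat, Matrix.one_apply,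
      Params.jInv, R33, R32, Matrix.diagonal_mul, Matrix.diagonal_apply] <;> ring

lemma tail_symbolB : tail (P.symbolB k *ᵥ f) = fun j =>
    (P.lam - P.nu) * ![-spin f 1, spin f 0] j + P.speed * ![-tail f 1, tail f 0] j := by
  rw [symbolB_eq]
  funext j
  fin_cases j <;>
    simp [spin, tail, Matrix.mulVec, dotProduct,
      Fintype.sum_sum_type, Fin.sum_univ_three, toC, R22, R23]
  ring

/-- The weights `(1, J_eq, s²)` of the energy. -/
noncomputable def weight : Idx → ℝ :=
  Sum.elim (fun _ => 1) (Sum.elim ![P.lam, P.lam, P.nu] fun _ => P.speed ^ 2 / (P.lam - P.nu))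

/-- The matrix `|k|² P_⊥` is the square of the Hermitian matrix `i k ×`. -/
lemma sum_conj_perpC (z : Fin 3 → ℂ) :
    ∑ j, ((starRingEnd ℂ) (z j) * perpC k z j).re = nsq (crossC k z) := by
  simp [Fin.sum_univ_three, perpC, crossC, dotC, nsq, Complex.sq_norm, Complex.normSq_apply]
  rw [dot_self]
  ring

lemma nsq_perpC (z : Fin 3 → ℂ) : nsq (perpC k z) = (k ⬝ᵥ k) * nsq (crossC k z) := by
  simp [Fin.sum_univ_three, perpC, crossC, dotC, nsq, Complex.sq_norm, Complex.normSq_apply]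
  rw [dot_self]
  ring

/-- Lagrange's identity. -/
lemma dot_self_mul_nsq (z : Fin 3 → ℂ) :
    (k ⬝ᵥ k) * nsq z = nsq (crossC k z) + ‖dotC k z‖ ^ 2 := by
  simp [Fin.sum_univ_three, crossC, dotC, nsq, dot_self]
  simp [Complex.sq_norm, Complex.normSq_apply]
  ring

/-- The weight `J_eq` cancels `J_eq⁻¹`. The rotations `R33` and `R22` act where the weights are
constant, so, being skew, they contribute nothing. The weight on `a` gives both couplings of `ω` and
`a` the size `d²`, so that they merge into one real part, as do the two couplings of `u` and `ω`. -/
lemma energyForm_symbolB (hnu : 0 < P.nu) (hlam : P.nu < P.lam) :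
    energyForm (weight P) (P.symbolB k) f =
      -(P.mu + P.kappa / 2) * nsq (crossC k (velocity f))
      + 2 * P.kappa * ∑ j, ((starRingEnd ℂ) (spin f j) * (Complex.I * crossC k (velocity f) j)).re
      - 2 * P.kappa * nsq (spin f) - (P.alpha + 4 * P.beta / 3) * ‖dotC k (spin f)‖ ^ 2
      - (P.beta + P.gamma) * nsq (crossC k (spin f))
      - 2 * P.speed ^ 2 * ((starRingEnd ℂ) (spin f 1) * tail f 0
        - (starRingEnd ℂ) (spin f 0) * tail f 1).re := by
  have h0 : P.nu ≠ 0 := hnu.ne'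
  have h1 : P.lam ≠ 0 := (hnu.trans hlam).ne'
  have h2 : P.lam - P.nu ≠ 0 := (sub_pos.mpr hlam).ne'
  have hu := fun j => congrFun (velocity_symbolB P k f) j
  have hw := fun j => congrFun (spin_symbolB P k f) j
  have ha := fun j => congrFun (tail_symbolB P k f) j
  have e : energyForm (weight P) (P.symbolB k) f =
      ∑ j, ((starRingEnd ℂ) (velocity f j) * velocity (P.symbolB k *ᵥ f) j).re
      + (∑ j, ![P.lam, P.lam, P.nu] j * ((starRingEnd ℂ) (spin f j) * spin (P.symbolB k *ᵥ f) j).re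
      + ∑ j, P.speed ^ 2 / (P.lam - P.nu) *
        ((starRingEnd ℂ) (tail f j) * tail (P.symbolB k *ᵥ f) j).re) := by
    simp [energyForm, Fintype.sum_sum_type, weight, velocity, spin, tail]
  rw [e]
  simp only [hu, hw, ha]
  generalize velocity f = u
  generalize spin f = v
  generalize tail f = a
  rw [← sum_conj_perpC, ← sum_conj_perpC]
  generalize perpC k u = pu
  generalize perpC k v = pv
  simp [Fin.sum_univ_three, crossC, dotC, nsq, Complex.sq_norm, Complex.normSq_apply,
    -Complex.inv_re, ← Complex.ofReal_inv, ← Complex.ofReal_pow, ← Complex.ofReal_div]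
  field_simp
  ring

end Symbol

end Micropolar

namespace Micropolar

open MeasureTheory Filter

/-! ### Symmetry, incompressibility and energy estimate for the symbol -/

section EnergyEstimate

variable (P : Params) (k : Fin 3 → ℝ) (f : Idx → ℂ)

lemma idx_ext {f g : Idx → ℂ} (hu : velocity f = velocity g) (hv : spin f = spin g)
    (ha : tail f = tail g) : f = g := by
  funext i
  rcases i with i | i | i
  · exact congrFun hu i
  · exact congrFun hv i
  · exact congrFun ha i

lemma symbolB_neg : P.symbolB (-k) = (P.symbolB k).map (starRingEnd ℂ) := by
  have hpar : projPar (-k) = projPar k := by simp [projPar]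
  have hperp : projPerp (-k) = projPerp k := by rw [projPerp, hpar, projPerp]
  have hcross : crossMat (-k) = -crossMat k := by
    ext i j
    fin_cases i <;> fin_cases j <;> simp [crossMat]
  rw [Params.symbolB, Params.symbolB, hpar, hperp, hcross, neg_dotProduct_neg]
  ext i j
  rcases i with i | i | i <;> rcases j with j | j | j <;> simp [toC, Complex.conj_ofNat]

lemma dotC_velocity_symbolB : dotC k (velocity (P.symbolB k *ᵥ f)) = 0 := by
  rw [velocity_symbolB]
  simp [dotC, perpC, crossC, dot_self]
  ring

lemma wsq_weight : wsq (weight P) f = nsq (velocity f) + (∑ j, ![P.lam, P.lam, P.nu] j *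
    ‖spin f j‖ ^ 2 + P.speed ^ 2 / (P.lam - P.nu) * nsq (tail f)) := by
  simp [wsq, nsq, Fintype.sum_sum_type, weight, velocity, spin, tail]
  ring

lemma weight_pos (hnu : 0 < P.nu) (hlam : P.nu < P.lam) (hd : 0 < P.speed) (i : Idx) :
    0 < weight P i := by
  have h1 := hnu.trans hlam
  have h2 := sub_pos.mpr hlam
  rcases i with i | i | i
  · exact one_pos
  · fin_cases i <;> assumption
  · simp only [weight, Sum.elim_inr]
    positivity

/-- Diffusion supplies `-m|k|²|ω|²`, which absorbs the coupling of `ω` and `a` at the cost of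
`d⁴/(m|k|²) |a|²`. Measured in the weight `d²/(λ-ν)` of `a`, this is the stated rate, which tends to
`0` as `|k|` grows. -/
lemma energyForm_symbolB_le (hnu : 0 < P.nu) (hlam : P.nu < P.lam) (hmu : 0 < P.mu)
    (hkappa : 0 < P.kappa) {m : ℝ} (hm : 0 < m) (halpha : m ≤ P.alpha + 4 * P.beta / 3)
    (hgamma : m ≤ P.beta + P.gamma) (hd : 0 < P.speed) (hk : k ≠ 0) :
    energyForm (weight P) (P.symbolB k) f
      ≤ P.speed ^ 2 * (P.lam - P.nu) / (m * (k ⬝ᵥ k)) * wsq (weight P) f := by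
  have hK := dot_self_pos hk
  have hln : 0 < P.lam - P.nu := sub_pos.mpr hlam
  rw [energyForm_symbolB P k f hnu hlam]
  -- Young's inequality with constants that use up exactly the `κ/2` part of the viscosity and the
  -- damping `2κ|ω|²`.
  have h1 : 2 * P.kappa * ∑ j, ((starRingEnd ℂ) (spin f j) *
      (Complex.I * crossC k (velocity f) j)).re
      ≤ P.kappa / 2 * nsq (crossC k (velocity f)) + 2 * P.kappa * nsq (spin f) := by
    rw [nsq, nsq, Finset.mul_sum, Finset.mul_sum, Finset.mul_sum, ← Finset.sum_add_distrib]
    refine Finset.sum_le_sum fun j _ => ?_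
    have h := Complex.re_le_norm ((starRingEnd ℂ) (spin f j) *
      (Complex.I * crossC k (velocity f) j))
    rw [norm_mul, norm_mul, Complex.norm_I, one_mul, RCLike.norm_conj] at h
    nlinarith [mul_nonneg hkappa.le (sq_nonneg (‖crossC k (velocity f) j‖ - 2 * ‖spin f j‖))]
  have h2 := dot_self_mul_nsq k (spin f)
  have h3 : ∀ x y : ℂ, 2 * P.speed ^ 2 * (‖x‖ * ‖y‖)
      ≤ m * (k ⬝ᵥ k) * ‖x‖ ^ 2 + P.speed ^ 4 / (m * (k ⬝ᵥ k)) * ‖y‖ ^ 2 := by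
    intro x y
    have hmK : 0 < m * (k ⬝ᵥ k) := by positivity
    have h : m * (k ⬝ᵥ k) * ‖x‖ ^ 2 + P.speed ^ 4 / (m * (k ⬝ᵥ k)) * ‖y‖ ^ 2
        - 2 * P.speed ^ 2 * (‖x‖ * ‖y‖)
        = (m * (k ⬝ᵥ k) * ‖x‖ - P.speed ^ 2 * ‖y‖) ^ 2 / (m * (k ⬝ᵥ k)) := by
      field_simp
      ring
    have h' : 0 ≤ (m * (k ⬝ᵥ k) * ‖x‖ - P.speed ^ 2 * ‖y‖) ^ 2 / (m * (k ⬝ᵥ k)) := by positivity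
    linarith
  have h4 : -(2 * P.speed ^ 2 * ((starRingEnd ℂ) (spin f 1) * tail f 0
      - (starRingEnd ℂ) (spin f 0) * tail f 1).re)
      ≤ m * (k ⬝ᵥ k) * nsq (spin f) + P.speed ^ 4 / (m * (k ⬝ᵥ k)) * nsq (tail f) := by
    have h := Complex.abs_re_le_norm ((starRingEnd ℂ) (spin f 1) * tail f 0
      - (starRingEnd ℂ) (spin f 0) * tail f 1)
    have h' := h.trans (norm_sub_le _ _)
    rw [norm_mul, norm_mul, RCLike.norm_conj, RCLike.norm_conj] at h'
    have h5 := neg_le_of_abs_le h'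
    have h6 := h3 (spin f 1) (tail f 0)
    have h7 := h3 (spin f 0) (tail f 1)
    have h8 : 0 ≤ m * (k ⬝ᵥ k) * ‖spin f 2‖ ^ 2 := by positivity
    have h9 := mul_le_mul_of_nonneg_left h5 (by positivity : 0 ≤ 2 * P.speed ^ 2)
    simp only [nsq, Fin.sum_univ_three, Fin.sum_univ_two]
    linarith
  have h5 : m * ‖dotC k (spin f)‖ ^ 2 ≤ (P.alpha + 4 * P.beta / 3) * ‖dotC k (spin f)‖ ^ 2 := by
    gcongr
  have h6 : m * nsq (crossC k (spin f)) ≤ (P.beta + P.gamma) * nsq (crossC k (spin f)) :=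
    mul_le_mul_of_nonneg_right hgamma (nsq_nonneg _)
  have h7 : 0 ≤ P.mu * nsq (crossC k (velocity f)) := mul_nonneg hmu.le (nsq_nonneg _)
  have h8 : P.speed ^ 4 / (m * (k ⬝ᵥ k)) * nsq (tail f)
      ≤ P.speed ^ 2 * (P.lam - P.nu) / (m * (k ⬝ᵥ k)) * wsq (weight P) f := by
    have h9 : P.speed ^ 2 / (P.lam - P.nu) * nsq (tail f) ≤ wsq (weight P) f := by
      rw [wsq_weight]
      have h10 : 0 ≤ ∑ j, ![P.lam, P.lam, P.nu] j * ‖spin f j‖ ^ 2 := by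
        have := hnu.trans hlam
        simp only [Fin.sum_univ_three, Matrix.cons_val]
        positivity
      linarith [nsq_nonneg (velocity f)]
    have h11 := mul_le_mul_of_nonneg_left h9
      (by positivity : 0 ≤ P.speed ^ 2 * (P.lam - P.nu) / (m * (k ⬝ᵥ k)))
    refine le_trans (le_of_eq ?_) h11
    field_simp
  nlinarith

end EnergyEstimate

/-! ### Eigenvalues -/

section Eigenvalues

open Params

variable {n : Type} [Fintype n] [DecidableEq n]

lemma hasEigenvalue_toLin'_iff (A : Matrix n n ℂ) (w : ℂ) :
    Module.End.HasEigenvalue (Matrix.toLin' A) w ↔ ∃ v, v ≠ 0 ∧ A *ᵥ v = w • v := by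
  constructor
  · intro h
    obtain ⟨v, hv⟩ := h.exists_hasEigenvector
    exact ⟨v, hv.2, by simpa using hv.apply_eq_smul⟩
  · rintro ⟨v, hv, h⟩
    exact Module.End.hasEigenvalue_of_hasEigenvector (x := v)
      (Module.End.hasEigenvector_iff.mpr ⟨Module.End.mem_eigenspace_iff.mpr (by simpa using h), hv⟩)

variable (P : Params) (k : Fin 3 → ℝ)

lemma crossMat_mul_crossMat : crossMat k * crossMat k = Matrix.vecMulVec k k - (k ⬝ᵥ k) • 1 := by
  rw [dot_self]
  ext i j
  fin_cases i <;> fin_cases j <;>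
    simp [crossMat, Matrix.mul_apply, Fin.sum_univ_three, Matrix.vecMulVec] <;> ring

lemma toC_mul {l m p : Type} [Fintype m] (A : Matrix l m ℝ) (B : Matrix m p ℝ) :
    toC (A * B) = toC A * toC B := by
  ext i j
  simp [toC, Matrix.mul_apply]

lemma toC_smul {l m : Type} (c : ℝ) (A : Matrix l m ℝ) : toC (c • A) = (c : ℂ) • toC A := by
  ext i j
  simp [toC]

lemma symbolT_mul_symbolT :
    symbolT k * symbolT k = -((k ⬝ᵥ k : ℝ) : ℂ)⁻¹ • toC (crossMat k * crossMat k) := by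
  have h : (Real.sqrt (k ⬝ᵥ k))⁻¹ * (Real.sqrt (k ⬝ᵥ k))⁻¹ = (k ⬝ᵥ k)⁻¹ := by
    rw [← mul_inv, Real.mul_self_sqrt (dot_self_nonneg k)]
  have h2 : toC ((Real.sqrt (k ⬝ᵥ k))⁻¹ • crossMat k) * toC ((Real.sqrt (k ⬝ᵥ k))⁻¹ • crossMat k)
      = ((k ⬝ᵥ k : ℝ) : ℂ)⁻¹ • toC (crossMat k * crossMat k) := by
    rw [← toC_mul, Matrix.smul_mul, Matrix.mul_smul, smul_smul, h, toC_smul, Complex.ofReal_inv]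
  rw [symbolT, Matrix.smul_mul, Matrix.mul_smul, smul_smul, Complex.I_mul_I, h2, neg_smul,
    one_smul, neg_smul]

lemma smul_crossMat_cube : crossMat k * (crossMat k * crossMat k) = -(k ⬝ᵥ k) • crossMat k := by
  rw [crossMat_mul_crossMat, mul_sub, crossMat_mul_vecMulVec, zero_sub, Matrix.mul_smul, mul_one,
    neg_smul]

/-- For `k ≠ 0`, `T(k)²` is the projection onto the complement of `k`, the rest being killed by `k
×`. At `k = 0` both sides vanish. -/
lemma toC_crossMat_mul_symbolT_sq :
    toC (crossMat k) * (symbolT k * symbolT k) = toC (crossMat k) := by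
  rcases eq_or_ne k 0 with rfl | hk
  · have h : crossMat 0 = 0 := by
      ext i j
      fin_cases i <;> fin_cases j <;> simp [crossMat]
    simp [h, toC]
  · have h : ((k ⬝ᵥ k : ℝ) : ℂ) ≠ 0 := by exact_mod_cast (dot_self_pos hk).ne'
    rw [symbolT_mul_symbolT, Matrix.mul_smul, ← toC_mul, smul_crossMat_cube, toC_smul, smul_smul]
    push_cast
    rw [neg_mul_neg, inv_mul_cancel₀ h, one_smul]

lemma symbolT_sq_mul_toC_crossMat :
    symbolT k * symbolT k * toC (crossMat k) = toC (crossMat k) := by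
  conv_rhs => rw [← toC_crossMat_mul_symbolT_sq]
  rw [symbolT_mul_symbolT, Matrix.mul_smul, Matrix.smul_mul, ← toC_mul, ← toC_mul, mul_assoc]

lemma sConst_mul_self (hlam : P.nu < P.lam) (hd : 0 < P.speed) : P.sConst ≠ 0 := by
  have : 0 < Real.sqrt (P.lam - P.nu) := Real.sqrt_pos.mpr (sub_pos.mpr hlam)
  unfold Params.sConst
  exact mul_ne_zero (neg_ne_zero.mpr (inv_ne_zero this.ne')) hd.ne'

lemma matQBar_mul_matQ (hnu : 0 < P.nu) (hlam : P.nu < P.lam) (hd : 0 < P.speed) :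
    P.matQBar k * P.matQ k = Matrix.fromBlocks (symbolT k * symbolT k) 0 0 1 := by
  have h1 : Real.sqrt P.lam ≠ 0 := (Real.sqrt_pos.mpr (hnu.trans hlam)).ne'
  have h2 : Real.sqrt P.nu ≠ 0 := (Real.sqrt_pos.mpr hnu).ne'
  have h3 := sConst_mul_self P hlam hd
  have h4 : R22 * R22 = -1 := by
    ext i j
    fin_cases i <;> fin_cases j <;> simp [R22, Matrix.mul_apply]
  rw [Params.matQBar, Params.matQ, Matrix.fromBlocks_multiply, ← toC_mul,
    Matrix.fromBlocks_multiply, Matrix.diagonal_mul_diagonal]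
  simp only [Matrix.zero_mul, Matrix.mul_zero, add_zero, zero_add, Matrix.smul_mul,
    Matrix.mul_smul, smul_smul, h4]
  congr 1
  have h5 : (Matrix.diagonal fun i : Fin 3 =>
      ![(Real.sqrt P.lam)⁻¹, (Real.sqrt P.lam)⁻¹, (Real.sqrt P.nu)⁻¹] i *
        ![Real.sqrt P.lam, Real.sqrt P.lam, Real.sqrt P.nu] i) = 1 := by
    ext i j
    fin_cases i <;> fin_cases j <;> simp [h1, h2]
  have h6 : (P.sConst * -P.sConst⁻¹) • (-1 : Matrix (Fin 2) (Fin 2) ℝ) = 1 := by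
    rw [mul_neg, mul_inv_cancel₀ h3, neg_smul, one_smul, neg_neg]
  rw [h5, h6, smul_zero, Matrix.fromBlocks_one]
  ext i j
  rw [toC, Matrix.map_apply, Matrix.one_apply, Matrix.one_apply]
  split_ifs <;> simp

/-- The velocity rows have a factor `k ×` on the left and the velocity columns one on the right,
because `|k|² P_⊥ = -(k ×)²`. Such factors absorb `T(k)²`. -/
lemma symbolB_blocks : ∃ (A : Matrix (Fin 3) (Fin 3) ℂ) (C : Matrix (Fin 3) (Fin 3 ⊕ Fin 2) ℂ)
    (D : Matrix (Fin 3 ⊕ Fin 2) (Fin 3) ℂ) (E : Matrix (Fin 3 ⊕ Fin 2) (Fin 3 ⊕ Fin 2) ℂ),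
    P.symbolB k = Matrix.fromBlocks (toC (crossMat k) * A * toC (crossMat k))
      (toC (crossMat k) * C) (D * toC (crossMat k)) E := by
  refine ⟨((P.mu + P.kappa / 2 : ℝ) : ℂ) • 1, Matrix.fromCols ((Complex.I * P.kappa) • 1) 0,
    Matrix.fromRows (Complex.I • toC (P.kappa • P.jInv)) 0, (P.symbolB k).toBlocks₂₂, ?_⟩
  rw [symbolB_eq, Matrix.toBlocks_fromBlocks₂₂]
  congr 1
  · have h : (k ⬝ᵥ k) • (1 : Matrix (Fin 3) (Fin 3) ℝ) - Matrix.vecMulVec k k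
        = -(crossMat k * crossMat k) := by
      rw [crossMat_mul_crossMat, neg_sub]
    rw [h, smul_neg, neg_smul, neg_neg, toC_smul, toC_mul, Matrix.mul_smul, mul_one,
      Matrix.smul_mul]
  · rw [Matrix.mul_fromCols, Matrix.mul_zero, toC_smul, smul_smul, Matrix.mul_smul, mul_one]
  · rw [Matrix.fromRows_mul, Matrix.zero_mul, Matrix.smul_mul, ← toC_mul, Matrix.smul_mul,
      Matrix.mul_smul]

lemma symbolB_mul_matQBar_mul_matQ (hnu : 0 < P.nu) (hlam : P.nu < P.lam) (hd : 0 < P.speed) :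
    P.symbolB k * (P.matQBar k * P.matQ k) = P.symbolB k := by
  obtain ⟨A, C, D, E, h⟩ := symbolB_blocks P k
  rw [matQBar_mul_matQ P k hnu hlam hd, h, Matrix.fromBlocks_multiply]
  simp only [Matrix.mul_zero, Matrix.mul_one, add_zero, zero_add, Matrix.mul_assoc,
    toC_crossMat_mul_symbolT_sq]

lemma matQBar_mul_matQ_mul_symbolB (hnu : 0 < P.nu) (hlam : P.nu < P.lam) (hd : 0 < P.speed) :
    P.matQBar k * P.matQ k * P.symbolB k = P.symbolB k := by
  obtain ⟨A, C, D, E, h⟩ := symbolB_blocks P k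
  rw [matQBar_mul_matQ P k hnu hlam hd, h, Matrix.fromBlocks_multiply]
  simp only [Matrix.zero_mul, Matrix.one_mul, add_zero, zero_add, ← Matrix.mul_assoc,
    symbolT_sq_mul_toC_crossMat]

/-- `Q` and `Q̄` are not invertible, but `Q̄ Q B = B = B Q̄ Q`. Hence `Q̄` carries eigenvectors of
`M` to eigenvectors of `B` and `Q` carries them back; for `w ≠ 0` the images cannot vanish. -/
lemma hasEigenvalue_matM_iff (hnu : 0 < P.nu) (hlam : P.nu < P.lam) (hd : 0 < P.speed) {w : ℂ}
    (hw : w ≠ 0) : Module.End.HasEigenvalue (Matrix.toLin' (P.matM k)) w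
      ↔ Module.End.HasEigenvalue (Matrix.toLin' (P.symbolB k)) w := by
  rw [hasEigenvalue_toLin'_iff, hasEigenvalue_toLin'_iff]
  constructor
  · rintro ⟨v, hv, h⟩
    refine ⟨P.matQBar k *ᵥ v, fun h0 => ?_, ?_⟩
    · rw [Params.matM, ← Matrix.mulVec_mulVec, h0, Matrix.mulVec_zero] at h
      exact smul_ne_zero hw hv h.symm
    · rw [← matQBar_mul_matQ_mul_symbolB P k hnu hlam hd, ← Matrix.mulVec_smul, ← h, Params.matM,
        Matrix.mulVec_mulVec, Matrix.mulVec_mulVec]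
      simp only [Matrix.mul_assoc]
  · rintro ⟨f, hf, h⟩
    have hB : P.symbolB k *ᵥ (P.matQBar k *ᵥ (P.matQ k *ᵥ f)) = P.symbolB k *ᵥ f := by
      rw [Matrix.mulVec_mulVec, Matrix.mulVec_mulVec, Matrix.mul_assoc,
        symbolB_mul_matQBar_mul_matQ P k hnu hlam hd]
    refine ⟨P.matQ k *ᵥ f, fun h0 => ?_, ?_⟩
    · rw [h0, Matrix.mulVec_zero, Matrix.mulVec_zero, h] at hB
      exact smul_ne_zero hw hf hB.symm
    · rw [Params.matM, ← Matrix.mulVec_mulVec, ← Matrix.mulVec_mulVec, hB, h, Matrix.mulVec_smul]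

end Eigenvalues

end Micropolar

namespace Micropolar

open MeasureTheory Filter

/-! ### Growth rates -/

section GrowthRates

variable (P : Params)

/-- A quadratic equation with an unstable root. -/
lemma exists_unstable_root {p r d : ℝ} (hp : 0 < p) (hr : 0 < r) (hrd : r < d) :
    ∃ w : ℂ, 0 < w.re ∧ w * w + (p - Complex.I * r) * w - Complex.I * (p * d) = 0 := by
  obtain ⟨w, hw⟩ := exists_quadratic_eq_zero (a := (1 : ℂ)) (b := p - Complex.I * r)
    (c := -(Complex.I * (p * d))) one_ne_zero
    (by
      obtain ⟨s, hs⟩ := IsAlgClosed.exists_pow_nat_eq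
        (discrim (1 : ℂ) (p - Complex.I * r) (-(Complex.I * (p * d)))) (n := 2) two_pos
      exact ⟨s, by rw [← hs, sq]⟩)
  have hw1 : w * w + (p - Complex.I * r) * w - Complex.I * (p * d) = 0 := by
    linear_combination hw
  by_cases h1 : 0 < w.re
  · exact ⟨w, h1, hw1⟩
  -- The other root, by Vieta.
  set z : ℂ := -(p - Complex.I * r) - w with hz
  have hz1 : z * z + (p - Complex.I * r) * z - Complex.I * (p * d) = 0 := by
    rw [hz]
    linear_combination hw1
  have hprod : z * w = -(Complex.I * (p * d)) := by
    rw [hz]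
    linear_combination -hw1
  refine ⟨z, ?_, hz1⟩
  -- Suppose both real parts are `≤ 0`. The product of the roots is purely imaginary, so `z.im *
  -- w.im = z.re * w.re ≥ 0`, and both imaginary parts are nonnegative because their sum is `r > 0`.
  -- The real parts sum to `-p`, so the imaginary part of the product is at least `-p r > -p d`, a
  -- contradiction.
  by_contra h2
  have hre : z.re = -p - w.re := by simp [hz]
  have him : z.im = r - w.im := by simp [hz]
  have e1 := congrArg Complex.re hprod
  have e2 := congrArg Complex.im hprod
  simp at e1 e2
  rw [not_lt] at h1 h2
  have h3 : 0 ≤ z.im * w.im := by nlinarith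
  have h4 : 0 ≤ w.im := by
    by_contra h
    rw [not_le] at h
    nlinarith
  have h5 : 0 ≤ z.im := by
    by_contra h
    rw [not_le] at h
    nlinarith
  nlinarith [mul_nonneg (neg_nonneg.mpr h1) h4, mul_nonneg (neg_nonneg.mpr h2) h5,
    mul_nonneg (neg_nonneg.mpr h1) h5, mul_nonneg (neg_nonneg.mpr h2) h4]

/-- On vectors `(p, -ip)` the matrix `R` is multiplication by `i`. Restricting `ω` and `a` to such
vectors leaves a system for two scalars, whose characteristic equation is the quadratic of
`exists_unstable_root`; the condition `r < d` is `ν < λ`. -/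
lemma exists_unstable_eigenvalue (hnu : 0 < P.nu) (hlam : P.nu < P.lam) (hkappa : 0 < P.kappa)
    (hd : 0 < P.speed) : ∃ w : ℂ, 0 < w.re ∧
      Module.End.HasEigenvalue (Matrix.toLin' (P.symbolB 0)) w := by
  have hl : 0 < P.lam := hnu.trans hlam
  obtain ⟨w, hw, h⟩ := exists_unstable_root (p := 2 * P.kappa / P.lam)
    (r := P.nu / P.lam * P.speed) (d := P.speed) (by positivity) (by positivity)
    (mul_lt_of_lt_one_left hd ((div_lt_one hl).mpr hlam))
  refine ⟨w, hw, (hasEigenvalue_toLin'_iff _ _).mpr ?_⟩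
  have hlc : (P.lam : ℂ) ≠ 0 := by exact_mod_cast hl.ne'
  have hln : (P.lam : ℂ) - P.nu ≠ 0 := by exact_mod_cast (sub_pos.mpr hlam).ne'
  -- `p` and `q` are chosen to solve the equation for `a` identically; the equation for `ω` is then
  -- the quadratic.
  set p : ℂ := w - P.speed * Complex.I with hp
  set q : ℂ := (P.lam - P.nu) * Complex.I with hq
  have h' : (P.lam : ℂ) * w * w + (2 * P.kappa - Complex.I * (P.nu * P.speed)) * w
      - Complex.I * (2 * P.kappa * P.speed) = 0 := by
    have := congrArg (fun z => (P.lam : ℂ) * z) h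
    push_cast at this
    field_simp at this
    linear_combination this
  have key1 : -((P.lam : ℂ)⁻¹ * (2 * P.kappa * p))
      - (1 - P.nu / P.lam) * P.speed * (Complex.I * p)
      - (P.lam : ℂ)⁻¹ * P.speed ^ 2 * (Complex.I * q) = w * p := by
    rw [hp, hq]
    field_simp
    linear_combination -h'
  have key2 : ((P.lam : ℂ) - P.nu) * (Complex.I * p) + P.speed * (Complex.I * q) = w * q := by
    rw [hp, hq]
    ring
  refine ⟨Sum.elim 0 (Sum.elim ![p, -Complex.I * p, 0] ![q, -Complex.I * q]), ?_, ?_⟩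
  · intro h0
    have := congrFun h0 (Sum.inr (Sum.inr 0))
    simp [hq, hln] at this
  · refine idx_ext ?_ ?_ ?_
    · rw [velocity_symbolB]
      funext j
      fin_cases j <;> simp [perpC, crossC, dotC, velocity, spin]
    · rw [spin_symbolB]
      funext j
      fin_cases j <;> simp [perpC, crossC, dotC, velocity, spin, tail]
      · linear_combination key1
      · linear_combination -Complex.I * key1 - ((1 - P.nu / P.lam) * P.speed * p
          + (P.lam : ℂ)⁻¹ * P.speed ^ 2 * q) * Complex.I_mul_I
    · rw [tail_symbolB]
      funext j
      fin_cases j <;> simp [spin, tail]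
      · linear_combination key2
      · linear_combination -Complex.I * key2
          + ((P.lam - P.nu) * p + P.speed * q) * Complex.I_mul_I

lemma finite_wave_le (R : ℝ) : {k : Fin 3 → ℤ | wave k ⬝ᵥ wave k ≤ R}.Finite := by
  obtain ⟨N, hN⟩ := exists_nat_ge (Real.sqrt R)
  refine (Set.finite_Icc (fun _ => -(N : ℤ)) (fun _ => (N : ℤ))).subset fun k hk => ?_
  have h : ∀ j, |(k j : ℝ)| ≤ N := by
    intro j
    refine le_trans ?_ hN
    refine Real.abs_le_sqrt (le_trans ?_ hk)
    rw [dot_self]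
    fin_cases j <;> simp [wave] <;> nlinarith [sq_nonneg (k 0 : ℝ), sq_nonneg (k 1 : ℝ),
      sq_nonneg (k 2 : ℝ)]
  refine ⟨fun j => ?_, fun j => ?_⟩
  · exact_mod_cast (abs_le.mp (h j)).1
  · exact_mod_cast (abs_le.mp (h j)).2

/-- For large wavenumbers the symbol is almost dissipative. -/
lemma exists_energy_bound (hnu : 0 < P.nu) (hlam : P.nu < P.lam) (hmu : 0 < P.mu)
    (hkappa : 0 < P.kappa) (halpha : 0 < P.alpha + 4 * P.beta / 3) (hgamma : 0 < P.beta + P.gamma)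
    (hd : 0 < P.speed) {c : ℝ} (hc : 0 < c) : ∃ R : ℝ, 0 ≤ R ∧
      ∀ k : Fin 3 → ℝ, R < k ⬝ᵥ k → ∀ f,
        energyForm (weight P) (P.symbolB k) f ≤ c * wsq (weight P) f := by
  set m := min (P.alpha + 4 * P.beta / 3) (P.beta + P.gamma) with hm
  have hm0 : 0 < m := lt_min halpha hgamma
  have hln : 0 < P.lam - P.nu := sub_pos.mpr hlam
  -- The value of `|k|²` at which the rate of `energyForm_symbolB_le` equals `c`.
  refine ⟨P.speed ^ 2 * (P.lam - P.nu) / (m * c), by positivity, fun k hk f => ?_⟩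
  have hK : 0 < k ⬝ᵥ k := lt_of_le_of_lt (by positivity) hk
  have hk0 : k ≠ 0 := by
    rintro rfl
    simp at hK
  refine (energyForm_symbolB_le P k f hnu hlam hmu hkappa hm0 (min_le_left _ _) (min_le_right _ _)
    hd hk0).trans ?_
  have hw : 0 ≤ wsq (weight P) f :=
    Finset.sum_nonneg fun i _ => mul_nonneg (weight_pos P hnu hlam hd i).le (sq_nonneg _)
  refine mul_le_mul_of_nonneg_right ?_ hw
  rw [div_lt_iff₀ (by positivity)] at hk
  rw [div_le_iff₀ (by positivity)]
  linarith

/-- With the energy bound at half the unstable rate `w₀.re`, large modes have no eigenvalue of real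
part `≥ w₀.re`. So the rates from `w₀.re` upwards come from finitely many matrices, and a maximum
exists. -/
lemma exists_isGreatest_growthRates (hnu : 0 < P.nu) (hlam : P.nu < P.lam) (hmu : 0 < P.mu)
    (hkappa : 0 < P.kappa) (halpha : 0 < P.alpha + 4 * P.beta / 3) (hgamma : 0 < P.beta + P.gamma)
    (hd : 0 < P.speed) : ∃ η : ℝ, 0 < η ∧ IsGreatest P.growthRates η := by
  obtain ⟨w₀, hw₀, hE⟩ := exists_unstable_eigenvalue P hnu hlam hkappa hd
  have hmem : w₀.re ∈ P.growthRates := by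
    have h0 : wave 0 = 0 := by
      funext j
      simp [wave]
    refine ⟨0, w₀, ?_, rfl⟩
    rw [h0, hasEigenvalue_matM_iff P 0 hnu hlam hd]
    · exact hE
    · rintro rfl
      simp at hw₀
  obtain ⟨R, hR, hb⟩ := exists_energy_bound P hnu hlam hmu hkappa halpha hgamma hd (half_pos hw₀)
  have hfin : (P.growthRates ∩ Set.Ici w₀.re).Finite := by
    refine ((finite_wave_le R).biUnion fun k _ =>
      (Module.End.finite_hasEigenvalue (Matrix.toLin' (P.matM (wave k)))).image
        Complex.re).subset ?_
    rintro x ⟨⟨k, w, hw, rfl⟩, hx⟩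
    rw [Set.mem_Ici] at hx
    refine Set.mem_biUnion (x := k) ?_ ⟨w, hw, rfl⟩
    by_contra hk
    rw [Set.mem_ofPred_eq, not_le] at hk
    have hwne : w ≠ 0 := by
      rintro rfl
      rw [Complex.zero_re] at hx
      linarith
    rw [hasEigenvalue_matM_iff P _ hnu hlam hd hwne, hasEigenvalue_toLin'_iff] at hw
    obtain ⟨v, hv, hvw⟩ := hw
    have := re_le_of_energyForm_le (weight_pos P hnu hlam hd) (hb _ hk v) hv hvw
    linarith
  obtain ⟨η, hη, hmax⟩ := Set.exists_max_image _ id hfin ⟨w₀.re, hmem, Set.mem_Ici.mpr le_rfl⟩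
  have hηw : w₀.re ≤ η := hη.2
  refine ⟨η, hw₀.trans_le hηw, hη.1, fun x hx => ?_⟩
  rcases le_total w₀.re x with h | h
  · exact hmax x ⟨hx, h⟩
  · exact h.trans hηw

/-- The uniform growth bound for the symbol. -/
lemma exists_uniform_growth_bound (hnu : 0 < P.nu) (hlam : P.nu < P.lam) (hmu : 0 < P.mu)
    (hkappa : 0 < P.kappa) (halpha : 0 < P.alpha + 4 * P.beta / 3) (hgamma : 0 < P.beta + P.gamma)
    (hd : 0 < P.speed) {η ε : ℝ} (hη : 0 < η) (hmax : IsGreatest P.growthRates η) (hε : 0 < ε) :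
    ∃ C : ℝ, 1 ≤ C ∧ ∀ (k : Fin 3 → ℤ) (t : ℝ), 0 ≤ t → ∀ v,
      nsq (NormedSpace.exp ((t : ℂ) • P.symbolB (wave k)) *ᵥ v)
        ≤ (C * Real.exp ((η + ε) * t)) ^ 2 * nsq v := by
  -- Since `η > 0`, the energy bound can be taken at the rate `η` itself; only the finitely many
  -- remaining modes need `ε`.
  obtain ⟨R, hR, hb⟩ := exists_energy_bound P hnu hlam hmu hkappa halpha hgamma hd hη
  have hspec : ∀ (k : Fin 3 → ℤ) (w : ℂ),
      Module.End.HasEigenvalue (Matrix.toLin' (P.symbolB (wave k))) w → w.re ≤ η := by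
    intro k w hw
    -- The comparison with `M_k` excludes the eigenvalue `0`, which is harmless because `0 < η`.
    rcases eq_or_ne w 0 with rfl | hw0
    · exact hη.le
    · exact hmax.2 ⟨k, w, (hasEigenvalue_matM_iff P _ hnu hlam hd hw0).mpr hw, rfl⟩
  choose D hD hDb using fun k : Fin 3 → ℤ =>
    exists_growth_bound (P.symbolB (wave k)) hε (hspec k)
  have hpos := weight_pos P hnu hlam hd
  obtain ⟨i₁, -, h1⟩ := Finset.exists_max_image Finset.univ (weight P) Finset.univ_nonempty
  obtain ⟨i₀, -, h0⟩ := Finset.exists_min_image Finset.univ (weight P) Finset.univ_nonempty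
  set a := weight P i₀
  set b := weight P i₁
  have ha : 0 < a := hpos i₀
  set F := (finite_wave_le R).toFinset
  have hsum : 0 ≤ ∑ k ∈ F, D k := Finset.sum_nonneg fun k _ => hD k
  have hba : 0 ≤ b / a := div_nonneg (hpos i₁).le ha.le
  -- The ratio `b / a` of the extreme weights compares the energy with `nsq` for large modes, and
  -- the `D k` serve the others. The summand `1` gives `C ≤ C ^ 2`, so that the bound can be written
  -- with `C ^ 2`.
  set C := 1 + b / a + ∑ k ∈ F, D k with hC
  have hC1 : 1 ≤ C := by linarith
  have hCC : C ≤ C ^ 2 := by nlinarith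
  refine ⟨C, hC1, fun k t ht v => ?_⟩
  have hexp : Real.exp ((η + ε) * t) ^ 2 = Real.exp (2 * (η + ε) * t) := by
    rw [← Real.exp_nat_mul]
    congr 1
    push_cast
    ring
  have key : nsq (NormedSpace.exp ((t : ℂ) • P.symbolB (wave k)) *ᵥ v)
      ≤ C * Real.exp (2 * (η + ε) * t) * nsq v := by
    have hn := nsq_nonneg v
    by_cases hk : wave k ⬝ᵥ wave k ≤ R
    · refine (hDb k t ht v).trans ?_
      have : D k ≤ ∑ k ∈ F, D k :=
        Finset.single_le_sum (f := D) (fun k _ => hD k) ((finite_wave_le R).mem_toFinset.mpr hk)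
      gcongr
      linarith
    · rw [not_le] at hk
      have h2 := wsq_exp_mulVec_le (fun f => hb _ hk f) v ht
      have h3 := le_wsq_of_le (fun i => h0 i (Finset.mem_univ i))
        (NormedSpace.exp ((t : ℂ) • P.symbolB (wave k)) *ᵥ v)
      have h4 := wsq_le_of_le (fun i => h1 i (Finset.mem_univ i)) v
      have h5 : Real.exp (2 * η * t) ≤ Real.exp (2 * (η + ε) * t) := by
        gcongr
        linarith
      have h6 : a * nsq (NormedSpace.exp ((t : ℂ) • P.symbolB (wave k)) *ᵥ v)
          ≤ Real.exp (2 * (η + ε) * t) * (b * nsq v) := by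
        refine h3.trans (h2.trans ?_)
        have := (le_wsq_of_le (fun i => (hpos i).le) v)
        rw [zero_mul] at this
        gcongr
      have h7 : nsq (NormedSpace.exp ((t : ℂ) • P.symbolB (wave k)) *ᵥ v)
          ≤ b / a * Real.exp (2 * (η + ε) * t) * nsq v := by
        rw [div_mul_eq_mul_div, div_mul_eq_mul_div, le_div_iff₀ ha]
        linarith
      refine h7.trans ?_
      gcongr
      linarith
  refine key.trans ?_
  rw [mul_pow, hexp]
  have hn := nsq_nonneg v
  gcongr

end GrowthRates

end Micropolar

namespace Micropolar

open MeasureTheory Filter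

/-! ### Elliptic estimates -/

section Elliptic

variable (P : Params) (k : Fin 3 → ℝ)

lemma nsq_mul_le {n : Type} [Fintype n] {c : n → ℂ} {b : ℝ} (hc : ∀ j, ‖c j‖ ≤ b) (z : n → ℂ) :
    nsq (fun j => c j * z j) ≤ b ^ 2 * nsq z := by
  rw [nsq, nsq, Finset.mul_sum]
  refine Finset.sum_le_sum fun j _ => ?_
  rw [norm_mul, mul_pow]
  have := hc j
  gcongr

lemma nsq_perpC_eq (z : Fin 3 → ℂ) :
    nsq (perpC k z) = (k ⬝ᵥ k) ^ 2 * nsq (toC (projPerp k) *ᵥ z) := by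
  rw [← toC_projPerp_mulVec, nsq_smul, Complex.norm_real, Real.norm_of_nonneg (dot_self_nonneg k)]

lemma nsq_crossC_le (z : Fin 3 → ℂ) : nsq (crossC k z) ≤ (k ⬝ᵥ k) * nsq z := by
  rw [dot_self_mul_nsq]
  linarith [sq_nonneg ‖dotC k z‖]

lemma nsq_crossC_eq (z : Fin 3 → ℂ) :
    nsq (crossC k z) = (k ⬝ᵥ k) * nsq (toC (projPerp k) *ᵥ z) := by
  rcases eq_or_ne k 0 with rfl | hk
  · simp [crossC, nsq, Fin.sum_univ_three]
  · have h := nsq_perpC k z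
    rw [nsq_perpC_eq, sq, mul_assoc] at h
    exact (mul_left_cancel₀ (dot_self_pos hk).ne' h).symm

lemma nsq_projPerp_le (z : Fin 3 → ℂ) : nsq (toC (projPerp k) *ᵥ z) ≤ nsq z := by
  rcases eq_or_ne k 0 with rfl | hk
  · have h : toC (projPerp 0) = 1 := by
      ext i j
      simp only [toC, projPerp, projPar, Matrix.vecMulVec_zero, smul_zero, sub_zero,
        Matrix.map_apply, Matrix.one_apply]
      split_ifs <;> simp
    rw [h, Matrix.one_mulVec]
  · have h := nsq_crossC_le k z
    rw [nsq_crossC_eq] at h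
    exact le_of_mul_le_mul_left h (dot_self_pos hk)

/-- The second order part of the equation for the angular velocity. -/
noncomputable def diffusionC (z : Fin 3 → ℂ) : Fin 3 → ℂ := fun j =>
  (P.alpha + 4 * P.beta / 3) * (k j * dotC k z) + (P.beta + P.gamma) * perpC k z j

lemma nsq_diffusionC (z : Fin 3 → ℂ) : nsq (diffusionC P k z) = (k ⬝ᵥ k) *
    ((P.alpha + 4 * P.beta / 3) ^ 2 * ‖dotC k z‖ ^ 2
      + (P.beta + P.gamma) ^ 2 * nsq (crossC k z)) := by
  have h : ∀ j, diffusionC P k z j = ((P.alpha + 4 * P.beta / 3 : ℝ) : ℂ) * (k j * dotC k z)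
      + ((P.beta + P.gamma : ℝ) : ℂ) * perpC k z j := by
    intro j
    simp [diffusionC]
  simp only [nsq, h]
  generalize P.alpha + 4 * P.beta / 3 = a
  generalize P.beta + P.gamma = b
  simp [Fin.sum_univ_three, perpC, crossC, dotC, Complex.sq_norm, Complex.normSq_apply]
  rw [dot_self]
  ring

lemma nsq_velocity_le (f : Idx → ℂ) : nsq (velocity f) ≤ nsq f := by
  rw [nsq_eq_add]
  linarith [nsq_nonneg (spin f), nsq_nonneg (tail f)]

lemma nsq_spin_le (f : Idx → ℂ) : nsq (spin f) ≤ nsq f := by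
  rw [nsq_eq_add f]
  linarith [nsq_nonneg (velocity f), nsq_nonneg (tail f)]

lemma nsq_tail_le (f : Idx → ℂ) : nsq (tail f) ≤ nsq f := by
  rw [nsq_eq_add f]
  linarith [nsq_nonneg (velocity f), nsq_nonneg (spin f)]

lemma nsq_rotate_le {n : Type} [Fintype n] (z : n → ℂ) (i j : n) (hij : i ≠ j) :
    nsq (![-z j, z i, 0] : Fin 3 → ℂ) ≤ nsq z := by
  classical
  have h := Finset.sum_le_sum_of_subset_of_nonneg (f := fun l => ‖z l‖ ^ 2)
    (Finset.subset_univ {i, j}) fun _ _ _ => sq_nonneg _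
  rw [Finset.sum_pair hij] at h
  simp only [nsq, Fin.sum_univ_three]
  simpa [add_comm] using h

lemma nsq_neg_one_smul {n : Type} [Fintype n] (v : n → ℂ) : nsq ((-1 : ℂ) • v) = nsq v := by
  rw [nsq_smul, norm_neg, norm_one, one_pow, one_mul]

lemma nsq_smul_add_le {n : Type} [Fintype n] (c : ℂ) (v w : n → ℂ) :
    nsq (c • v + w) ≤ 2 * (‖c‖ ^ 2 * nsq v) + 2 * nsq w := by
  rw [← nsq_smul]
  exact nsq_add_le _ _

/-- The zeroth order part of the equation for the angular velocity. -/
noncomputable def spinRotation (f : Idx → ℂ) : Fin 3 → ℂ :=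
  ((1 - P.nu / P.lam) * P.speed : ℂ) • ![-spin f 1, spin f 0, 0]
    + ((P.lam : ℂ)⁻¹ * P.speed ^ 2) • ![-tail f 1, tail f 0, 0]

lemma exists_nsq_spinRotation_le : ∃ C : ℝ, 0 ≤ C ∧ ∀ f, nsq (spinRotation P f) ≤ C * nsq f := by
  refine ⟨2 * ‖((1 - P.nu / P.lam) * P.speed : ℂ)‖ ^ 2
    + 2 * ‖((P.lam : ℂ)⁻¹ * P.speed ^ 2)‖ ^ 2, by positivity, fun f => ?_⟩
  refine (nsq_add_le _ _).trans ?_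
  rw [nsq_smul, nsq_smul]
  have h1 := (nsq_rotate_le (spin f) 0 1 (by decide)).trans (nsq_spin_le f)
  have h2 := (nsq_rotate_le (tail f) 0 1 (by decide)).trans (nsq_tail_le f)
  have h3 := mul_le_mul_of_nonneg_left h1 (sq_nonneg ‖((1 - P.nu / P.lam) * P.speed : ℂ)‖)
  have h4 := mul_le_mul_of_nonneg_left h2 (sq_nonneg ‖((P.lam : ℂ)⁻¹ * P.speed ^ 2)‖)
  linarith

lemma spin_symbolB_eq (f : Idx → ℂ) : spin (P.symbolB k *ᵥ f) =
    (fun j => ((![P.lam⁻¹, P.lam⁻¹, P.nu⁻¹] j : ℝ) : ℂ) *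
      ((Complex.I * P.kappa) • crossC k (velocity f) + ((-(2 * P.kappa) : ℂ) • spin f
        + (-1 : ℂ) • diffusionC P k (spin f))) j) + (-1 : ℂ) • spinRotation P f := by
  rw [spin_symbolB]
  funext j
  fin_cases j <;> simp [diffusionC, spinRotation]
  · ring
  · ring
  · exact Or.inl (by ring)

lemma diffusionC_eq (hnu : 0 < P.nu) (hlam : P.nu < P.lam) (f : Idx → ℂ) :
    diffusionC P k (spin f) = (Complex.I * P.kappa) • crossC k (velocity f)
      + ((-(2 * P.kappa) : ℂ) • spin f + (fun j => ((-![P.lam, P.lam, P.nu] j : ℝ) : ℂ) *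
        (spin (P.symbolB k *ᵥ f) + spinRotation P f) j)) := by
  have h1 : (P.lam : ℂ) ≠ 0 := by exact_mod_cast (hnu.trans hlam).ne'
  have h2 : (P.nu : ℂ) ≠ 0 := by exact_mod_cast hnu.ne'
  rw [spin_symbolB_eq]
  funext j
  fin_cases j <;> simp [h1, h2] <;> ring

/-- Solving the symbol equation for the second order part. -/
lemma exists_nsq_diffusionC_le (hnu : 0 < P.nu) (hlam : P.nu < P.lam) :
    ∃ C : ℝ, 0 < C ∧ ∀ (k : Fin 3 → ℝ) (f : Idx → ℂ), nsq (diffusionC P k (spin f))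
      ≤ C * (nsq (crossC k (velocity f)) + (nsq f + nsq (P.symbolB k *ᵥ f))) := by
  obtain ⟨D, hD, hr⟩ := exists_nsq_spinRotation_le P
  have hl := hnu.trans hlam
  refine ⟨1 + 2 * ‖Complex.I * P.kappa‖ ^ 2 + 4 * ‖(-(2 * P.kappa) : ℂ)‖ ^ 2
    + 4 * (P.lam ^ 2 * (2 + 2 * D)), by positivity, fun k f => ?_⟩
  have hX := nsq_nonneg (crossC k (velocity f))
  have hf := nsq_nonneg f
  have hg := nsq_nonneg (P.symbolB k *ᵥ f)
  set S := nsq (crossC k (velocity f)) + (nsq f + nsq (P.symbolB k *ᵥ f)) with hS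
  rw [diffusionC_eq P k hnu hlam]
  have h1 := nsq_smul_add_le (Complex.I * P.kappa) (crossC k (velocity f))
    ((-(2 * P.kappa) : ℂ) • spin f + (fun j => ((-![P.lam, P.lam, P.nu] j : ℝ) : ℂ) *
        (spin (P.symbolB k *ᵥ f) + spinRotation P f) j))
  have h2 := nsq_smul_add_le (-(2 * P.kappa) : ℂ) (spin f)
    (fun j => ((-![P.lam, P.lam, P.nu] j : ℝ) : ℂ) *
        (spin (P.symbolB k *ᵥ f) + spinRotation P f) j)
  have h3 : nsq (fun j => ((-![P.lam, P.lam, P.nu] j : ℝ) : ℂ) *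
        (spin (P.symbolB k *ᵥ f) + spinRotation P f) j) ≤ P.lam ^ 2 * ((2 + 2 * D) * S) := by
    refine (nsq_mul_le (b := P.lam) (fun j => ?_) _).trans ?_
    · rw [Complex.norm_real, norm_neg]
      fin_cases j <;> simp [abs_of_pos hl, abs_of_pos hnu, hlam.le]
    · have h4 := nsq_add_le (spin (P.symbolB k *ᵥ f)) (spinRotation P f)
      have h5 := nsq_spin_le (P.symbolB k *ᵥ f)
      have h6 := hr f
      have h7 : D * nsq f ≤ D * S := by
        gcongr
        linarith
      gcongr
      linarith
  have h8 : ‖Complex.I * P.kappa‖ ^ 2 * nsq (crossC k (velocity f))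
      ≤ ‖Complex.I * P.kappa‖ ^ 2 * S := by
    gcongr
    linarith
  have h9 : ‖(-(2 * P.kappa) : ℂ)‖ ^ 2 * nsq (spin f) ≤ ‖(-(2 * P.kappa) : ℂ)‖ ^ 2 * S := by
    have := nsq_spin_le f
    gcongr
    linarith
  linarith

/-- The opposite direction to `exists_nsq_diffusionC_le`, needed to show that the Sobolev conditions
suffice for the domain. -/
lemma exists_nsq_spin_symbolB_le (hnu : 0 < P.nu) (hlam : P.nu < P.lam) :
    ∃ C : ℝ, 0 < C ∧ ∀ (k : Fin 3 → ℝ) (f : Idx → ℂ), nsq (spin (P.symbolB k *ᵥ f))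
      ≤ C * (nsq (crossC k (velocity f)) + (nsq f + nsq (diffusionC P k (spin f)))) := by
  obtain ⟨D, hD, hr⟩ := exists_nsq_spinRotation_le P
  have hl := hnu.trans hlam
  refine ⟨1 + 2 * (P.nu⁻¹ ^ 2 * (2 * ‖Complex.I * P.kappa‖ ^ 2 + 4 * ‖(-(2 * P.kappa) : ℂ)‖ ^ 2
    + 4)) + 2 * D, by positivity, fun k f => ?_⟩
  have hX := nsq_nonneg (crossC k (velocity f))
  have hf := nsq_nonneg f
  have hg := nsq_nonneg (diffusionC P k (spin f))
  set S := nsq (crossC k (velocity f)) + (nsq f + nsq (diffusionC P k (spin f))) with hS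
  rw [spin_symbolB_eq]
  refine (nsq_add_le _ _).trans ?_
  have h1 := nsq_smul_add_le (Complex.I * P.kappa) (crossC k (velocity f))
    ((-(2 * P.kappa) : ℂ) • spin f + (-1 : ℂ) • diffusionC P k (spin f))
  have h2 := nsq_smul_add_le (-(2 * P.kappa) : ℂ) (spin f) ((-1 : ℂ) • diffusionC P k (spin f))
  rw [nsq_neg_one_smul] at h2
  rw [nsq_neg_one_smul]
  have h3 := nsq_mul_le (c := fun j => ((![P.lam⁻¹, P.lam⁻¹, P.nu⁻¹] j : ℝ) : ℂ)) (b := P.nu⁻¹)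
    (fun j => by
      rw [Complex.norm_real]
      fin_cases j <;> simp [abs_of_pos hl, abs_of_pos hnu, inv_anti₀ hnu hlam.le])
    ((Complex.I * P.kappa) • crossC k (velocity f)
      + ((-(2 * P.kappa) : ℂ) • spin f + (-1 : ℂ) • diffusionC P k (spin f)))
  have h8 : ‖Complex.I * P.kappa‖ ^ 2 * nsq (crossC k (velocity f))
      ≤ ‖Complex.I * P.kappa‖ ^ 2 * S := by
    gcongr
    linarith
  have h9 : ‖(-(2 * P.kappa) : ℂ)‖ ^ 2 * nsq (spin f) ≤ ‖(-(2 * P.kappa) : ℂ)‖ ^ 2 * S := by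
    have := nsq_spin_le f
    gcongr
    linarith
  have h10 : nsq ((Complex.I * P.kappa) • crossC k (velocity f)
      + ((-(2 * P.kappa) : ℂ) • spin f + (-1 : ℂ) • diffusionC P k (spin f)))
      ≤ (2 * ‖Complex.I * P.kappa‖ ^ 2 + 4 * ‖(-(2 * P.kappa) : ℂ)‖ ^ 2 + 4) * S := by
    linarith
  have h11 := mul_le_mul_of_nonneg_left h10 (sq_nonneg P.nu⁻¹)
  have h12 : D * nsq f ≤ D * S := by
    gcongr
    linarith
  have h13 := hr f
  linarith

/-- Absorption of the first order terms. -/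
lemma exists_absorption_bound {m₁ m₂ c₁ c₂ : ℝ} (hm₁ : 0 < m₁) (hm₂ : 0 < m₂) (hc₁ : 0 < c₁)
    (hc₂ : 0 < c₂) : ∃ C : ℝ, 0 ≤ C ∧ ∀ A V K N X : ℝ, 0 ≤ A → 0 ≤ V → 0 ≤ K → 0 ≤ N →
      m₁ * A ≤ c₁ * (K * V) + 2 * N → m₂ * (K ^ 2 * V) ≤ c₂ * (X + N) → X ^ 2 ≤ A * N →
      V ≤ N → K ^ 2 * V ≤ C * N ∧ A ≤ C * N := by
  -- In the application `A = |k|⁴|P_⊥ u|²`, `V = |ω|²`, `K = |k|²`, `X = |k × u|²`, and `N` is the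
  -- right-hand side of the estimate. With this `δ`, inserting the bound for `A` into `c₂ δ A`
  -- produces exactly `m₂ K V` at first order. As `K V ≤ (K² V + V) / 2`, half of `m₂ K² V` survives
  -- the absorption.
  set δ := m₁ * m₂ / (c₁ * c₂) with hδ
  have hδ0 : 0 < δ := by positivity
  set C₀ := 2 / m₂ * (2 * c₂ * δ / m₁ + c₂ / (4 * δ) + c₂ + m₂ / 2) with hC₀
  have hC₀0 : 0 ≤ C₀ := by positivity
  refine ⟨C₀ + (c₁ * (C₀ + 1) + 2) / m₁, by positivity, fun A V K N X hA hV hK hN h1 h2 h3 h4 => ?_⟩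
  have hX : X ≤ δ * A + N / (4 * δ) := by
    have h5 : X ^ 2 ≤ (δ * A + N / (4 * δ)) ^ 2 := by
      refine h3.trans ?_
      have : (δ * A + N / (4 * δ)) ^ 2 - A * N = (δ * A - N / (4 * δ)) ^ 2 := by
        field_simp
        ring
      linarith [sq_nonneg (δ * A - N / (4 * δ))]
    exact (le_abs_self X).trans (abs_le_of_sq_le_sq h5 (by positivity))
  have hKV : K * V ≤ (K ^ 2 * V + V) / 2 := by nlinarith [mul_nonneg hV (sq_nonneg (K - 1))]
  have hKV0 : 0 ≤ K ^ 2 * V := by positivity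
  have hA1 : A ≤ (c₁ * (K * V) + 2 * N) / m₁ := by
    rw [le_div_iff₀ hm₁]
    linarith
  have h6 : c₂ * (δ * A) ≤ m₂ * (K * V) + 2 * c₂ * δ / m₁ * N := by
    have := mul_le_mul_of_nonneg_left hA1 (by positivity : 0 ≤ c₂ * δ)
    have h7 : c₂ * δ * ((c₁ * (K * V) + 2 * N) / m₁) = m₂ * (K * V) + 2 * c₂ * δ / m₁ * N := by
      rw [hδ]
      field_simp
    linarith
  have h8 : m₂ / 2 * (K ^ 2 * V) ≤ (2 * c₂ * δ / m₁ + c₂ / (4 * δ) + c₂ + m₂ / 2) * N := by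
    have h9 := mul_le_mul_of_nonneg_left hX hc₂.le
    have h10 : c₂ * (N / (4 * δ)) = c₂ / (4 * δ) * N := by ring
    have h11 := mul_le_mul_of_nonneg_left hKV hm₂.le
    have h12 := mul_le_mul_of_nonneg_left h4 hm₂.le
    linarith
  have h13 : K ^ 2 * V ≤ C₀ * N := by
    have := mul_le_mul_of_nonneg_left h8 (by positivity : 0 ≤ 2 / m₂)
    have h14 : 2 / m₂ * (m₂ / 2 * (K ^ 2 * V)) = K ^ 2 * V := by
      field_simp
    rw [hC₀]
    linarith
  have h15 : A ≤ (c₁ * (C₀ + 1) + 2) / m₁ * N := by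
    refine hA1.trans ?_
    rw [div_mul_eq_mul_div]
    have h16 : K * V ≤ (C₀ + 1) * N := by nlinarith
    gcongr
    nlinarith
  have h17 : 0 ≤ (c₁ * (C₀ + 1) + 2) / m₁ * N := by positivity
  have h18 : 0 ≤ C₀ * N := by positivity
  constructor <;> linarith

lemma velocity_symbolB_eq (f : Idx → ℂ) : velocity (P.symbolB k *ᵥ f) =
    (-(P.mu + P.kappa / 2 : ℝ) : ℂ) • perpC k (velocity f)
      + (Complex.I * P.kappa) • crossC k (spin f) := by
  rw [velocity_symbolB]
  funext j
  simp

/-- The elliptic estimate: the symbol controls `H²` of the projected velocity and of the angular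
velocity. -/
lemma exists_elliptic_bound (hnu : 0 < P.nu) (hlam : P.nu < P.lam) (hmu : 0 < P.mu)
    (hkappa : 0 < P.kappa) (halpha : 0 < P.alpha + 4 * P.beta / 3)
    (hgamma : 0 < P.beta + P.gamma) :
    ∃ C : ℝ, ∀ (k : Fin 3 → ℝ) (f : Idx → ℂ),
      (1 + k ⬝ᵥ k) ^ 2 * nsq (toC (projPerp k) *ᵥ velocity f)
        ≤ C * (nsq f + nsq (P.symbolB k *ᵥ f)) ∧
      (1 + k ⬝ᵥ k) ^ 2 * nsq (spin f) ≤ C * (nsq f + nsq (P.symbolB k *ᵥ f)) := by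
  obtain ⟨c₂, hc₂, hdiff⟩ := exists_nsq_diffusionC_le P hnu hlam
  set m := min (P.alpha + 4 * P.beta / 3) (P.beta + P.gamma) with hm
  have hm0 : 0 < m := lt_min halpha hgamma
  have hμ : 0 < P.mu + P.kappa / 2 := by positivity
  obtain ⟨C, hC, hab⟩ := exists_absorption_bound (m₁ := (P.mu + P.kappa / 2) ^ 2) (m₂ := m ^ 2)
    (c₁ := 2 * P.kappa ^ 2) (by positivity) (by positivity) (by positivity) hc₂
  refine ⟨2 + 2 * C, fun k f => ?_⟩
  have hK := dot_self_nonneg k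
  set N := nsq f + nsq (P.symbolB k *ᵥ f) with hN
  have hg := nsq_nonneg (P.symbolB k *ᵥ f)
  have hf := nsq_nonneg f
  have hu := nsq_velocity_le f
  have hv := nsq_spin_le f
  -- The inequalities to check are the velocity row solved for the viscous term, the spin row solved
  -- for diffusion (bounded below through Lagrange's identity), and the interpolation `|k × u|⁴ ≤
  -- |k|²|k × u|²|u|²`.
  obtain ⟨h1, h2⟩ := hab (nsq (perpC k (velocity f))) (nsq (spin f)) (k ⬝ᵥ k) N
    (nsq (crossC k (velocity f))) (nsq_nonneg _) (nsq_nonneg _) hK (by positivity)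
    (by
      have e : ((P.mu + P.kappa / 2 : ℝ) : ℂ) • perpC k (velocity f)
          = (Complex.I * P.kappa) • crossC k (spin f) - velocity (P.symbolB k *ᵥ f) := by
        rw [velocity_symbolB_eq, neg_smul]
        abel
      have h := nsq_sub_le ((Complex.I * P.kappa) • crossC k (spin f))
        (velocity (P.symbolB k *ᵥ f))
      rw [← e, nsq_smul, nsq_smul, Complex.norm_real, norm_mul, Complex.norm_I, one_mul,
        Complex.norm_real, Real.norm_of_nonneg hμ.le, Real.norm_of_nonneg hkappa.le] at h
      have h3 := nsq_velocity_le (P.symbolB k *ᵥ f)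
      have h4 := mul_le_mul_of_nonneg_left (nsq_crossC_le k (spin f)) (sq_nonneg P.kappa)
      linarith)
    (by
      refine le_trans ?_ (hdiff k f)
      rw [nsq_diffusionC]
      have h5 : m ^ 2 * ‖dotC k (spin f)‖ ^ 2
          ≤ (P.alpha + 4 * P.beta / 3) ^ 2 * ‖dotC k (spin f)‖ ^ 2 := by
        gcongr
        exact min_le_left _ _
      have h6 : m ^ 2 * nsq (crossC k (spin f))
          ≤ (P.beta + P.gamma) ^ 2 * nsq (crossC k (spin f)) := by
        have := nsq_nonneg (crossC k (spin f))
        gcongr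
        exact min_le_right _ _
      have h7 := mul_le_mul_of_nonneg_left (add_le_add h5 h6) hK
      have h8 := dot_self_mul_nsq k (spin f)
      calc m ^ 2 * ((k ⬝ᵥ k) ^ 2 * nsq (spin f))
          = (k ⬝ᵥ k) * (m ^ 2 * ((k ⬝ᵥ k) * nsq (spin f))) := by ring
        _ = (k ⬝ᵥ k) * (m ^ 2 * ‖dotC k (spin f)‖ ^ 2
              + m ^ 2 * nsq (crossC k (spin f))) := by rw [h8]; ring
        _ ≤ _ := h7)
    (by
      have h9 := mul_le_mul_of_nonneg_left (nsq_crossC_le k (velocity f))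
        (nsq_nonneg (crossC k (velocity f)))
      rw [nsq_perpC]
      have h10 := nsq_nonneg (crossC k (velocity f))
      have h11 : nsq (crossC k (velocity f)) * ((k ⬝ᵥ k) * nsq (velocity f))
          ≤ nsq (crossC k (velocity f)) * ((k ⬝ᵥ k) * N) := by
        gcongr
        linarith
      linarith)
    (by linarith)
  have hsq : (1 + k ⬝ᵥ k) ^ 2 ≤ 2 + 2 * (k ⬝ᵥ k) ^ 2 := by nlinarith [sq_nonneg (1 - k ⬝ᵥ k)]
  constructor
  · rw [nsq_perpC_eq] at h2
    have h3 := nsq_projPerp_le k (velocity f)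
    have h4 := mul_le_mul_of_nonneg_right hsq (nsq_nonneg (toC (projPerp k) *ᵥ velocity f))
    linarith
  · have h4 := mul_le_mul_of_nonneg_right hsq (nsq_nonneg (spin f))
    linarith

lemma exists_nsq_tail_symbolB_le :
    ∃ C : ℝ, 0 ≤ C ∧ ∀ (k : Fin 3 → ℝ) (f : Idx → ℂ),
      nsq (tail (P.symbolB k *ᵥ f)) ≤ C * nsq f := by
  refine ⟨2 * ‖(P.lam - P.nu : ℂ)‖ ^ 2 + 2 * ‖(P.speed : ℂ)‖ ^ 2, by positivity, fun k f => ?_⟩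
  have h : tail (P.symbolB k *ᵥ f) = (P.lam - P.nu : ℂ) • ![-spin f 1, spin f 0]
      + (P.speed : ℂ) • ![-tail f 1, tail f 0] := by
    rw [tail_symbolB]
    funext j
    fin_cases j <;> simp
  have h1 : nsq ![-spin f 1, spin f 0] ≤ nsq f := by
    refine le_trans ?_ (nsq_spin_le f)
    simp [nsq, Fin.sum_univ_three]
    nlinarith [sq_nonneg ‖spin f 2‖]
  have h2 : nsq ![-tail f 1, tail f 0] ≤ nsq f := by
    refine le_trans ?_ (nsq_tail_le f)
    simp [nsq, add_comm]
  rw [h]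
  refine (nsq_add_le _ _).trans ?_
  rw [nsq_smul, nsq_smul]
  have h3 := mul_le_mul_of_nonneg_left h1 (sq_nonneg ‖(P.lam - P.nu : ℂ)‖)
  have h4 := mul_le_mul_of_nonneg_left h2 (sq_nonneg ‖(P.speed : ℂ)‖)
  linarith

/-- The symbol sees the velocity only through `P_⊥ u`, because `k × u = k × P_⊥ u`. Hence the domain
imposes nothing further on the gradient part of `u`. -/
lemma exists_nsq_symbolB_le (hnu : 0 < P.nu) (hlam : P.nu < P.lam) :
    ∃ C : ℝ, ∀ (k : Fin 3 → ℝ) (f : Idx → ℂ), nsq (P.symbolB k *ᵥ f)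
      ≤ C * ((1 + k ⬝ᵥ k) ^ 2 * nsq (toC (projPerp k) *ᵥ velocity f)
        + (1 + k ⬝ᵥ k) ^ 2 * nsq (spin f) + nsq f) := by
  obtain ⟨C₁, hC₁, h1⟩ := exists_nsq_spin_symbolB_le P hnu hlam
  obtain ⟨C₂, hC₂, h2⟩ := exists_nsq_tail_symbolB_le P
  set b := (P.alpha + 4 * P.beta / 3) ^ 2 + (P.beta + P.gamma) ^ 2 with hb
  have hb0 : 0 ≤ b := by positivity
  set c := ‖(-(P.mu + P.kappa / 2 : ℝ) : ℂ)‖ ^ 2 with hc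
  set c' := ‖Complex.I * P.kappa‖ ^ 2 with hc'
  refine ⟨2 * c + 2 * c' + C₁ * (2 + b) + C₂, fun k f => ?_⟩
  have hK := dot_self_nonneg k
  have hp := nsq_nonneg (toC (projPerp k) *ᵥ velocity f)
  have hv := nsq_nonneg (spin f)
  have hf := nsq_nonneg f
  have hK1 : (k ⬝ᵥ k) ^ 2 ≤ (1 + k ⬝ᵥ k) ^ 2 := by gcongr; linarith
  have hK2 : k ⬝ᵥ k ≤ (1 + k ⬝ᵥ k) ^ 2 := by nlinarith
  set T := (1 + k ⬝ᵥ k) ^ 2 * nsq (toC (projPerp k) *ᵥ velocity f)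
    + (1 + k ⬝ᵥ k) ^ 2 * nsq (spin f) + nsq f with hT
  have e1 : 0 ≤ (1 + k ⬝ᵥ k) ^ 2 * nsq (toC (projPerp k) *ᵥ velocity f) := by positivity
  have e2 : 0 ≤ (1 + k ⬝ᵥ k) ^ 2 * nsq (spin f) := by positivity
  have hu : nsq (velocity (P.symbolB k *ᵥ f)) ≤ 2 * (c * T) + 2 * (c' * T) := by
    rw [velocity_symbolB_eq]
    refine (nsq_add_le _ _).trans ?_
    rw [nsq_smul, nsq_smul, nsq_perpC_eq]
    have h3 : (k ⬝ᵥ k) ^ 2 * nsq (toC (projPerp k) *ᵥ velocity f) ≤ T := by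
      have := mul_le_mul_of_nonneg_right hK1 hp
      linarith
    have h4 : nsq (crossC k (spin f)) ≤ T := by
      have := mul_le_mul_of_nonneg_right hK2 hv
      linarith [nsq_crossC_le k (spin f)]
    have h5 := mul_le_mul_of_nonneg_left h3 (sq_nonneg ‖(-(P.mu + P.kappa / 2 : ℝ) : ℂ)‖)
    have h6 := mul_le_mul_of_nonneg_left h4 (sq_nonneg ‖Complex.I * P.kappa‖)
    linarith
  have hs : nsq (spin (P.symbolB k *ᵥ f)) ≤ C₁ * ((2 + b) * T) := by
    refine (h1 k f).trans ?_
    gcongr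
    have h3 : nsq (crossC k (velocity f)) + nsq f ≤ 2 * T := by
      have := mul_le_mul_of_nonneg_right hK2 hp
      rw [nsq_crossC_eq]
      linarith
    have h4 : nsq (diffusionC P k (spin f)) ≤ b * T := by
      have h5 := dot_self_mul_nsq k (spin f)
      have h6 := nsq_nonneg (crossC k (spin f))
      have h7 := sq_nonneg ‖dotC k (spin f)‖
      have h8 : (P.alpha + 4 * P.beta / 3) ^ 2 * ‖dotC k (spin f)‖ ^ 2
          + (P.beta + P.gamma) ^ 2 * nsq (crossC k (spin f)) ≤ b * ((k ⬝ᵥ k) * nsq (spin f)) := by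
        rw [h5, hb]
        have := mul_nonneg (sq_nonneg (P.alpha + 4 * P.beta / 3)) h6
        have := mul_nonneg (sq_nonneg (P.beta + P.gamma)) h7
        linarith
      have h9 : (k ⬝ᵥ k) ^ 2 * nsq (spin f) ≤ T := by
        have := mul_le_mul_of_nonneg_right hK1 hv
        linarith
      rw [nsq_diffusionC]
      calc _ ≤ (k ⬝ᵥ k) * (b * ((k ⬝ᵥ k) * nsq (spin f))) := mul_le_mul_of_nonneg_left h8 hK
        _ = b * ((k ⬝ᵥ k) ^ 2 * nsq (spin f)) := by ring
        _ ≤ b * T := mul_le_mul_of_nonneg_left h9 hb0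
    linarith
  have ht : nsq (tail (P.symbolB k *ᵥ f)) ≤ C₂ * T := by
    refine (h2 k f).trans ?_
    gcongr
    linarith
  rw [nsq_eq_add]
  linarith

end Elliptic

end Micropolar

namespace Micropolar

open MeasureTheory Filter

/-! ### Incompressibility in Fourier space -/

section Smooth

/-- Continuity on the torus can be tested on periodic lifts to `ℝ³`, where smoothness is defined. -/
lemma isOpenQuotientMap_torus : IsOpenQuotientMap
    fun (y : Fin 3 → ℝ) (i : Fin 3) => (y i : AddCircle (2 * Real.pi)) :=
  IsOpenQuotientMap.piMap fun _ => QuotientAddGroup.isOpenQuotientMap_mk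

lemma torus_add_single (y : Fin 3 → ℝ) (j : Fin 3) (h : ℝ) :
    (fun i => ((y + h • (Pi.single j (1 : ℝ) : Fin 3 → ℝ)) i : AddCircle (2 * Real.pi)))
      = (fun i => (y i : AddCircle (2 * Real.pi))) + Pi.single j (h : AddCircle (2 * Real.pi)) := by
  funext i
  rcases eq_or_ne i j with rfl | hij
  · simp
  · simp [hij]

variable {φ : Torus → ℝ}

lemma IsSmooth.continuous (hφ : IsSmooth φ) : Continuous φ :=
  isOpenQuotientMap_torus.isQuotientMap.continuous_iff.mpr (ContDiff.continuous hφ)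

lemma IsSmooth.hasDerivAt (hφ : IsSmooth φ) (y : Fin 3 → ℝ) (j : Fin 3) (h : ℝ) :
    HasDerivAt (fun h : ℝ => φ ((fun i => (y i : AddCircle (2 * Real.pi)))
        + Pi.single j (h : AddCircle (2 * Real.pi))))
      (fderiv ℝ (fun y : Fin 3 → ℝ => φ fun i => (y i : AddCircle (2 * Real.pi)))
        (y + h • (Pi.single j (1 : ℝ) : Fin 3 → ℝ)) (Pi.single j 1)) h := by
  simp only [← torus_add_single]
  have h1 : DifferentiableAt ℝ (fun y : Fin 3 → ℝ => φ fun i => (y i : AddCircle (2 * Real.pi)))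
      (y + h • (Pi.single j (1 : ℝ) : Fin 3 → ℝ)) :=
    (ContDiff.differentiable hφ (by simp)).differentiableAt
  have h2 : HasDerivAt (fun h : ℝ => y + h • (Pi.single j (1 : ℝ) : Fin 3 → ℝ))
      (Pi.single j (1 : ℝ)) h := by
    simpa using ((hasDerivAt_id h).smul_const (Pi.single j (1 : ℝ) : Fin 3 → ℝ)).const_add y
  exact h1.hasFDerivAt.comp_hasDerivAt h h2

lemma IsSmooth.partialD_eq (hφ : IsSmooth φ) (y : Fin 3 → ℝ) (j : Fin 3) :
    partialD j φ (fun i => (y i : AddCircle (2 * Real.pi)))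
      = fderiv ℝ (fun y : Fin 3 → ℝ => φ fun i => (y i : AddCircle (2 * Real.pi))) y
        (Pi.single j 1) := by
  have h := (hφ.hasDerivAt y j 0).deriv
  rwa [zero_smul, add_zero] at h

lemma IsSmooth.continuous_partialD (hφ : IsSmooth φ) (j : Fin 3) : Continuous (partialD j φ) := by
  rw [isOpenQuotientMap_torus.isQuotientMap.continuous_iff]
  have h : (partialD j φ ∘ fun (y : Fin 3 → ℝ) i => (y i : AddCircle (2 * Real.pi)))
      = fun y => fderiv ℝ (fun y : Fin 3 → ℝ => φ fun i => (y i : AddCircle (2 * Real.pi))) y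
        (Pi.single j 1) := funext fun y => hφ.partialD_eq y j
  rw [h]
  exact (ContDiff.continuous_fderiv hφ (by simp)).clm_apply continuous_const

lemma IsSmooth.hasDerivAt_partialD (hφ : IsSmooth φ) (x : Torus) (j : Fin 3) (h : ℝ) :
    HasDerivAt (fun h : ℝ => φ (x + Pi.single j (h : AddCircle (2 * Real.pi))))
      (partialD j φ (x + Pi.single j (h : AddCircle (2 * Real.pi)))) h := by
  obtain ⟨y, rfl⟩ := isOpenQuotientMap_torus.surjective x
  have h1 := hφ.hasDerivAt y j h
  rw [← hφ.partialD_eq, torus_add_single] at h1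
  exact h1

lemma hasDerivAt_character (k : Fin 3 → ℤ) (x : Torus) (j : Fin 3) (h : ℝ) :
    HasDerivAt (fun h : ℝ => character k (x + Pi.single j (h : AddCircle (2 * Real.pi))))
      (Complex.I * k j * character k (x + Pi.single j (h : AddCircle (2 * Real.pi)))) h := by
  simp only [character_apply_add, character_pi_single]
  refine ((hasDerivAt_fourier (2 * Real.pi) (k j) h).const_mul (character k x)).congr_deriv ?_
  have : (Real.pi : ℂ) ≠ 0 := by exact_mod_cast Real.pi_ne_zero
  push_cast
  field_simp

lemma contDiff_character (k : Fin 3 → ℤ) : ContDiff ℝ ∞ fun y : Fin 3 → ℝ =>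
    character k fun i => (y i : AddCircle (2 * Real.pi)) := by
  simp only [character, fourier_coe_apply]
  have : ∀ i : Fin 3, ContDiff ℝ ∞ fun y : Fin 3 → ℝ => ((y i : ℝ) : ℂ) := fun i =>
    Complex.ofRealCLM.contDiff.comp (contDiff_apply ℝ ℝ i)
  refine contDiff_prod fun i _ => ?_
  exact ((contDiff_const.mul (this i)).div_const _).cexp

end Smooth

/-! ### Vanishing divergence and transversal Fourier coefficients -/

section Incompressible

/-- Differentiation under the integral sign. -/
lemma hasDerivAt_integral_of_continuous {α : Type*} [TopologicalSpace α] [CompactSpace α]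
    [SecondCountableTopology α] [MeasurableSpace α] [BorelSpace α] (m : Measure α)
    [IsFiniteMeasure m]
    {F F' : ℝ → α → ℂ} (hF : ∀ h, Continuous (F h)) (hF' : Continuous (F' 0)) {K : ℝ}
    (hbound : ∀ x h, ‖F' h x‖ ≤ K) (hdiff : ∀ x h, HasDerivAt (fun h => F h x) (F' h x) h) :
    HasDerivAt (fun h : ℝ => ∫ x, F h x ∂m) (∫ x, F' 0 x ∂m) 0 :=
  (hasDerivAt_integral_of_dominated_loc_of_deriv_le (bound := fun _ => K) (s := Set.univ)
    Filter.univ_mem (Eventually.of_forall fun h => (hF h).aestronglyMeasurable)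
    ((hF 0).integrable_of_hasCompactSupport (HasCompactSupport.of_compactSpace _))
    hF'.aestronglyMeasurable (Eventually.of_forall fun x h _ => hbound x h)
    (integrable_const _) (Eventually.of_forall fun x h _ => hdiff x h)).2

lemma IsSmooth.hasDerivAt_integral {φ : Torus → ℝ} (hφ : IsSmooth φ) (c : C(Torus, ℂ))
    (j : Fin 3) : HasDerivAt (fun h : ℝ => ∫ x : Torus, c x *
        (φ (x + Pi.single j (h : AddCircle (2 * Real.pi))) : ℂ))
      (∫ x : Torus, c x * (partialD j φ (x + Pi.single j ((0 : ℝ) : AddCircle (2 * Real.pi))) : ℂ))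
      0 := by
  obtain ⟨N, hN⟩ := isCompact_univ.exists_bound_of_continuousOn
    (hφ.continuous_partialD j).continuousOn
  obtain ⟨L, hL⟩ := isCompact_univ.exists_bound_of_continuousOn c.continuous.continuousOn
  have hL0 : 0 ≤ L := (norm_nonneg _).trans (hL 0 (Set.mem_univ _))
  have hadd : ∀ h : ℝ, Continuous fun x : Torus =>
      x + Pi.single j (h : AddCircle (2 * Real.pi)) := fun h => continuous_id.add continuous_const
  have hF : ∀ h : ℝ, Continuous fun x : Torus =>
      c x * (φ (x + Pi.single j (h : AddCircle (2 * Real.pi))) : ℂ) := fun h =>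
    c.continuous.mul (Complex.continuous_ofReal.comp (hφ.continuous.comp (hadd h)))
  have hF' : Continuous fun x : Torus =>
      c x * (partialD j φ (x + Pi.single j ((0 : ℝ) : AddCircle (2 * Real.pi))) : ℂ) :=
    c.continuous.mul (Complex.continuous_ofReal.comp ((hφ.continuous_partialD j).comp (hadd 0)))
  have hbound : ∀ (x : Torus) (h : ℝ), ‖c x *
      (partialD j φ (x + Pi.single j (h : AddCircle (2 * Real.pi))) : ℂ)‖ ≤ L * N := by
    intro x h
    rw [norm_mul, Complex.norm_real]
    exact mul_le_mul (hL x (Set.mem_univ _)) (hN _ (Set.mem_univ _)) (norm_nonneg _) hL0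
  have hdiff : ∀ (x : Torus) (h : ℝ), HasDerivAt (fun h : ℝ => c x *
        (φ (x + Pi.single j (h : AddCircle (2 * Real.pi))) : ℂ))
      (c x * (partialD j φ (x + Pi.single j (h : AddCircle (2 * Real.pi))) : ℂ)) h := fun x h =>
    ((hφ.hasDerivAt_partialD x j h).ofReal_comp).const_mul _
  exact hasDerivAt_integral_of_continuous (volume : Measure Torus) hF hF' hbound hdiff

/-- The Fourier coefficients of a derivative. -/
lemma IsSmooth.integral_character_partialD {φ : Torus → ℝ} (hφ : IsSmooth φ) (k : Fin 3 → ℤ)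
    (j : Fin 3) : ∫ x : Torus, character (-k) x * (partialD j φ x : ℂ)
      = Complex.I * k j * ∫ x : Torus, character (-k) x * (φ x : ℂ) := by
  -- Integration by parts in the guise of translation invariance: translating `φ` multiplies its
  -- coefficient by a character, and both expressions are differentiated at `h = 0`.
  have h1 : HasDerivAt (fun h : ℝ => ∫ x : Torus, character (-k) x *
        (φ (x + Pi.single j (h : AddCircle (2 * Real.pi))) : ℂ))
      (∫ x : Torus, character (-k) x *
        (partialD j φ (x + Pi.single j ((0 : ℝ) : AddCircle (2 * Real.pi))) : ℂ)) 0 :=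
    hφ.hasDerivAt_integral (characterC (-k)) j
  have h2 : ∀ h : ℝ, ∫ x : Torus, character (-k) x *
        (φ (x + Pi.single j (h : AddCircle (2 * Real.pi))) : ℂ)
      = character k (0 + Pi.single j (h : AddCircle (2 * Real.pi)))
        * ∫ x : Torus, character (-k) x * (φ x : ℂ) := by
    intro h
    rw [← integral_const_mul, zero_add, ← integral_add_right_eq_self
      (fun x => character k (Pi.single j (h : AddCircle (2 * Real.pi))) *
        (character (-k) x * (φ x : ℂ))) (Pi.single j (h : AddCircle (2 * Real.pi)))]
    refine integral_congr_ae (Eventually.of_forall fun x => ?_)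
    simp only
    have h3 : character k (Pi.single j (h : AddCircle (2 * Real.pi)))
        * character (-k) (Pi.single j (h : AddCircle (2 * Real.pi))) = 1 := by
      rw [← character_add, add_neg_cancel, character_zero]
    rw [character_apply_add]
    linear_combination (-(character (-k) x) *
      (φ (x + Pi.single j (h : AddCircle (2 * Real.pi))) : ℂ)) * h3
  simp only [h2] at h1
  have h4 := h1.unique ((hasDerivAt_character k 0 j 0).mul_const _)
  simpa [character_zero, character] using h4

/-- The polarized Parseval identity; `ψ` is real, so its conjugate in the inner product is
invisible. -/
lemma summable_coeff_mul (g : Lp ℂ 2 (volume : Measure Torus)) (ψ : Torus → ℝ)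
    (hψ : Continuous ψ) : HasSum (fun k => (starRingEnd ℂ)
      ((fourierConst : ℂ) * ∫ x : Torus, character (-k) x * (ψ x : ℂ)) * characterBasis.repr g k)
      (∫ x : Torus, (ψ x : ℂ) * g x) := by
  set ψC : C(Torus, ℂ) := ⟨fun x => (ψ x : ℂ), Complex.continuous_ofReal.comp hψ⟩
  set ψL : Lp ℂ 2 (volume : Measure Torus) := ContinuousMap.toLp (E := ℂ) 2 volume ℂ ψC
  have hae : ψL =ᵐ[volume] fun x => (ψ x : ℂ) :=
    ContinuousMap.coeFn_toLp (p := 2) (𝕜 := ℂ) volume ψC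
  have h := characterBasis.hasSum_inner_mul_inner ψL g
  have h1 : inner ℂ ψL g = ∫ x : Torus, (ψ x : ℂ) * g x := by
    rw [MeasureTheory.L2.inner_def]
    apply integral_congr_ae
    filter_upwards [hae] with x hx
    rw [hx, RCLike.inner_apply, Complex.conj_ofReal, mul_comm]
  have h2 : ∀ k, (fourierConst : ℂ) * ∫ x : Torus, character (-k) x * (ψ x : ℂ)
      = characterBasis.repr ψL k := by
    intro k
    rw [characterBasis_repr]
    congr 1
    apply integral_congr_ae
    filter_upwards [hae] with x hx
    rw [hx]
  rw [← h1]
  refine h.congr_fun fun k => ?_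
  rw [h2, HilbertBasis.repr_apply_apply, HilbertBasis.repr_apply_apply, inner_conj_symm]

/-- A velocity field is incompressible if and only if its Fourier coefficients are transversal. -/
lemma incompressible_iff (X : State) : Incompressible X.u
    ↔ ∀ k, dotC (wave k) (velocity (coeff X.1 k)) = 0 := by
  have hint : ∀ (j : Fin 3) (ψ : Torus → ℝ), Continuous ψ →
      Integrable fun x : Torus => X.u x j * ψ x := by
    intro j ψ hψ
    exact ((memLp_component X.1 (Sum.inl j)).integrable (by norm_num)).mul_of_top_left
      (hψ.memLp_top_of_hasCompactSupport (HasCompactSupport.of_compactSpace ψ) _)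
  have hcast : ∀ (j : Fin 3) (ψ : Torus → ℝ), ((∫ x : Torus, X.u x j * ψ x : ℝ) : ℂ)
      = ∫ x : Torus, (ψ x : ℂ) * complexComponent (Sum.inl j) X.1 x := by
    intro j ψ
    rw [← integral_complex_ofReal]
    apply integral_congr_ae
    filter_upwards [coeFn_complexComponent (Sum.inl j) X.1] with x hx
    rw [hx, mul_comm]
    push_cast
    rfl
  have hsum : ∀ φ : Torus → ℝ, IsSmooth φ → ((∫ x : Torus, ∑ j, X.u x j * partialD j φ x : ℝ) : ℂ)
      = ∑ j, ∫ x : Torus, (partialD j φ x : ℂ) * complexComponent (Sum.inl j) X.1 x := by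
    intro φ hφ
    rw [integral_finsetSum _ fun j _ => hint j _ (hφ.continuous_partialD j)]
    push_cast
    exact Finset.sum_congr rfl fun j _ => hcast j _
  have hintC : ∀ (j : Fin 3) (ψ : Torus → ℝ), Continuous ψ →
      Integrable fun x : Torus => (ψ x : ℂ) * complexComponent (Sum.inl j) X.1 x := by
    intro j ψ hψ
    refine (hint j ψ hψ).ofReal.congr ?_
    filter_upwards [coeFn_complexComponent (Sum.inl j) X.1] with x hx
    rw [hx, mul_comm]
    push_cast
    rfl
  constructor
  · intro hX k
    -- Test functions are real, so the real and imaginary parts of the character are used separately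
    -- and then recombined.
    set χ : Torus → ℂ := character (-k) with hχ
    have hre : IsSmooth fun x => (χ x).re := Complex.reCLM.contDiff.comp (contDiff_character (-k))
    have him : IsSmooth fun x => (χ x).im := Complex.imCLM.contDiff.comp (contDiff_character (-k))
    have hd : ∀ (j : Fin 3) (x : Torus), HasDerivAt
        (fun h : ℝ => χ (x + Pi.single j (h : AddCircle (2 * Real.pi))))
        (-(Complex.I * k j) * χ x) 0 := by
      intro j x
      have h := hasDerivAt_character (-k) x j 0
      simpa using h
    have hpre : ∀ (j : Fin 3) (x : Torus), partialD j (fun x => (χ x).re) x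
        = (-(Complex.I * k j) * χ x).re := fun j x =>
      (Complex.reCLM.hasFDerivAt.comp_hasDerivAt (0 : ℝ) (hd j x)).deriv
    have hpim : ∀ (j : Fin 3) (x : Torus), partialD j (fun x => (χ x).im) x
        = (-(Complex.I * k j) * χ x).im := fun j x =>
      (Complex.imCLM.hasFDerivAt.comp_hasDerivAt (0 : ℝ) (hd j x)).deriv
    have h1 := hsum _ hre
    have h2 := hsum _ him
    rw [hX _ hre] at h1
    rw [hX _ him] at h2
    have h3 : ∀ j : Fin 3,
        (∫ x : Torus, (partialD j (fun x => (χ x).re) x : ℂ) * complexComponent (Sum.inl j) X.1 x)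
          + Complex.I * ∫ x : Torus, (partialD j (fun x => (χ x).im) x : ℂ)
            * complexComponent (Sum.inl j) X.1 x
        = -(Complex.I * k j) * ∫ x : Torus, χ x * complexComponent (Sum.inl j) X.1 x := by
      intro j
      rw [← integral_const_mul, ← integral_const_mul, ← integral_add
        (hintC j _ (hre.continuous_partialD j))
        ((hintC j _ (him.continuous_partialD j)).const_mul _)]
      refine integral_congr_ae (Eventually.of_forall fun x => ?_)
      simp only [hpre, hpim]
      linear_combination (complexComponent (Sum.inl j) X.1 x)
        * Complex.re_add_im (-(Complex.I * k j) * χ x)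
    have h4 : ∑ j : Fin 3, -(Complex.I * k j) *
        ∫ x : Torus, χ x * complexComponent (Sum.inl j) X.1 x = 0 := by
      rw [← Finset.sum_congr rfl fun j _ => h3 j, Finset.sum_add_distrib, ← Finset.mul_sum,
        ← h1, ← h2]
      simp
    simp only [dotC, velocity, wave, Complex.ofReal_intCast, Fin.sum_univ_three, coeff_eq_repr,
      characterBasis_repr] at h4 ⊢
    refine (mul_eq_zero.mp ?_).resolve_left Complex.I_ne_zero
    linear_combination -(fourierConst : ℂ) * h4
  -- By Parseval the pairing with `∇φ` is a sum over modes of a multiple of `conj (φ̂(k)) (k ·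
  -- û(k))`, and each term vanishes.
  · intro hk φ hφ
    have h1 : HasSum (fun k => ∑ j, (starRingEnd ℂ)
        ((fourierConst : ℂ) * ∫ x : Torus, character (-k) x * (partialD j φ x : ℂ))
          * characterBasis.repr (complexComponent (Sum.inl j) X.1) k)
        ((∫ x : Torus, ∑ j, X.u x j * partialD j φ x : ℝ) : ℂ) := by
      rw [hsum φ hφ]
      exact hasSum_sum fun j _ => summable_coeff_mul _ _ (hφ.continuous_partialD j)
    have h2 : ∀ k, ∑ j, (starRingEnd ℂ)
        ((fourierConst : ℂ) * ∫ x : Torus, character (-k) x * (partialD j φ x : ℂ))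
          * characterBasis.repr (complexComponent (Sum.inl j) X.1) k = 0 := by
      intro k
      have h3 := hk k
      simp only [hφ.integral_character_partialD, ← coeff_eq_repr, Fin.sum_univ_three, map_mul,
        Complex.conj_I, Complex.conj_ofReal, map_intCast]
      simp only [dotC, velocity, wave, Complex.ofReal_intCast] at h3
      linear_combination -(fourierConst : ℂ) * Complex.I * (starRingEnd ℂ)
        (∫ x : Torus, character (-k) x * (φ x : ℂ)) * h3
    simp only [h2] at h1
    exact_mod_cast h1.unique hasSum_zero

end Incompressible

end Micropolar

namespace Micropolar

open MeasureTheory Filter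

/-! ### Sobolev norms -/

section Sobolev

variable {n : Type} [Fintype n]

lemma one_add_dot_self_pos (k : Fin 3 → ℝ) : 0 < 1 + k ⬝ᵥ k := by
  linarith [dot_self_nonneg k]

lemma hatNormSq_two_lt_top_iff (c : (Fin 3 → ℤ) → n → ℂ) : hatNormSq 2 c < ⊤
    ↔ Summable fun k => (1 + wave k ⬝ᵥ wave k) ^ 2 * nsq (c k) := by
  have h : hatNormSq 2 c
      = ∑' k, ENNReal.ofReal ((1 + wave k ⬝ᵥ wave k) ^ 2 * nsq (c k)) := by
    simp only [hatNormSq, Real.rpow_two, nsq]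
  have hnn : ∀ k, 0 ≤ (1 + wave k ⬝ᵥ wave k) ^ 2 * nsq (c k) := fun k =>
    mul_nonneg (sq_nonneg _) (nsq_nonneg _)
  rw [h, lt_top_iff_ne_top]
  refine ⟨fun h => ?_, Summable.tsum_ofReal_ne_top⟩
  simpa only [ENNReal.toReal_ofReal (hnn _)] using ENNReal.summable_toReal h

lemma hatNormSq_le {c c' : (Fin 3 → ℤ) → n → ℂ} (s : ℝ) {D : ℝ} (hD : 0 ≤ D)
    (h : ∀ k, nsq (c' k) ≤ D * nsq (c k)) :
    hatNormSq s c' ≤ ENNReal.ofReal D * hatNormSq s c := by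
  unfold hatNormSq
  rw [← ENNReal.tsum_mul_left]
  refine ENNReal.tsum_le_tsum fun k => ?_
  rw [← ENNReal.ofReal_mul hD]
  refine ENNReal.ofReal_le_ofReal ?_
  have h1 : 0 ≤ (1 + wave k ⬝ᵥ wave k) ^ s := Real.rpow_nonneg (one_add_dot_self_pos _).le s
  calc (1 + wave k ⬝ᵥ wave k) ^ s * nsq (c' k)
      ≤ (1 + wave k ⬝ᵥ wave k) ^ s * (D * nsq (c k)) := mul_le_mul_of_nonneg_left (h k) h1
    _ = D * ((1 + wave k ⬝ᵥ wave k) ^ s * nsq (c k)) := by ring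

end Sobolev

/-! ### Rotations -/

section Rotation

/-- A skew generator makes the derivative of the squared norm vanish. -/
lemma norm_exp_smul_apply {E : Type*} [NormedAddCommGroup E] [InnerProductSpace ℝ E]
    [CompleteSpace E] (A : E →L[ℝ] E) (hA : ∀ x, inner ℝ x (A x) = 0) (t : ℝ) (x : E) :
    ‖NormedSpace.exp (t • A) x‖ = ‖x‖ := by
  have hd : ∀ s : ℝ, HasDerivAt (fun s : ℝ => ‖NormedSpace.exp (s • A) x‖ ^ 2) 0 s := by
    intro s
    have h1 := (hasDerivAt_exp_smul_const' A s).clm_apply (hasDerivAt_const s x)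
    rw [map_zero, add_zero] at h1
    have h2 := h1.norm_sq
    refine h2.congr_deriv ?_
    change 2 * inner ℝ _ (A (NormedSpace.exp (s • A) x)) = 0
    rw [hA, mul_zero]
  have h := is_const_of_deriv_eq_zero (fun s => (hd s).differentiableAt) (fun s => (hd s).deriv) t 0
  simp only [zero_smul, NormedSpace.exp_zero, one_apply_eq_self] at h
  exact (sq_eq_sq₀ (norm_nonneg _) (norm_nonneg _)).mp h

/-- Both `tr (Jᵀ R J)` and `tr (Jᵀ J R)` vanish, since each is the trace of a skew matrix against a
symmetric one. -/
lemma inner_bracket_self (P : Params) (J : EuclideanSpace ℝ (Fin 2 × Fin 2)) :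
    inner ℝ J (P.bracket J) = 0 := by
  simp [Params.bracket, commutator, PiLp.inner_apply, Fintype.sum_prod_type, Fin.sum_univ_two, R22]
  ring

lemma norm_exp_bracket (P : Params) (t : ℝ) (J : EuclideanSpace ℝ (Fin 2 × Fin 2)) :
    ‖NormedSpace.exp (t • P.bracket) J‖ = ‖J‖ :=
  norm_exp_smul_apply P.bracket (inner_bracket_self P) t J

lemma norm_exp_bracket_compLp_le (P : Params) (t : ℝ) (f : L2 (Fin 2 × Fin 2)) :
    ‖(NormedSpace.exp (t • P.bracket)).compLp f‖ ≤ ‖f‖ := by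
  refine (ContinuousLinearMap.norm_compLp_le _ f).trans ?_
  refine mul_le_of_le_one_left (norm_nonneg _) ?_
  exact ContinuousLinearMap.opNorm_le_bound _ zero_le_one fun J => by
    rw [norm_exp_bracket, one_mul]

end Rotation

/-! ### The Leray projection and the divergence -/

section Divergence

variable (P : Params) (k : Fin 3 → ℝ)

lemma toC_projPerp_mulVec_of_dotC_eq_zero {z : Fin 3 → ℂ} (h : dotC k z = 0) :
    toC (projPerp k) *ᵥ z = z := by
  rcases eq_or_ne k 0 with rfl | hk
  · have h : toC (projPerp 0) = 1 := by
      ext i j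
      simp only [toC, projPerp, projPar, Matrix.vecMulVec_zero, smul_zero, sub_zero,
        Matrix.map_apply, Matrix.one_apply]
      split_ifs <;> simp
    rw [h, Matrix.one_mulVec]
  · have hk' : ((k ⬝ᵥ k : ℝ) : ℂ) ≠ 0 := by exact_mod_cast (dot_self_pos hk).ne'
    refine smul_right_injective _ hk' ?_
    change ((k ⬝ᵥ k : ℝ) : ℂ) • _ = ((k ⬝ᵥ k : ℝ) : ℂ) • z
    rw [toC_projPerp_mulVec]
    funext j
    simp [perpC, h]

/-- The derivative is `k` paired with the velocity row of the symbol, which is zero. -/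
lemma dotC_velocity_exp_symbolB (v : Idx → ℂ) (t : ℝ) :
    dotC k (velocity (NormedSpace.exp ((t : ℂ) • P.symbolB k) *ᵥ v)) = dotC k (velocity v) := by
  have hd : ∀ s : ℝ, HasDerivAt
      (fun s : ℝ => dotC k (velocity (NormedSpace.exp ((s : ℂ) • P.symbolB k) *ᵥ v))) 0 s := by
    intro s
    have h1 := hasDerivAt_pi.mp (hasDerivAt_exp_mulVec (P.symbolB k) v s)
    have h2 := (((h1 (Sum.inl 0)).const_mul (k 0 : ℂ)).add
      ((h1 (Sum.inl 1)).const_mul (k 1 : ℂ))).add ((h1 (Sum.inl 2)).const_mul (k 2 : ℂ))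
    refine h2.congr_deriv ?_
    rw [exp_mulVec_mulVec_comm]
    exact dotC_velocity_symbolB P k _
  have h := is_const_of_deriv_eq_zero (fun s => (hd s).differentiableAt) (fun s => (hd s).deriv) t 0
  simp only [exp_zero_smul_mulVec] at h
  exact h

end Divergence

/-! ### The semigroup -/

section Flow

lemma wave_neg (k : Fin 3 → ℤ) : wave (-k) = -wave k := by
  funext j
  simp [wave]

variable (P : Params)

/-- The semigroup generated by the linearized operator, in terms of its first component. -/
noncomputable def flow (S : ℝ≥0 → L2 Idx →L[ℝ] L2 Idx) (t : ℝ≥0) : State →L[ℝ] State :=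
  (S t).prodMap ((pointwiseSemigroup P.bracket t).prodMap (ContinuousLinearMap.id ℝ _))

variable {P} {S : ℝ≥0 → L2 Idx →L[ℝ] L2 Idx}

lemma isFlow_iff (hS : ∀ (t : ℝ≥0) f k, coeff (S t f) k
      = NormedSpace.exp (((t : ℝ) : ℂ) • P.symbolB (wave k)) *ᵥ coeff f k)
    (t : ℝ≥0) (X X' : State) : P.IsFlow t X X' ↔ X' = flow P S t X := by
  have h1 : (∀ k : Fin 3 → ℤ, fourierHat X'.y k
      = NormedSpace.exp (((t : ℝ) : ℂ) • P.symbolB (wave k)) *ᵥ fourierHat X.y k)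
      ↔ X'.1 = S t X.1 := by
    rw [← coeff_injective.eq_iff, funext_iff]
    simp only [hS]
    rfl
  rw [Params.IsFlow, h1, Prod.ext_iff, Prod.ext_iff]
  rfl

lemma isC0Semigroup_flow (hS : IsC0Semigroup S) : IsC0Semigroup (flow P S) :=
  hS.prodMap ((isC0Semigroup_pointwiseSemigroup P.bracket).prodMap isC0Semigroup_id)

lemma generatorMaps_flow_iff
    (hS : ∀ f g, GeneratorMaps S f g ↔ ∀ k, coeff g k = P.symbolB (wave k) *ᵥ coeff f k)
    (X X' : State) : GeneratorMaps (flow P S) X X' ↔ P.IsLin X X' := by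
  have h1 : GeneratorMaps (flow P S) X X' ↔ GeneratorMaps S X.1 X'.1 ∧
      GeneratorMaps (pointwiseSemigroup P.bracket) X.2.1 X'.2.1 ∧
      GeneratorMaps (fun _ : ℝ≥0 => ContinuousLinearMap.id ℝ (Lp ℝ 2 (volume : Measure Torus)))
        X.2.2 X'.2.2 := by
    rw [← generatorMaps_prodMap X.2 X'.2, ← generatorMaps_prodMap X X']
    rfl
  rw [h1, hS, generatorMaps_pointwiseSemigroup, generatorMaps_id]
  rfl

end Flow

/-! ### The domain of the generator -/

section Domain

variable {P : Params}

lemma inLerayDomain_iff (X : State) : X.InLerayDomain ↔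
    Summable (fun k => (1 + wave k ⬝ᵥ wave k) ^ 2
      * nsq (toC (projPerp (wave k)) *ᵥ velocity (coeff X.1 k))) ∧
    Summable (fun k => (1 + wave k ⬝ᵥ wave k) ^ 2 * nsq (spin (coeff X.1 k))) :=
  and_congr (hatNormSq_two_lt_top_iff _) (hatNormSq_two_lt_top_iff _)

lemma inDomain_iff (X : State) : X.InDomain ↔
    Summable (fun k => (1 + wave k ⬝ᵥ wave k) ^ 2 * nsq (velocity (coeff X.1 k))) ∧
    Summable (fun k => (1 + wave k ⬝ᵥ wave k) ^ 2 * nsq (spin (coeff X.1 k))) :=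
  and_congr (hatNormSq_two_lt_top_iff _) (hatNormSq_two_lt_top_iff _)

/-- The elliptic estimate gives necessity. For sufficiency the converse estimate makes the candidate
coefficients square summable, and Riesz–Fischer yields the image. -/
lemma exists_isLin_iff (hnu : 0 < P.nu) (hlam : P.nu < P.lam) (hmu : 0 < P.mu)
    (hkappa : 0 < P.kappa) (halpha : 0 < P.alpha + 4 * P.beta / 3)
    (hgamma : 0 < P.beta + P.gamma) (X : State) :
    (∃ X', P.IsLin X X') ↔ X.InLerayDomain := by
  have hnn : ∀ (k : Fin 3 → ℤ) (z : Fin 3 → ℂ), 0 ≤ (1 + wave k ⬝ᵥ wave k) ^ 2 * nsq z :=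
    fun k z => mul_nonneg (sq_nonneg _) (nsq_nonneg _)
  rw [inLerayDomain_iff]
  constructor
  · rintro ⟨X', hX', -, -⟩
    obtain ⟨C, hC⟩ := exists_elliptic_bound P hnu hlam hmu hkappa halpha hgamma
    have hsum : Summable fun k => C * (nsq (coeff X.1 k)
        + nsq (P.symbolB (wave k) *ᵥ coeff X.1 k)) := by
      refine ((hasSum_nsq_coeff X.1).summable.add ?_).mul_left C
      refine (hasSum_nsq_coeff X'.1).summable.congr fun k => ?_
      exact congrArg nsq (hX' k)
    exact ⟨hsum.of_nonneg_of_le (fun k => hnn k _) fun k => (hC (wave k) (coeff X.1 k)).1,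
      hsum.of_nonneg_of_le (fun k => hnn k _) fun k => (hC (wave k) (coeff X.1 k)).2⟩
  · rintro ⟨hu, hw⟩
    obtain ⟨C, hC⟩ := exists_nsq_symbolB_le P hnu hlam
    have hsum : Summable fun k => nsq (P.symbolB (wave k) *ᵥ coeff X.1 k) :=
      (((hu.add hw).add (hasSum_nsq_coeff X.1).summable).mul_left C).of_nonneg_of_le
        (fun k => nsq_nonneg _) fun k => hC (wave k) (coeff X.1 k)
    obtain ⟨g, hg⟩ := exists_coeff_eq _ hsum fun k i => by
      rw [wave_neg, symbolB_neg, ← map_conj_mulVec]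
      congr 2
      funext j
      exact coeff_neg_wave X.1 k j
    exact ⟨(g, P.bracket.compLp X.2.1, 0), fun k => congrFun hg k, rfl, rfl⟩

lemma State.InDomain.inLerayDomain {X : State} (hX : X.InDomain) : X.InLerayDomain := by
  rw [inDomain_iff] at hX
  rw [inLerayDomain_iff]
  refine ⟨hX.1.of_nonneg_of_le (fun k => mul_nonneg (sq_nonneg _) (nsq_nonneg _)) fun k => ?_, hX.2⟩
  exact mul_le_mul_of_nonneg_left (nsq_projPerp_le _ _) (sq_nonneg _)

lemma inLerayDomain_iff_inDomain {X : State} (hX : Incompressible X.u) :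
    X.InLerayDomain ↔ X.InDomain := by
  rw [inDomain_iff, inLerayDomain_iff]
  simp only [toC_projPerp_mulVec_of_dotC_eq_zero _ ((incompressible_iff X).mp hX _)]

end Domain

/-! ### Growth bounds for the flow in `L²` and in Sobolev norms -/

section Growth

variable {P : Params} {S : ℝ≥0 → L2 Idx →L[ℝ] L2 Idx} {D : ℝ}

lemma norm_sq_le_of_nsq_coeff_le {n : Type} [Fintype n] {f g : L2 n}
    (h : ∀ k, nsq (coeff g k) ≤ D * nsq (coeff f k)) : ‖g‖ ^ 2 ≤ D * ‖f‖ ^ 2 :=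
  hasSum_le h (hasSum_nsq_coeff g) ((hasSum_nsq_coeff f).mul_left D)

lemma l2NormSq_flow_le (hD : 1 ≤ D) (t : ℝ≥0) (X : State)
    (h : ∀ k, nsq (coeff (S t X.1) k) ≤ D * nsq (coeff X.1 k)) :
    (flow P S t X).l2NormSq ≤ D * X.l2NormSq := by
  have h1 : ‖S t X.1‖ ^ 2 ≤ D * ‖X.1‖ ^ 2 := norm_sq_le_of_nsq_coeff_le h
  have h2 : ‖(flow P S t X).2.1‖ ^ 2 ≤ ‖X.2.1‖ ^ 2 :=
    pow_le_pow_left₀ (norm_nonneg _) (norm_exp_bracket_compLp_le P t X.2.1) 2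
  have h3 : (flow P S t X).l2NormSq
      = ‖S t X.1‖ ^ 2 + ‖(flow P S t X).2.1‖ ^ 2 + ‖X.2.2‖ ^ 2 := rfl
  rw [h3, State.l2NormSq, mul_add, mul_add]
  have h4 := le_mul_of_one_le_left (sq_nonneg ‖X.2.1‖) hD
  have h5 := le_mul_of_one_le_left (sq_nonneg ‖X.2.2‖) hD
  linarith

/-- The bound holds for each mode, so the Sobolev weights factor out and the constant does not
depend on `p`, `q`, `r`. The components `J̄` and `J₃₃` do not grow, and `1 ≤ D` lets them share the
constant. -/
lemma hNormSq_flow_le (hD : 1 ≤ D) (t : ℝ≥0) (X : State)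
    (h : ∀ k, nsq (coeff (S t X.1) k) ≤ D * nsq (coeff X.1 k)) (p q r : ℝ) :
    (flow P S t X).hNormSq p q r ≤ ENNReal.ofReal D * X.hNormSq p q r := by
  have hD0 : 0 ≤ D := zero_le_one.trans hD
  unfold State.hNormSq
  rw [mul_add, mul_add]
  refine add_le_add (add_le_add ?_ ?_) ?_
  · exact hatNormSq_le p hD0 h
  · refine hatNormSq_le q hD0 fun k => ?_
    refine (nsq_coeff_compLp_le (NormedSpace.exp ((t : ℝ) • P.bracket))
      (fun v => (norm_exp_bracket P t v).le) X.2.1 k).trans ?_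
    exact le_mul_of_one_le_left (nsq_nonneg _) hD
  · exact hatNormSq_le r hD0 fun k => le_mul_of_one_le_left (nsq_nonneg _) hD

end Growth

lemma incompressible_flow {P : Params} {S : ℝ≥0 → L2 Idx →L[ℝ] L2 Idx}
    (hS : ∀ (t : ℝ≥0) f k, coeff (S t f) k
      = NormedSpace.exp (((t : ℝ) : ℂ) • P.symbolB (wave k)) *ᵥ coeff f k)
    {X : State} (hX : Incompressible X.u) (t : ℝ≥0) : Incompressible (flow P S t X).u := by
  rw [incompressible_iff] at hX ⊢
  intro k
  change dotC (wave k) (velocity (coeff (S t X.1) k)) = 0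
  rw [hS, dotC_velocity_exp_symbolB, hX]

end Micropolar
theorem mainTheorem8 (P : Micropolar.Params)
    (hnu : 0 < P.nu) (hlam : P.nu < P.lam) (hmu : 0 < P.mu) (hkappa : 0 < P.kappa)
    (halpha : 0 < P.alpha + 4 * P.beta / 3) (hgamma : 0 < P.beta + P.gamma) (htau : 0 < P.tau) :
    -- `η` is the largest real part of the eigenvalues of the `M_k`
    ∃ η : ℝ, 0 < η ∧ IsGreatest P.growthRates η ∧
    -- the operators `e^{tL}` are well defined and bounded on `L²`
    ∃ S : ℝ≥0 → Micropolar.State →L[ℝ] Micropolar.State,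
      (∀ (t : ℝ≥0) (X X' : Micropolar.State), P.IsFlow (t : ℝ) X X' ↔ X' = S t X) ∧
      -- they form a semigroup
      Micropolar.IsC0Semigroup S ∧
      -- whose generator is `L`
      (∀ X X', Micropolar.GeneratorMaps S X X' ↔ P.IsLin X X') ∧
      -- with the domain given by `H²` for `ω` and for the Leray projection of `u`
      (∀ X, (∃ X', Micropolar.GeneratorMaps S X X') ↔ X.InLerayDomain) ∧
      -- which contains `𝔇`, and is `𝔇` as far as incompressible velocities are concerned
      (∀ X : Micropolar.State, X.InDomain → ∃ X', Micropolar.GeneratorMaps S X X') ∧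
      (∀ X : Micropolar.State, Micropolar.Incompressible X.u →
        ((∃ X', Micropolar.GeneratorMaps S X X') ↔ X.InDomain)) ∧
      -- growth bounds on `L²` and on all `H^{p,q,r}`
      (∀ ε : ℝ, 0 < ε → ∃ C : ℝ, 0 < C ∧
        (∀ t X, (S t X).l2NormSq
          ≤ C ^ 2 * Real.exp (2 * (η + ε) * (t : ℝ)) * Micropolar.State.l2NormSq X) ∧
        ∀ p q r : ℝ, 0 ≤ p → 0 ≤ q → 0 ≤ r → ∀ t X, Micropolar.State.hNormSq p q r X < ⊤ →
          (S t X).hNormSq p q r < ⊤ ∧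
          (S t X).hNormSq p q r
            ≤ ENNReal.ofReal (C ^ 2 * Real.exp (2 * (η + ε) * (t : ℝ)))
              * Micropolar.State.hNormSq p q r X) ∧
      -- incompressibility is propagated
      (∀ X : Micropolar.State, Micropolar.Incompressible X.u →
        ∀ t, Micropolar.Incompressible (S t X).u) := by
  have hd : 0 < P.speed := div_pos htau (by positivity)
  obtain ⟨η, hη, hmax⟩ :=
    Micropolar.exists_isGreatest_growthRates P hnu hlam hmu hkappa halpha hgamma hd
  -- The value `ε = 1` is arbitrary: it serves only to construct the semigroup. The bound for a
  -- given `ε` is applied to the same operators afterwards.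
  obtain ⟨C₁, hC₁, hb₁⟩ := Micropolar.exists_uniform_growth_bound P hnu hlam hmu hkappa halpha
    hgamma hd hη hmax one_pos
  obtain ⟨S, hS, hC0, hgen⟩ := Micropolar.exists_multiplier_semigroup
    (fun k => P.symbolB (Micropolar.wave k))
    (fun k => by rw [Micropolar.wave_neg, Micropolar.symbolB_neg])
    (zero_le_one.trans hC₁) (by positivity : 0 ≤ η + 1) hb₁
  have hlin := Micropolar.generatorMaps_flow_iff hgen
  have hdom : ∀ X, (∃ X', Micropolar.GeneratorMaps (Micropolar.flow P S) X X')
      ↔ X.InLerayDomain := by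
    intro X
    simp only [hlin]
    exact Micropolar.exists_isLin_iff hnu hlam hmu hkappa halpha hgamma X
  refine ⟨η, hη, hmax, Micropolar.flow P S, Micropolar.isFlow_iff hS,
    Micropolar.isC0Semigroup_flow hC0, hlin, hdom, fun X hX => (hdom X).mpr hX.inLerayDomain,
    fun X hX => (hdom X).trans (Micropolar.inLerayDomain_iff_inDomain hX), ?_,
    fun X hX t => Micropolar.incompressible_flow hS hX t⟩
  intro ε hε
  obtain ⟨C, hC, hb⟩ := Micropolar.exists_uniform_growth_bound P hnu hlam hmu hkappa halpha
    hgamma hd hη hmax hε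
  have hexp : ∀ t : ℝ≥0, (C * Real.exp ((η + ε) * t)) ^ 2
      = C ^ 2 * Real.exp (2 * (η + ε) * t) := by
    intro t
    rw [mul_pow, ← Real.exp_nat_mul]
    push_cast
    ring_nf
  have hone : ∀ t : ℝ≥0, 1 ≤ C ^ 2 * Real.exp (2 * (η + ε) * t) := fun t =>
    one_le_mul_of_one_le_of_one_le (one_le_pow₀ hC) (Real.one_le_exp (by positivity))
  have hmode : ∀ (t : ℝ≥0) f k, Micropolar.nsq (Micropolar.coeff (S t f) k)
      ≤ C ^ 2 * Real.exp (2 * (η + ε) * t) * Micropolar.nsq (Micropolar.coeff f k) := by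
    intro t f k
    rw [hS, ← hexp]
    exact hb k t t.2 _
  refine ⟨C, zero_lt_one.trans_le hC,
    fun t X => Micropolar.l2NormSq_flow_le (hone t) t X (hmode t X.1), ?_⟩
  intro p q r _ _ _ t X hX
  have h := Micropolar.hNormSq_flow_le (P := P) (hone t) t X (hmode t X.1) p q r
  exact ⟨h.trans_lt (ENNReal.mul_lt_top ENNReal.ofReal_lt_top hX), h⟩
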